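/- Let $\alpha(y_1,\dots,y_n)$ denote the alphabetic minimax cost of real numbers $y_1,\dots,y_n$, that is, the minimum, over all ordered binary trees with $n$ leaves, of $\max_{1\le i\le n}(y_i+\ell_i)$, where $\ell_1,\dots,\ell_n$ are the depths of the leaves from left to right. Let $W=w_1,\dots,w_n$ ($n\ge 1$) be real weights and let $d$ be the number of distinct integers among $\lceil w_1\rceil,\dots,\lceil w_n\rceil$. In $O(n)$ time one can build a data structure that stores $W$ and a bit vector $X=x_1,\dots,x_n$, initially $0,\dots,0$, and that performs any (online) sequence of $O(n)$ of the following operations in $O(n\,d\,\max\{1,\log_2\log_2 n\})$ total time (where $\max\{1,\log_2\log_2 n\}$ means $1$ if $n=1$): - set$(i)$: set $x_i$ to $1$; - undo: undo the last set operation that has not been undone yet (with no effect if there is none); - cost: return $\alpha(\lceil w_1\rceil-x_1,\dots,\lceil w_n\rceil-x_n)$. The programs and the constant in the building time do not depend on $n$, $W$ or the operations. For every $c$, the constant in the bound for sequences of at most $cn$ operations depends only on $c$. The model of computation is a unit-cost random access machine with integer words of $O(\log n)$ bits (the constant may depend on $c$), under $+$, truncated $-$, $\times$, integer division, comparison and use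 as addresses, and with real-valued cells, on which it can perform $+$, $-$, comparison and rounding up to an integer, and into which words can be converted; all memory other than the input is initially zero. -/

import Mathlib

/-! ### Alphabetic minimax trees (binary case) -/

/-- Ordered binary trees: every internal node has one child or two (left and right) children. -/
inductive OTree : Type
  | leaf : OTree
  | unary : OTree → OTree
  | binary : OTree → OTree → OTree

/-- The depths of the leaves, from left to right. -/
def OTree.depths : OTree → List ℕ
  | .leaf => [0]
  | .unary s => s.depths.map (· + 1)
  | .binary l r => (l.depths ++ r.depths).map (· + 1)

/-- `m` is the maximum of `w i + ℓ i`, where `ℓ` lists the leaf depths of a tree `T` on `n` leaves. -/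
def OTree.HasCost {n : ℕ} (T : OTree) (w : Fin n → ℝ) (m : ℝ) : Prop :=
  ∃ h : T.depths.length = n,
    IsGreatest (Set.range fun i : Fin n => w i + ((T.depths.get (i.cast h.symm) : ℕ) : ℝ)) m

/-- `a` is the alphabetic minimax cost `α(w)`: the least cost of an ordered binary tree
on `n` leaves. -/
def IsMinimaxCost {n : ℕ} (w : Fin n → ℝ) (a : ℝ) : Prop :=
  IsLeast {m : ℝ | ∃ T : OTree, T.HasCost w m} a

/-! ### The machine: a word RAM that also has real registers

Programs are built from assignments, sequencing, conditionals and loops.  A program mentions finitely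
many word registers, word arrays, real registers and real arrays.  Words are natural numbers at
most `B`; a computation in which a word would exceed `B` gets stuck.  Reals can only be added,
subtracted, compared and rounded up, and a word can be converted to a real. Every operation of an
expression and every command executed costs one unit of time. -/

/-- The memory contents: word registers, word arrays, real registers, real arrays. -/
structure RamState : Type where
  nv : ℕ → ℕ
  na : ℕ → ℕ → ℕ
  rv : ℕ → ℝ
  ra : ℕ → ℕ → ℝ

namespace RamState

def setNV (σ : RamState) (v x : ℕ) : RamState :=
  { σ with nv := Function.update σ.nv v x }

def setNA (σ : RamState) (a i x : ℕ) : RamState :=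
  { σ with na := Function.update σ.na a (Function.update (σ.na a) i x) }

noncomputable def setRV (σ : RamState) (v : ℕ) (x : ℝ) : RamState :=
  { σ with rv := Function.update σ.rv v x }

noncomputable def setRA (σ : RamState) (a i : ℕ) (x : ℝ) : RamState :=
  { σ with ra := Function.update σ.ra a (Function.update (σ.ra a) i x) }

end RamState

/-- Word expressions; `sub` is truncated at zero, `div` rounds down. -/
inductive NExp : Type
  | lit : ℕ → NExp
  | var : ℕ → NExp
  | arr : ℕ → NExp → NExp
  | add : NExp → NExp → NExp
  | sub : NExp → NExp → NExp
  | mul : NExp → NExp → NExp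
  | div : NExp → NExp → NExp

namespace NExp

def eval (σ : RamState) : NExp → ℕ
  | lit k => k
  | var v => σ.nv v
  | arr a e => σ.na a (e.eval σ)
  | add e f => e.eval σ + f.eval σ
  | sub e f => e.eval σ - f.eval σ
  | mul e f => e.eval σ * f.eval σ
  | div e f => e.eval σ / f.eval σ

/-- All values that occur in the evaluation are at most `B`. -/
def Fits (B : ℕ) (σ : RamState) : NExp → Prop
  | lit k => k ≤ B
  | var v => σ.nv v ≤ B
  | arr a e => e.Fits B σ ∧ σ.na a (e.eval σ) ≤ B
  | add e f => e.Fits B σ ∧ f.Fits B σ ∧ e.eval σ + f.eval σ ≤ B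
  | sub e f => e.Fits B σ ∧ f.Fits B σ
  | mul e f => e.Fits B σ ∧ f.Fits B σ ∧ e.eval σ * f.eval σ ≤ B
  | div e f => e.Fits B σ ∧ f.Fits B σ

/-- The time to evaluate an expression: the number of its nodes. -/
def time : NExp → ℕ
  | lit _ => 1
  | var _ => 1
  | arr _ e => e.time + 1
  | add e f => e.time + f.time + 1
  | sub e f => e.time + f.time + 1
  | mul e f => e.time + f.time + 1
  | div e f => e.time + f.time + 1

end NExp

/-- Real expressions. -/
inductive RExp : Type
  | ofWord : NExp → RExp
  | var : ℕ → RExp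
  | arr : ℕ → NExp → RExp
  | add : RExp → RExp → RExp
  | sub : RExp → RExp → RExp
  | ceil : RExp → RExp

namespace RExp

noncomputable def eval (σ : RamState) : RExp → ℝ
  | ofWord e => (e.eval σ : ℝ)
  | var v => σ.rv v
  | arr a e => σ.ra a (e.eval σ)
  | add e f => e.eval σ + f.eval σ
  | sub e f => e.eval σ - f.eval σ
  | ceil e => (⌈e.eval σ⌉ : ℝ)

def Fits (B : ℕ) (σ : RamState) : RExp → Prop
  | ofWord e => e.Fits B σ
  | var _ => True
  | arr _ e => e.Fits B σ
  | add e f => e.Fits B σ ∧ f.Fits B σ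
  | sub e f => e.Fits B σ ∧ f.Fits B σ
  | ceil e => e.Fits B σ

def time : RExp → ℕ
  | ofWord e => e.time + 1
  | var _ => 1
  | arr _ e => e.time + 1
  | add e f => e.time + f.time + 1
  | sub e f => e.time + f.time + 1
  | ceil e => e.time + 1

end RExp

/-- Tests: comparisons of words and of reals, and Boolean combinations. -/
inductive BExp : Type
  | neq : NExp → NExp → BExp
  | nle : NExp → NExp → BExp
  | req : RExp → RExp → BExp
  | rle : RExp → RExp → BExp
  | not : BExp → BExp
  | and : BExp → BExp → BExp

namespace BExp

/-- `neq` and `req` test for equality. -/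
def Holds (σ : RamState) : BExp → Prop
  | neq e f => e.eval σ = f.eval σ
  | nle e f => e.eval σ ≤ f.eval σ
  | req e f => e.eval σ = f.eval σ
  | rle e f => e.eval σ ≤ f.eval σ
  | not b => ¬ b.Holds σ
  | and b c => b.Holds σ ∧ c.Holds σ

def Fits (B : ℕ) (σ : RamState) : BExp → Prop
  | neq e f => e.Fits B σ ∧ f.Fits B σ
  | nle e f => e.Fits B σ ∧ f.Fits B σ
  | req e f => e.Fits B σ ∧ f.Fits B σ
  | rle e f => e.Fits B σ ∧ f.Fits B σ
  | not b => b.Fits B σ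
  | and b c => b.Fits B σ ∧ c.Fits B σ

def time : BExp → ℕ
  | neq e f => e.time + f.time + 1
  | nle e f => e.time + f.time + 1
  | req e f => e.time + f.time + 1
  | rle e f => e.time + f.time + 1
  | not b => b.time + 1
  | and b c => b.time + c.time + 1

end BExp

/-- Programs. -/
inductive Cmd : Type
  | skip : Cmd
  | nset : ℕ → NExp → Cmd
  | nstore : ℕ → NExp → NExp → Cmd
  | rset : ℕ → RExp → Cmd
  | rstore : ℕ → NExp → RExp → Cmd
  | seq : Cmd → Cmd → Cmd
  | ite : BExp → Cmd → Cmd → Cmd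
  | loop : BExp → Cmd → Cmd

/-- `Exec B p σ t σ'`: with words at most `B`, the program `p` started in the memory `σ`
halts after exactly `t` units of time and leaves the memory `σ'`. -/
inductive Exec (B : ℕ) : Cmd → RamState → ℕ → RamState → Prop
  | skip (σ : RamState) : Exec B Cmd.skip σ 1 σ
  | nset (σ : RamState) (v : ℕ) (e : NExp) (he : e.Fits B σ) :
      Exec B (Cmd.nset v e) σ (e.time + 1) (σ.setNV v (e.eval σ))
  | nstore (σ : RamState) (a : ℕ) (i e : NExp) (hi : i.Fits B σ) (he : e.Fits B σ) :
      Exec B (Cmd.nstore a i e) σ (i.time + e.time + 1) (σ.setNA a (i.eval σ) (e.eval σ))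
  | rset (σ : RamState) (v : ℕ) (e : RExp) (he : e.Fits B σ) :
      Exec B (Cmd.rset v e) σ (e.time + 1) (σ.setRV v (e.eval σ))
  | rstore (σ : RamState) (a : ℕ) (i : NExp) (e : RExp) (hi : i.Fits B σ) (he : e.Fits B σ) :
      Exec B (Cmd.rstore a i e) σ (i.time + e.time + 1) (σ.setRA a (i.eval σ) (e.eval σ))
  | seq (p q : Cmd) (σ σ' σ'' : RamState) (s t : ℕ)
      (hp : Exec B p σ s σ') (hq : Exec B q σ' t σ'') :
      Exec B (Cmd.seq p q) σ (s + t) σ''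
  | iteTrue (b : BExp) (p q : Cmd) (σ σ' : RamState) (t : ℕ)
      (hf : b.Fits B σ) (hb : b.Holds σ) (hp : Exec B p σ t σ') :
      Exec B (Cmd.ite b p q) σ (b.time + 1 + t) σ'
  | iteFalse (b : BExp) (p q : Cmd) (σ σ' : RamState) (t : ℕ)
      (hf : b.Fits B σ) (hb : ¬ b.Holds σ) (hq : Exec B q σ t σ') :
      Exec B (Cmd.ite b p q) σ (b.time + 1 + t) σ'
  | loopTrue (b : BExp) (p : Cmd) (σ σ' σ'' : RamState) (s t : ℕ)
      (hf : b.Fits B σ) (hb : b.Holds σ) (hp : Exec B p σ s σ')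
      (hl : Exec B (Cmd.loop b p) σ' t σ'') :
      Exec B (Cmd.loop b p) σ (b.time + 1 + s + t) σ''
  | loopFalse (b : BExp) (p : Cmd) (σ : RamState)
      (hf : b.Fits B σ) (hb : ¬ b.Holds σ) :
      Exec B (Cmd.loop b p) σ (b.time + 1) σ

/-! ### The dynamic problem -/

/-- The operations: set the bit `x i` to one, undo the last set operation that has not yet been
undone, report the cost. -/
inductive Op (n : ℕ) : Type
  | setBit : Fin n → Op n
  | undo : Op n
  | cost : Op n

/-- The effect of an operation on the list of the set operations that have not been undone, latest
first.  An `undo` without a set operation to undo has no effect. -/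
def Op.apply {n : ℕ} : Op n → List (Fin n) → List (Fin n)
  | .setBit i, H => i :: H
  | .undo, H => H.tail
  | .cost, H => H

/-- The bit vector that results from the set operations in `H`. -/
def bitOf {n : ℕ} (H : List (Fin n)) (i : Fin n) : ℕ := if i ∈ H then 1 else 0

/-- The number `d` of distinct integers `⌈w i⌉`. -/
noncomputable def numCeil {n : ℕ} (w : Fin n → ℝ) : ℕ :=
  (Finset.univ.image fun i => ⌈w i⌉).card

/-- A data structure: the program that builds it and one program for each kind of operation. -/
structure DataStructure : Type where
  buildP : Cmd
  setP : Cmd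
  undoP : Cmd
  costP : Cmd

/-- The input: `n` in word register 0, the weights in real array 0, zero elsewhere. -/
noncomputable def inputState {n : ℕ} (w : Fin n → ℝ) : RamState where
  nv := fun v => if v = 0 then n else 0
  na := fun _ _ => 0
  rv := fun _ => 0
  ra := fun a j => if h : a = 0 ∧ j < n then w ⟨j, h.2⟩ else 0

/-- The memory holds the weights in real array 0 and the bit vector in word array 0. -/
def Stores {n : ℕ} (w : Fin n → ℝ) (H : List (Fin n)) (σ : RamState) : Prop :=
  ∀ i : Fin n, σ.ra 0 i = w i ∧ σ.na 0 i = bitOf H i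

/-- Execution of one operation. The argument of a set operation is put into word register 1. -/
def ExecOp (B : ℕ) (D : DataStructure) {n : ℕ} (o : Op n) (σ : RamState) (t : ℕ)
    (σ' : RamState) : Prop :=
  match o with
  | .setBit i => Exec B D.setP (σ.setNV 1 i) t σ'
  | .undo => Exec B D.undoP σ t σ'
  | .cost => Exec B D.costP σ t σ'

/-- The answer to a `cost` operation, in real register 0, is right. -/
def AnswerOK {n : ℕ} (w : Fin n → ℝ) (H : List (Fin n)) (o : Op n) (σ' : RamState) : Prop :=
  match o with
  | .setBit _ => True
  | .undo => True
  | .cost => IsMinimaxCost (fun i => (⌈w i⌉ : ℝ) - (bitOf H i : ℝ)) (σ'.rv 0)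

/-- `Serves B D w H σ ops T`: from the memory `σ`, in which the list of set operations in force is
`H`, the data structure performs the operations `ops` one after the other, correctly and in total
time `T`. -/
inductive Serves (B : ℕ) (D : DataStructure) {n : ℕ} (w : Fin n → ℝ) :
    List (Fin n) → RamState → List (Op n) → ℕ → Prop
  | nil (H : List (Fin n)) (σ : RamState) (hs : Stores w H σ) : Serves B D w H σ [] 0
  | cons (H : List (Fin n)) (σ σ' : RamState) (o : Op n) (ops : List (Op n)) (t T : ℕ)
      (hs : Stores w H σ) (he : ExecOp B D o σ t σ') (ha : AnswerOK w H o σ')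
      (hr : Serves B D w (o.apply H) σ' ops T) :
      Serves B D w H σ (o :: ops) (t + T)

/-!
# Dynamic alphabetic minimax trees

**The cost.** Write `u i` for the weights rounded up. For integer weights `a + e i` with `e i : ℕ`, an
ordered tree with leaf depths `m - e i` exists if and only if dyadic intervals of the lengths `2 ^ e i`
can be placed one after the other in an interval of length `2 ^ m`; it suffices to try the greedy
placement, each interval as far to the left as alignment permits (`gr`, `isMinimaxCost_of_gr`). So the
cost is the logarithm, rounded up, of the end of the greedy placement.

**The levels.** The thresholds are the values that a weight can take, `u i` and `u i - 1`; there are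
`m ≤ 2 * d` of them, and items are represented by threshold numbers `v`. At level `r`, the items with
`r ≤ v x` are separators, and `run f r v a b` is the length of the greedy placement of the run `[a, b)`
between two separators, rounded up to a multiple of the unit, the threshold before number `r`, and
counted in this unit. Two facts make these counts easy to maintain. Counts are additive at an item as
long as the unit, and the counts of the next level are sums of those of this level, each divided by the
ratio of the units and rounded up. So when an item is lowered by one threshold, a single run of each
level is affected, and a pair of numbers, the old and the new contribution of the affected run to
the next level, is all that has to be carried upwards (`Carry`, `Carry.run_eq`, `Carry.succ`). The cost
follows from the last counts of the two highest levels (`cost_eq`).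

**The search.** To find the run that contains the item, each level keeps its separators in a
stratified tree (van Emde Boas), of which only deletions and searches for a neighbour are needed. It is
laid out in coordinates relative to the whole universe (prefixes and resolutions), in such a way that
memory filled with zeros represents the full set, and a deletion writes one cell for each of the `K`
ranks, where `K` is about `log log n` (`vebDel_spec`, `vebFind_spec`). Every level thus costs
`O(K)` time, and a set operation `O(d * K)` (`run_lowerP`).

**Undoing.** All cells are in one word array, and all writes to it go through a log. An undo
operation rolls the log back to where it was before the set operation, in time proportional to that
of the operation (`Chain`, `run_popP`).

**Initialization.** The building program rounds the weights and computes tables in linear time. The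
levels start from zero memory, with all items at the highest threshold number; the first operation
finds the thresholds and lowers every item to its own, in time `O(n * d * K)` (`run_initP`).

**Memory layout.** Word registers `0` to `7` hold `n`, the argument, the flag of initialization, `K`, the
base `2 * bsz K` of addresses, `m`, the length of the log and the number of set operations in force;
the others are scratch. Word array `0` holds `X`, array `1` the cells of the levels, arrays `2` and `3`
the log (addresses and old values), arrays `4`, `5` and `11` the stack of set operations (item, length
of the log and bit before the operation), arrays `6` to `9` the tables of universe sizes, logarithms,
threshold numbers of the items and ratios of units, and array `10` the path of a search. Real registers
`1` and `2` hold the greatest and the least rounded weight, real array `1` the rounded weights.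

Correctness and running times of programs are shown together, through the predicate `Run`.
-/


/-! ### Weakest preconditions with running times -/

open NExp (var lit arr)

instance : Add NExp := ⟨NExp.add⟩
instance : Sub NExp := ⟨NExp.sub⟩
instance : Mul NExp := ⟨NExp.mul⟩
instance : Div NExp := ⟨NExp.div⟩
instance : Add RExp := ⟨RExp.add⟩
instance : Sub RExp := ⟨RExp.sub⟩

section Simp
variable (σ : RamState) (B : ℕ) (e f : NExp) (a b : RExp) (v i x k : ℕ) (y : ℝ)

@[simp] theorem eval_add : (e + f).eval σ = e.eval σ + f.eval σ := rfl
@[simp] theorem eval_sub : (e - f).eval σ = e.eval σ - f.eval σ := rfl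
@[simp] theorem eval_mul : (e * f).eval σ = e.eval σ * f.eval σ := rfl
@[simp] theorem eval_div : (e / f).eval σ = e.eval σ / f.eval σ := rfl
@[simp] theorem eval_lit : (lit k).eval σ = k := rfl
@[simp] theorem eval_var : (var v).eval σ = σ.nv v := rfl
@[simp] theorem eval_arr : (arr v e).eval σ = σ.na v (e.eval σ) := rfl
@[simp] theorem time_add : (e + f).time = e.time + f.time + 1 := rfl
@[simp] theorem time_sub : (e - f).time = e.time + f.time + 1 := rfl
@[simp] theorem time_mul : (e * f).time = e.time + f.time + 1 := rfl
@[simp] theorem time_div : (e / f).time = e.time + f.time + 1 := rfl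
@[simp] theorem fits_add : (e + f).Fits B σ ↔
    e.Fits B σ ∧ f.Fits B σ ∧ e.eval σ + f.eval σ ≤ B := Iff.rfl
@[simp] theorem fits_sub : (e - f).Fits B σ ↔ e.Fits B σ ∧ f.Fits B σ := Iff.rfl
@[simp] theorem fits_mul : (e * f).Fits B σ ↔
    e.Fits B σ ∧ f.Fits B σ ∧ e.eval σ * f.eval σ ≤ B := Iff.rfl
@[simp] theorem fits_div : (e / f).Fits B σ ↔ e.Fits B σ ∧ f.Fits B σ := Iff.rfl
@[simp] theorem fits_lit : (lit k).Fits B σ ↔ k ≤ B := Iff.rfl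
@[simp] theorem fits_var : (var v).Fits B σ ↔ σ.nv v ≤ B := Iff.rfl
@[simp] theorem fits_arr : (arr v e).Fits B σ ↔ e.Fits B σ ∧ σ.na v (e.eval σ) ≤ B := Iff.rfl

@[simp] theorem reval_add : (a + b).eval σ = a.eval σ + b.eval σ := rfl
@[simp] theorem reval_sub : (a - b).eval σ = a.eval σ - b.eval σ := rfl
@[simp] theorem rtime_add : (a + b).time = a.time + b.time + 1 := rfl
@[simp] theorem rtime_sub : (a - b).time = a.time + b.time + 1 := rfl
@[simp] theorem rfits_add : (a + b).Fits B σ ↔ a.Fits B σ ∧ b.Fits B σ := Iff.rfl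
@[simp] theorem rfits_sub : (a - b).Fits B σ ↔ a.Fits B σ ∧ b.Fits B σ := Iff.rfl

attribute [simp] NExp.time RExp.time BExp.time RExp.eval RExp.Fits BExp.Holds BExp.Fits

@[simp] theorem nv_setNV (u : ℕ) : (σ.setNV v x).nv u = if u = v then x else σ.nv u := by
  simp [RamState.setNV, Function.update_apply]
@[simp] theorem na_setNV : (σ.setNV v x).na = σ.na := rfl
@[simp] theorem rv_setNV : (σ.setNV v x).rv = σ.rv := rfl
@[simp] theorem ra_setNV : (σ.setNV v x).ra = σ.ra := rfl
@[simp] theorem nv_setNA : (σ.setNA v i x).nv = σ.nv := rfl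
@[simp] theorem na_setNA (u : ℕ) : (σ.setNA v i x).na u =
    if u = v then Function.update (σ.na v) i x else σ.na u := by
  simp [RamState.setNA, Function.update_apply]
@[simp] theorem rv_setNA : (σ.setNA v i x).rv = σ.rv := rfl
@[simp] theorem ra_setNA : (σ.setNA v i x).ra = σ.ra := rfl
@[simp] theorem nv_setRV : (σ.setRV v y).nv = σ.nv := rfl
@[simp] theorem na_setRV : (σ.setRV v y).na = σ.na := rfl
@[simp] theorem rv_setRV (u : ℕ) : (σ.setRV v y).rv u = if u = v then y else σ.rv u := by
  simp [RamState.setRV, Function.update_apply]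
@[simp] theorem ra_setRV : (σ.setRV v y).ra = σ.ra := rfl
@[simp] theorem nv_setRA : (σ.setRA v i y).nv = σ.nv := rfl
@[simp] theorem na_setRA : (σ.setRA v i y).na = σ.na := rfl
@[simp] theorem rv_setRA : (σ.setRA v i y).rv = σ.rv := rfl
@[simp] theorem ra_setRA (u : ℕ) : (σ.setRA v i y).ra u =
    if u = v then Function.update (σ.ra v) i y else σ.ra u := by
  simp [RamState.setRA, Function.update_apply]
end Simp

/-- `Run B p σ Q`: with words at most `B`, the program `p` started in `σ` halts, and its running
time and its final memory satisfy `Q`. -/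
def Run (B : ℕ) (p : Cmd) (σ : RamState) (Q : ℕ → RamState → Prop) : Prop :=
  ∃ t σ', Exec B p σ t σ' ∧ Q t σ'

section Run
variable {B : ℕ} {σ : RamState} {Q : ℕ → RamState → Prop}

theorem Run.mono {p : Cmd} {Q' : ℕ → RamState → Prop} (h : Run B p σ Q')
    (hQ : ∀ t σ', Q' t σ' → Q t σ') : Run B p σ Q := by
  obtain ⟨t, σ', he, hq⟩ := h
  exact ⟨t, σ', he, hQ _ _ hq⟩

@[simp] theorem run_skip : Run B .skip σ Q ↔ Q 1 σ :=
  ⟨by rintro ⟨t, σ', he, hq⟩; cases he; exact hq, fun h => ⟨_, _, .skip σ, h⟩⟩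

@[simp] theorem run_nset {v : ℕ} {e : NExp} : Run B (.nset v e) σ Q ↔
    e.Fits B σ ∧ Q (e.time + 1) (σ.setNV v (e.eval σ)) :=
  ⟨by rintro ⟨t, σ', he, hq⟩; cases he; exact ⟨‹_›, hq⟩, fun h => ⟨_, _, .nset σ v e h.1, h.2⟩⟩

@[simp] theorem run_nstore {a : ℕ} {i e : NExp} : Run B (.nstore a i e) σ Q ↔
    i.Fits B σ ∧ e.Fits B σ ∧ Q (i.time + e.time + 1) (σ.setNA a (i.eval σ) (e.eval σ)) :=
  ⟨by rintro ⟨t, σ', he, hq⟩; cases he; exact ⟨‹_›, ‹_›, hq⟩,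
    fun h => ⟨_, _, .nstore σ a i e h.1 h.2.1, h.2.2⟩⟩

@[simp] theorem run_rset {v : ℕ} {e : RExp} : Run B (.rset v e) σ Q ↔
    e.Fits B σ ∧ Q (e.time + 1) (σ.setRV v (e.eval σ)) :=
  ⟨by rintro ⟨t, σ', he, hq⟩; cases he; exact ⟨‹_›, hq⟩, fun h => ⟨_, _, .rset σ v e h.1, h.2⟩⟩

@[simp] theorem run_rstore {a : ℕ} {i : NExp} {e : RExp} : Run B (.rstore a i e) σ Q ↔
    i.Fits B σ ∧ e.Fits B σ ∧ Q (i.time + e.time + 1) (σ.setRA a (i.eval σ) (e.eval σ)) :=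
  ⟨by rintro ⟨t, σ', he, hq⟩; cases he; exact ⟨‹_›, ‹_›, hq⟩,
    fun h => ⟨_, _, .rstore σ a i e h.1 h.2.1, h.2.2⟩⟩

@[simp] theorem run_seq {p q : Cmd} : Run B (.seq p q) σ Q ↔
    Run B p σ fun t σ' => Run B q σ' fun t' σ'' => Q (t + t') σ'' := by
  constructor
  · rintro ⟨t, σ', he, hq⟩
    cases he with
    | seq _ _ _ σ₁ _ s t hp hq' => exact ⟨s, σ₁, hp, t, _, hq', hq⟩
  · rintro ⟨s, σ₁, hp, t, σ₂, hq, h⟩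
    exact ⟨_, _, .seq p q σ σ₁ σ₂ s t hp hq, h⟩

@[simp] theorem run_ite {b : BExp} {p q : Cmd} : Run B (.ite b p q) σ Q ↔
    b.Fits B σ ∧ (b.Holds σ → Run B p σ fun t σ' => Q (b.time + 1 + t) σ') ∧
      (¬ b.Holds σ → Run B q σ fun t σ' => Q (b.time + 1 + t) σ') := by
  constructor
  · rintro ⟨t, σ', he, hq⟩
    cases he with
    | iteTrue _ _ _ _ _ t hf hb hp => exact ⟨hf, fun _ => ⟨_, _, hp, hq⟩, fun h => absurd hb h⟩
    | iteFalse _ _ _ _ _ t hf hb hp => exact ⟨hf, fun h => absurd h hb, fun _ => ⟨_, _, hp, hq⟩⟩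
  · rintro ⟨hf, h1, h2⟩
    by_cases hb : b.Holds σ
    · obtain ⟨t, σ', he, hq⟩ := h1 hb
      exact ⟨_, _, .iteTrue b p q σ σ' t hf hb he, hq⟩
    · obtain ⟨t, σ', he, hq⟩ := h2 hb
      exact ⟨_, _, .iteFalse b p q σ σ' t hf hb he, hq⟩

/-- The rule for loops: `I j` is the invariant after `j` of the `N` iterations, each of which takes
time at most `c`. -/
theorem run_loop {b : BExp} {p : Cmd} {c : ℕ} (I : ℕ → RamState → Prop) (N : ℕ)
    (hstep : ∀ j < N, ∀ σ, I j σ → b.Fits B σ ∧ b.Holds σ ∧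
      Run B p σ fun t σ' => t ≤ c ∧ I (j + 1) σ')
    (hend : ∀ σ, I N σ → b.Fits B σ ∧ ¬ b.Holds σ) (h0 : I 0 σ) :
    Run B (.loop b p) σ fun t σ' => t ≤ N * (c + b.time + 1) + (b.time + 1) ∧ I N σ' := by
  have key : ∀ k j σ, j + k = N → I j σ →
      Run B (.loop b p) σ fun t σ' => t ≤ k * (c + b.time + 1) + (b.time + 1) ∧ I N σ' := by
    intro k
    induction k with
    | zero =>
      rintro j σ rfl hI
      obtain ⟨hf, hb⟩ := hend σ hI
      exact ⟨_, _, .loopFalse b p σ hf hb, by simp, hI⟩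
    | succ k ih =>
      rintro j σ hj hI
      obtain ⟨hf, hb, t, σ₁, he, ht, hI'⟩ := hstep j (by omega) σ hI
      obtain ⟨t', σ₂, he', ht', hI''⟩ := ih (j + 1) σ₁ (by omega) hI'
      refine ⟨_, _, .loopTrue b p σ σ₁ σ₂ t t' hf hb he he', ?_, hI''⟩
      rw [Nat.succ_mul]
      omega
  exact key N 0 σ (by simp) h0

/-- A list of commands, executed one after the other. -/
def block : List Cmd → Cmd
  | [] => .skip
  | p :: ps => .seq p (block ps)

@[simp] theorem run_block_nil : Run B (block []) σ Q ↔ Q 1 σ := run_skip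
@[simp] theorem run_block_cons {p : Cmd} {ps : List Cmd} : Run B (block (p :: ps)) σ Q ↔
    Run B p σ fun t σ' => Run B (block ps) σ' fun t' σ'' => Q (t + t') σ'' := run_seq

end Run

/-! ### Greedy placement of dyadic intervals -/

/-- `a / b`, rounded up. -/
def cd (a b : ℕ) : ℕ := (a + b - 1) / b

theorem cd_le_iff {a b c : ℕ} (hb : 0 < b) : cd a b ≤ c ↔ a ≤ c * b := by
  unfold cd
  rw [← Nat.lt_succ_iff, Nat.div_lt_iff_lt_mul hb, Nat.succ_mul]
  omega

theorem le_cd_mul {a b : ℕ} (hb : 0 < b) : a ≤ cd a b * b := (cd_le_iff hb).1 le_rfl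

theorem cd_mono {a a' b : ℕ} (hb : 0 < b) (h : a ≤ a') : cd a b ≤ cd a' b :=
  (cd_le_iff hb).2 (h.trans (le_cd_mul hb))

theorem cd_mul {a b : ℕ} (hb : 0 < b) : cd (a * b) b = a :=
  le_antisymm ((cd_le_iff hb).2 le_rfl) (Nat.le_of_mul_le_mul_right (le_cd_mul hb) hb)

theorem cd_mul_add {a b c : ℕ} (hb : 0 < b) : cd (c * b + a) b = c + cd a b := by
  refine eq_of_forall_ge_iff fun d => ?_
  rw [cd_le_iff hb]
  constructor
  · intro h
    have hc : c ≤ d := Nat.le_of_mul_le_mul_right ((Nat.le_add_right _ _).trans h) hb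
    obtain ⟨e, rfl⟩ := Nat.exists_eq_add_of_le hc
    rw [add_mul] at h
    have := (cd_le_iff (a := a) (c := e) hb).2 (by omega)
    omega
  · intro h
    have := le_cd_mul (a := a) hb
    calc c * b + a ≤ c * b + cd a b * b := by omega
      _ = (c + cd a b) * b := by ring
      _ ≤ d * b := Nat.mul_le_mul_right _ h

theorem cd_cd {a b c : ℕ} (hb : 0 < b) (hc : 0 < c) : cd (cd a b) c = cd a (b * c) := by
  refine eq_of_forall_ge_iff fun d => ?_
  rw [cd_le_iff hc, cd_le_iff hb, cd_le_iff (Nat.mul_pos hb hc), mul_assoc, mul_comm c b]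

theorem cd_zero {b : ℕ} (hb : 0 < b) : cd 0 b = 0 := by
  have := (cd_le_iff (a := 0) (c := 0) hb).2 (by simp)
  omega

/-- Dyadic intervals of lengths `2 ^ e`, for `e` in the list, are placed one after the other, each
as far to the left as alignment permits, to the right of `s`; this is the end of the last one. -/
def gr (s : ℕ) (L : List ℕ) : ℕ := L.foldl (fun p e => (cd p (2 ^ e) + 1) * 2 ^ e) s

@[simp] theorem gr_nil (s : ℕ) : gr s [] = s := rfl
@[simp] theorem gr_cons (s e : ℕ) (L : List ℕ) :
    gr s (e :: L) = gr ((cd s (2 ^ e) + 1) * 2 ^ e) L := rfl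
theorem gr_append (s : ℕ) (L L' : List ℕ) : gr s (L ++ L') = gr (gr s L) L' :=
  List.foldl_append

theorem gr_mono {s s' : ℕ} (L : List ℕ) (h : s ≤ s') : gr s L ≤ gr s' L := by
  induction L generalizing s s' with
  | nil => exact h
  | cons e L ih =>
    exact ih (Nat.mul_le_mul_right _ (Nat.add_le_add_right (cd_mono (by positivity) h) 1))

theorem le_gr (s : ℕ) (L : List ℕ) : s ≤ gr s L := by
  induction L generalizing s with
  | nil => exact le_rfl
  | cons e L ih =>
    have h1 := le_cd_mul (a := s) (b := 2 ^ e) (by positivity)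
    have h2 := ih ((cd s (2 ^ e) + 1) * 2 ^ e)
    rw [gr_cons]
    rw [add_mul] at h2
    rw [add_mul]
    omega

/-- Greedy placement commutes with shifts by multiples of `2 ^ q`. -/
theorem gr_shift {q : ℕ} (c s : ℕ) (L : List ℕ) (h : ∀ e ∈ L, e ≤ q) :
    gr (c * 2 ^ q + s) L = c * 2 ^ q + gr s L := by
  induction L generalizing s with
  | nil => rfl
  | cons e L ih =>
    obtain ⟨d, rfl⟩ := Nat.exists_eq_add_of_le (h e (by simp))
    have h2 : c * 2 ^ (e + d) = (c * 2 ^ d) * 2 ^ e := by rw [pow_add]; ring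
    rw [gr_cons, gr_cons, ← ih _ fun e' he => h e' (by simp [he])]
    congr 1
    rw [h2, cd_mul_add (by positivity)]
    ring

theorem pow_le_gr {s e : ℕ} {L : List ℕ} (h : e ∈ L) : s + 2 ^ e ≤ gr s L := by
  induction L generalizing s with
  | nil => simp at h
  | cons e' L ih =>
    rw [gr_cons]
    have h1 := le_cd_mul (a := s) (b := 2 ^ e') (by positivity)
    rcases List.mem_cons.1 h with rfl | h
    · refine le_trans ?_ (le_gr _ _)
      rw [add_mul]; omega
    · refine le_trans ?_ (ih h)
      rw [add_mul]; omega

/-! ### Greedy placement and ordered trees -/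

/-- The leaves of a tree, at depths `ℓ`, are disjoint dyadic intervals of lengths `2 ^ (m - ℓ)`
in an interval of length `2 ^ m`, from left to right; the greedy placement does at least as
well. -/
theorem gr_le_of_tree (T : OTree) (m q : ℕ) (L : List ℕ)
    (h : List.Forall₂ (fun e l => e + l ≤ m) L T.depths) :
    gr (q * 2 ^ m) L ≤ (q + 1) * 2 ^ m := by
  induction T generalizing m q L with
  | leaf =>
    obtain ⟨e, L', he, hL', rfl⟩ := List.forall₂_cons_right_iff.1 h
    obtain rfl := List.forall₂_nil_right_iff.1 hL'
    have he' : e ≤ m := he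
    have := gr_shift (q := m) q 0 [e] (by simpa using he')
    have h2 : (2 : ℕ) ^ e ≤ 2 ^ m := Nat.pow_le_pow_right (by norm_num) he'
    simp only [add_zero] at this
    rw [this]
    simp [cd_zero, add_mul, h2]
  | unary T ih =>
    rw [OTree.depths, List.forall₂_map_right_iff] at h
    rcases m with _ | m
    · have : T.depths = [] := by
        rcases hT : T.depths with _ | ⟨l, ls⟩
        · rfl
        · rw [hT] at h
          obtain ⟨e, L', he, -⟩ := List.forall₂_cons_right_iff.1 h
          omega
      rw [this] at h
      obtain rfl := List.forall₂_nil_right_iff.1 h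
      simp
    · have := ih m (q * 2) L (h.imp fun _ _ h => by omega)
      have e1 : q * 2 * 2 ^ m = q * 2 ^ (m + 1) := by ring
      rw [e1] at this
      refine this.trans ?_
      rw [pow_succ]; nlinarith [Nat.two_pow_pos m]
  | binary l r ihl ihr =>
    rw [OTree.depths, List.forall₂_map_right_iff] at h
    rcases m with _ | m
    · have : l.depths ++ r.depths = [] := by
        rcases hT : l.depths ++ r.depths with _ | ⟨a, ls⟩
        · rfl
        · rw [hT] at h
          obtain ⟨e, L', he, -⟩ := List.forall₂_cons_right_iff.1 h
          omega
      rw [this] at h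
      obtain rfl := List.forall₂_nil_right_iff.1 h
      simp
    · have h' : List.Forall₂ (fun e l => e + l ≤ m) L (l.depths ++ r.depths) :=
        h.imp fun _ _ h => by omega
      have h1 := List.forall₂_take_append _ _ _ h'
      have h2 := List.forall₂_drop_append _ _ _ h'
      have i1 := ihl m (q * 2) _ h1
      have i2 := ihr m (q * 2 + 1) _ h2
      rw [← List.take_append_drop l.depths.length L, gr_append]
      have e1 : q * 2 * 2 ^ m = q * 2 ^ (m + 1) := by ring
      have e2 : (q * 2 + 1 + 1) * 2 ^ m = (q + 1) * 2 ^ (m + 1) := by ring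
      rw [e1] at i1
      exact (gr_mono _ i1).trans (i2.trans e2.le)

/-- Conversely, a greedy placement in an interval of length `2 ^ m` gives a tree, whose left
subtree takes the intervals in the left half. -/
theorem exists_tree_of_gr_le (m : ℕ) (L : List ℕ) (hL : L ≠ []) (h : gr 0 L ≤ 2 ^ m) :
    ∃ T : OTree, T.depths = L.map (m - ·) := by
  induction m generalizing L with
  | zero =>
    obtain ⟨e, L, rfl⟩ := List.exists_cons_of_ne_nil hL
    rcases L with _ | ⟨e', L⟩
    · exact ⟨.leaf, by simp [OTree.depths]⟩
    · exfalso
      have h1 := pow_le_gr (s := (cd 0 (2 ^ e) + 1) * 2 ^ e) (e := e') (L := e' :: L) (by simp)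
      rw [gr_cons] at h
      rw [cd_zero (by positivity)] at h h1
      have := Nat.two_pow_pos e
      have := Nat.two_pow_pos e'
      simp only [zero_add, one_mul, pow_zero] at h h1
      omega
  | succ m ih =>
    by_cases hm : ∃ e ∈ L, m + 1 ≤ e
    · obtain ⟨e, he, hme⟩ := hm
      obtain ⟨L1, L2, rfl⟩ := List.append_of_mem he
      have h2 : (2 : ℕ) ^ (m + 1) ≤ 2 ^ e := Nat.pow_le_pow_right (by norm_num) hme
      -- an interval of length at least `2 ^ (m + 1)` leaves no room for another one
      have h3 : ∀ a ∈ L1 ++ e :: L2, gr 0 L1 + 2 ^ e ≤ gr 0 (L1 ++ [e]) := fun a _ => by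
        rw [gr_append]; exact pow_le_gr (by simp)
      have h3 := h3 e he
      have h4 : gr 0 (L1 ++ e :: L2) = gr (gr 0 (L1 ++ [e])) L2 := by
        rw [← gr_append]; simp
      have h5 := le_gr (gr 0 (L1 ++ [e])) L2
      have hL1 : L1 = [] := by
        by_contra hne
        obtain ⟨a, L1', rfl⟩ := List.exists_cons_of_ne_nil hne
        have := pow_le_gr (s := 0) (e := a) (L := a :: L1') (by simp)
        have := Nat.two_pow_pos a
        omega
      subst hL1
      have hL2 : L2 = [] := by
        by_contra hne
        obtain ⟨a, L2', rfl⟩ := List.exists_cons_of_ne_nil hne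
        have := pow_le_gr (s := gr 0 ([] ++ [e])) (e := a) (L := a :: L2') (by simp)
        have := Nat.two_pow_pos a
        omega
      subst hL2
      exact ⟨.leaf, by simp [OTree.depths]; omega⟩
    · push Not at hm
      have hle : ∀ e ∈ L, e ≤ m := fun e he => by have := hm e he; omega
      -- the longest prefix placed in the left half
      have hsplit : ∀ L : List ℕ, (∀ e ∈ L, e ≤ m) → ∀ s ≤ 2 ^ m, ∃ L1 L2, L = L1 ++ L2 ∧
          gr s L1 ≤ 2 ^ m ∧ gr (2 ^ m) L2 ≤ max (2 ^ m) (gr s L) := by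
        intro L
        induction L with
        | nil => intro _ s hs; exact ⟨[], [], rfl, hs, by simp⟩
        | cons e L ihL =>
          intro hle s hs
          by_cases hs' : (cd s (2 ^ e) + 1) * 2 ^ e ≤ 2 ^ m
          · obtain ⟨L1, L2, rfl, h1, h2⟩ := ihL (fun a ha => hle a (by simp [ha])) _ hs'
            exact ⟨e :: L1, L2, rfl, h1, h2⟩
          · refine ⟨[], e :: L, rfl, hs, le_max_of_le_right ?_⟩
            rw [gr_cons, gr_cons]
            apply gr_mono
            obtain ⟨d, hd⟩ := Nat.exists_eq_add_of_le (hle e (by simp))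
            have h2 : (2 : ℕ) ^ m = 2 ^ d * 2 ^ e := by rw [hd, pow_add]; ring
            rw [h2] at hs' ⊢
            rw [cd_mul (by positivity)]
            have := lt_of_mul_lt_mul_right (not_le.1 hs') (Nat.zero_le _)
            exact Nat.mul_le_mul_right _ (by omega)
      obtain ⟨L1, L2, rfl, h1, h2⟩ := hsplit L hle 0 (Nat.zero_le _)
      have h2' : gr (2 ^ m) L2 ≤ 2 * 2 ^ m := by
        refine h2.trans (max_le (by omega) (h.trans ?_))
        rw [pow_succ]; omega
      have h3 := gr_shift (q := m) 1 0 L2 fun e he => hle e (by simp [he])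
      simp only [one_mul, add_zero] at h3
      have h4 : gr 0 L2 ≤ 2 ^ m := by omega
      have hsub : ∀ L' : List ℕ, (∀ e ∈ L', e ≤ m) →
          (L'.map (m - ·)).map (· + 1) = L'.map (m + 1 - ·) := by
        intro L' hL'
        rw [List.map_map]
        refine List.map_congr_left fun e he => ?_
        have := hL' e he
        simp only [Function.comp]
        omega
      by_cases hn1 : L1 = []
      · subst hn1
        obtain ⟨T, hT⟩ := ih L2 (by simpa using hL) h4
        exact ⟨.unary T, by rw [OTree.depths, hT]; exact hsub _ hle⟩
      by_cases hn2 : L2 = []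
      · subst hn2
        obtain ⟨T, hT⟩ := ih L1 hn1 h1
        exact ⟨.unary T, by rw [OTree.depths, hT, List.append_nil]; exact hsub _ (by simpa using hle)⟩
      obtain ⟨T1, hT1⟩ := ih L1 hn1 h1
      obtain ⟨T2, hT2⟩ := ih L2 hn2 h4
      refine ⟨.binary T1 T2, ?_⟩
      rw [OTree.depths, hT1, hT2, ← List.map_append]
      exact hsub _ hle

/-- The minimax cost of integer weights `a + e i`, where `e i` are natural numbers. -/
theorem isMinimaxCost_of_gr {n : ℕ} (hn : 1 ≤ n) (a : ℤ) (e : Fin n → ℕ) (y : Fin n → ℝ)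
    (hy : ∀ i, y i = (a + e i : ℤ)) (m : ℕ)
    (h1 : gr 0 (List.ofFn e) ≤ 2 ^ m) (h2 : ∀ m', gr 0 (List.ofFn e) ≤ 2 ^ m' → m ≤ m') :
    IsMinimaxCost y ((a + m : ℤ) : ℝ) := by
  have hem : ∀ i, e i ≤ m := fun i => by
    have := pow_le_gr (s := 0) (e := e i) (L := List.ofFn e) (by simp [List.mem_ofFn])
    exact (Nat.pow_le_pow_iff_right (a := 2) (by norm_num)).1 (by omega)
  constructor
  · obtain ⟨T, hT⟩ := exists_tree_of_gr_le m (List.ofFn e)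
      (by rw [Ne, List.ofFn_eq_nil_iff]; omega) h1
    have hlen : T.depths.length = n := by rw [hT]; simp
    have hval : ∀ i : Fin n, y i + ((T.depths.get (i.cast hlen.symm) : ℕ) : ℝ) = (a + m : ℤ) := by
      intro i
      have : T.depths.get (i.cast hlen.symm) = m - e i := by
        simp only [List.get_eq_getElem, hT]
        simp
      rw [this, hy, Nat.cast_sub (hem i)]
      push_cast
      ring
    refine ⟨T, hlen, ⟨⟨0, hn⟩, hval _⟩, ?_⟩
    rintro _ ⟨i, rfl⟩
    exact (hval i).le
  · rintro c ⟨T, hlen, ⟨i, hi⟩, hub⟩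
    set l : ℕ := T.depths.get (i.cast hlen.symm) with hl
    have hc : c = ((a + (e i + l : ℕ) : ℤ) : ℝ) := by
      rw [← hi]; simp only [hy]; push_cast; ring
    rw [hc]
    have hle : m ≤ e i + l := by
      apply h2
      have := gr_le_of_tree T (e i + l) 0 (List.ofFn e) ?_
      · simpa using this
      rw [List.forall₂_iff_get]
      refine ⟨by simp [hlen], fun j hj hj' => ?_⟩
      have hjn : j < n := by simpa using hj
      have := hub ⟨⟨j, hjn⟩, rfl⟩
      simp only [hc, hy] at this
      have h3 : (a + (e ⟨j, hjn⟩ : ℕ) : ℝ) + (T.depths.get ⟨j, hj'⟩ : ℕ) ≤ a + ((e i + l : ℕ) : ℝ) := by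
        have h4 := this
        push_cast at h4 ⊢
        simpa using h4
      have h5 : ((e ⟨j, hjn⟩ + T.depths.get ⟨j, hj'⟩ : ℕ) : ℝ) ≤ ((e i + l : ℕ) : ℝ) := by
        push_cast at h3 ⊢; linarith
      have h6 := Nat.cast_le.1 h5
      simpa using h6
    exact_mod_cast (by omega : a + (m : ℤ) ≤ a + ((e i + l : ℕ) : ℤ))

/-! ### Counting units of a threshold -/

/-- The number of units `2 ^ q` that the greedy placement of `L` needs. -/
def cnt (q : ℕ) (L : List ℕ) : ℕ := cd (gr 0 L) (2 ^ q)

@[simp] theorem cnt_nil (q : ℕ) : cnt q [] = 0 := cd_zero (by positivity)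

@[simp] theorem cnt_singleton (q : ℕ) : cnt q [q] = 1 := by
  rw [cnt, gr_cons, gr_nil, cd_zero (by positivity), cd_mul (by positivity)]

theorem dvd_gr_append_singleton (q s : ℕ) (L : List ℕ) : 2 ^ q ∣ gr s (L ++ [q]) := by
  rw [gr_append]; exact ⟨_, mul_comm _ _⟩

theorem cnt_append_of_dvd {q : ℕ} {L L' : List ℕ} (h : ∀ e ∈ L', e ≤ q) (hd : 2 ^ q ∣ gr 0 L) :
    cnt q (L ++ L') = cnt q L + cnt q L' := by
  obtain ⟨c, hc⟩ := hd
  have := gr_shift (q := q) c 0 L' h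
  rw [cnt, cnt, cnt, gr_append, hc, mul_comm, cd_mul (by positivity)]
  rw [add_zero] at this
  rw [this, cd_mul_add (by positivity)]

theorem cnt_append_cons {q : ℕ} {L L' : List ℕ} (h : ∀ e ∈ L', e ≤ q) :
    cnt q (L ++ q :: L') = cnt q L + cnt q (q :: L') := by
  have h1 : L ++ q :: L' = (L ++ [q]) ++ L' := by simp
  have h2 : q :: L' = [q] ++ L' := rfl
  rw [h1, cnt_append_of_dvd h (dvd_gr_append_singleton _ _ _), h2,
    cnt_append_of_dvd h (by simp), ← add_assoc]
  congr 1
  rw [cnt, gr_append, gr_cons, gr_nil, cd_mul (by positivity), cnt_singleton, cnt]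

theorem cnt_le_length {q : ℕ} {L : List ℕ} (h : ∀ e ∈ L, e ≤ q) : cnt q L ≤ L.length := by
  induction L using List.reverseRecOn with
  | nil => simp
  | append_singleton L e ih =>
    have ih := ih fun a ha => h a (by simp [ha])
    obtain ⟨d, rfl⟩ := Nat.exists_eq_add_of_le (h e (by simp))
    rw [cnt, gr_append, gr_cons, gr_nil, cd_le_iff (by positivity), List.length_append]
    rw [cnt, cd_le_iff (by positivity), pow_add] at ih
    have h1 : cd (gr 0 L) (2 ^ e) ≤ L.length * 2 ^ d := by
      rw [cd_le_iff (by positivity)]; linarith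
    have h2 := Nat.two_pow_pos d
    calc _ ≤ (L.length * 2 ^ d + 2 ^ d) * 2 ^ e := Nat.mul_le_mul_right _ (by omega)
      _ = _ := by simp only [List.length_singleton]; ring

theorem cnt_cnt {q q' : ℕ} (h : q ≤ q') (L : List ℕ) : cd (cnt q L) (2 ^ (q' - q)) = cnt q' L := by
  rw [cnt, cd_cd (by positivity) (by positivity), ← pow_add, cnt, Nat.add_sub_cancel' h]

/-- The values of `e` on the interval `[a, b)`, in order. -/
def seg (e : ℕ → ℕ) (a b : ℕ) : List ℕ := (List.range' a (b - a)).map e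

@[simp] theorem seg_self (e : ℕ → ℕ) (a : ℕ) : seg e a a = [] := by simp [seg]

theorem mem_seg {e : ℕ → ℕ} {a b z : ℕ} : z ∈ seg e a b ↔ ∃ y, a ≤ y ∧ y < b ∧ e y = z := by
  simp only [seg, List.mem_map, List.mem_range'_1]
  constructor
  · rintro ⟨y, ⟨h1, h2⟩, h3⟩; exact ⟨y, h1, by omega, h3⟩
  · rintro ⟨y, h1, h2, h3⟩; exact ⟨y, ⟨h1, by omega⟩, h3⟩

theorem seg_append (e : ℕ → ℕ) {a b c : ℕ} (h1 : a ≤ b) (h2 : b ≤ c) :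
    seg e a b ++ seg e b c = seg e a c := by
  have h := List.range'_append_1 (s := a) (m := b - a) (n := c - b)
  rw [Nat.add_sub_cancel' h1] at h
  rw [seg, seg, seg, ← List.map_append, h]
  congr 2
  omega

theorem seg_succ (e : ℕ → ℕ) (a : ℕ) : seg e a (a + 1) = [e a] := by simp [seg]

theorem seg_congr {e e' : ℕ → ℕ} {a b : ℕ} (h : ∀ y, a ≤ y → y < b → e y = e' y) :
    seg e a b = seg e' a b := by
  refine List.map_congr_left fun y hy => ?_
  rw [List.mem_range'_1] at hy
  exact h y hy.1 (by omega)

/-- Counts are additive at a cut next to an interval as long as the unit. -/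
theorem cnt_seg_split {e : ℕ → ℕ} {q a b c : ℕ} (h1 : a ≤ b) (h2 : b ≤ c)
    (h : ∀ y, b ≤ y → y < c → e y ≤ q)
    (hq : a = b ∨ (a < b ∧ e (b - 1) = q) ∨ b = c ∨ e b = q) :
    cnt q (seg e a c) = cnt q (seg e a b) + cnt q (seg e b c) := by
  rw [← seg_append e h1 h2]
  have hm : ∀ z ∈ seg e b c, z ≤ q := by
    intro z hz
    obtain ⟨y, hy1, hy2, rfl⟩ := mem_seg.1 hz
    exact h y hy1 hy2
  rcases hq with rfl | ⟨hab, hq⟩ | rfl | hq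
  · simp
  · apply cnt_append_of_dvd hm
    rw [← seg_append e (show a ≤ b - 1 by omega) (show b - 1 ≤ b by omega)]
    have : seg e (b - 1) b = [q] := by
      have := seg_succ e (b - 1)
      rwa [Nat.sub_add_cancel (by omega), hq] at this
    rw [this]
    exact dvd_gr_append_singleton _ _ _
  · simp
  · rcases h2.eq_or_lt with rfl | h2
    · simp
    have : seg e b c = q :: seg e (b + 1) c := by
      rw [← seg_append e (show b ≤ b + 1 by omega) (show b + 1 ≤ c by omega), seg_succ, hq]
      rfl
    rw [this] at hm ⊢
    exact cnt_append_cons fun z hz => hm z (by simp [hz])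

/-- The number of units of the threshold below level `r` that the items at the positions in
`[a, b)` need, when the item at position `y` has the threshold number `v y` and the `j`-th
threshold is `f j`. -/
def run (f : ℕ → ℕ) (r : ℕ) (v : ℕ → ℕ) (a b : ℕ) : ℕ := cnt (f (r - 1)) (seg (fun y => f (v y)) a b)

section Carry
variable {f v : ℕ → ℕ} {r a b c : ℕ}

@[simp] theorem run_self : run f r v a a = 0 := by simp [run]

theorem run_congr {v' : ℕ → ℕ} (h : ∀ y, a ≤ y → y < b → v y = v' y) :
    run f r v a b = run f r v' a b := by
  rw [run, run, seg_congr fun y h1 h2 => by rw [h y h1 h2]]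

theorem run_le (hf : Monotone f) (h : ∀ y, a ≤ y → y < b → v y < r) : run f r v a b ≤ b - a := by
  refine (cnt_le_length fun z hz => ?_).trans (by simp [seg])
  obtain ⟨y, h1, h2, rfl⟩ := mem_seg.1 hz
  have := h y h1 h2
  exact hf (by omega)

theorem run_split (hf : Monotone f) (h1 : a ≤ b) (h2 : b ≤ c)
    (h : ∀ y, b ≤ y → y < c → v y < r)
    (hq : a = b ∨ (a < b ∧ v (b - 1) = r - 1) ∨ b = c ∨ v b = r - 1) :
    run f r v a c = run f r v a b + run f r v b c := by
  refine cnt_seg_split h1 h2 (fun y hy1 hy2 => hf ?_) ?_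
  · have := h y hy1 hy2; omega
  · rcases hq with h | h | h | h
    · exact .inl h
    · exact .inr (.inl ⟨h.1, by rw [h.2]⟩)
    · exact .inr (.inr (.inl h))
    · exact .inr (.inr (.inr (by rw [h])))

theorem run_singleton {x : ℕ} (h : v x = r - 1) : run f r v x (x + 1) = 1 := by
  rw [run, seg_succ, h, cnt_singleton]

theorem run_succ (hf : Monotone f) :
    run f (r + 1) v a b = cd (run f r v a b) (2 ^ (f r - f (r - 1))) := by
  rw [run, run, cnt_cnt (hf (by omega))]; rfl

/-- When the item at `x` is lowered from the threshold number `v x`, giving the numbers `v'`, the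
contribution of the part of the sequence around `x` to the counts of level `r` changes
from `o` to `w`.  For `r ≤ v x`, the item `x` separates two runs of level `r` before it is lowered,
and `o` is the sum of the contributions to the two. -/
def Carry (f : ℕ → ℕ) (r : ℕ) (v v' : ℕ → ℕ) (x o w : ℕ) : Prop :=
  ∃ l h, l ≤ x ∧ x < h ∧ (∀ y, l ≤ y → y < h → y ≠ x → v y < r) ∧
    ∀ a c, a ≤ l → h ≤ c → (∀ y, a ≤ y → y < c → y ≠ x → v y < r) →
      run f r v' a c = run f r v a l + w + run f r v h c ∧
      (r ≤ v x → run f r v a x + run f r v (x + 1) c = run f r v a l + o + run f r v h c) ∧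
      (v x < r → run f r v a c = run f r v a l + o + run f r v h c)

theorem carry_base (hf : Monotone f) {x r₀ : ℕ} (h0 : r₀ < v x) :
    Carry f (r₀ + 1) v (Function.update v x r₀) x 0 1 := by
  refine ⟨x, x + 1, le_rfl, by omega, fun y _ _ _ => by omega, fun a c ha hc hv => ⟨?_, ?_, ?_⟩⟩
  · set v' := Function.update v x r₀ with hv'
    have hx : v' x = r₀ := by simp [hv']
    have hy : ∀ y, y ≠ x → v' y = v y := fun y hy => by simp [hv', hy]
    have hlt : ∀ y, a ≤ y → y < c → v' y < r₀ + 1 := by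
      intro y h1 h2
      by_cases h : y = x
      · rw [h, hx]; omega
      · rw [hy y h]; exact hv y h1 h2 h
    rw [run_split hf ha (show x ≤ c by omega) (fun y h1 h2 => hlt y (by omega) h2)
        (.inr (.inr (.inr (by simpa using hx)))),
      run_split hf (show x ≤ x + 1 by omega) hc (fun y h1 h2 => hlt y (by omega) h2)
        (.inr (.inl ⟨by omega, by simpa using hx⟩)), run_singleton (by simpa using hx),
      run_congr (v := v') (v' := v) (b := x) fun y h1 h2 => hy y (by omega),
      run_congr (v := v') (v' := v) (b := c) fun y h1 h2 => hy y (by omega), add_assoc]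
  · intro _; simp
  · intro h; omega

variable {v' : ℕ → ℕ} {x o w p s : ℕ}

/-- The new count of the run of level `r` around `x`. -/
theorem Carry.run_eq (hc : Carry f r v v' x o w) (hpx : p < x) (hxs : x < s)
    (hv : ∀ y, p < y → y < s → y ≠ x → v y < r) (hp : r ≤ v p) (hs : r ≤ v s) :
    (r ≤ v x → o ≤ run f r v (p + 1) x + run f r v (x + 1) s ∧ run f r v' (p + 1) s =
      run f r v (p + 1) x + run f r v (x + 1) s - o + w) ∧
    (v x < r → o ≤ run f r v (p + 1) s ∧ run f r v' (p + 1) s = run f r v (p + 1) s - o + w) := by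
  obtain ⟨l, h, hl, hh, hlh, H⟩ := hc
  have h1 : p + 1 ≤ l := by
    by_contra hcon
    have := hlh p (by omega) (by omega) (by omega)
    omega
  have h2 : h ≤ s := by
    by_contra hcon
    have := hlh s (by omega) (by omega) (by omega)
    omega
  obtain ⟨H1, H2, H3⟩ := H (p + 1) s h1 h2 fun y hy1 hy2 => hv y (by omega) hy2
  exact ⟨fun h => by have := H2 h; omega, fun h => by have := H3 h; omega⟩

/-- The contributions of the run of level `r` around `x` to the next level. -/
theorem Carry.succ (hf : Monotone f) (hne : ∀ y, y ≠ x → v' y = v y) (hx' : v' x < r)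
    (hpx : p < x) (hxs : x < s)
    (hv : ∀ y, p < y → y < s → y ≠ x → v y < r) (hp : r ≤ v p) (hs : r ≤ v s) :
    Carry f (r + 1) v v' x
      (if r ≤ v x then cd (run f r v (p + 1) x) (2 ^ (f r - f (r - 1))) +
          cd (run f r v (x + 1) s) (2 ^ (f r - f (r - 1))) + (if r = v x then 1 else 0)
        else cd (run f r v (p + 1) s) (2 ^ (f r - f (r - 1))))
      (cd (run f r v' (p + 1) s) (2 ^ (f r - f (r - 1)))) := by
  simp only [← run_succ hf]
  refine ⟨p + 1, s, hpx, hxs, fun y h1 h2 h3 => (hv y h1 h2 h3).trans (by omega),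
    fun a c ha hc hv2 => ?_⟩
  have hap : a = p + 1 ∨ v p = r := by
    by_cases h : a = p + 1
    · exact .inl h
    · have := hv2 p (by omega) (by omega) (by omega)
      exact .inr (by omega)
  have hsc : s = c ∨ v s = r := by
    by_cases h : s = c
    · exact .inl h
    · have := hv2 s (by omega) (by omega) (by omega)
      exact .inr (by omega)
  -- both cuts, for numbers that agree with `v` outside `x`
  have key : ∀ u : ℕ → ℕ, (∀ y, y ≠ x → u y = v y) → u x < r + 1 →
      run f (r + 1) u a c = run f (r + 1) v a (p + 1) + run f (r + 1) u (p + 1) s +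
        run f (r + 1) v s c := by
    intro u hu hux
    have hlt : ∀ y, a ≤ y → y < c → u y < r + 1 := by
      intro y h1 h2
      by_cases h : y = x
      · rw [h]; exact hux
      · rw [hu y h]; exact hv2 y h1 h2 h
    rw [run_split hf (show a ≤ s by omega) hc (fun y h1 h2 => hlt y (by omega) h2) ?_,
      run_split hf ha (show p + 1 ≤ s by omega) (fun y h1 h2 => hlt y (by omega) (by omega)) ?_,
      run_congr (v := u) (v' := v) (b := p + 1) fun y h1 h2 => hu y (by omega),
      run_congr (v := u) (v' := v) (b := c) fun y h1 h2 => hu y (by omega)]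
    · rcases hap with h | h
      · exact .inl h
      · by_cases h' : a = p + 1
        · exact .inl h'
        · refine .inr (.inl ⟨by omega, ?_⟩)
          simp [hu p (by omega), h]
    · rcases hsc with h | h
      · exact .inr (.inr (.inl h))
      · exact .inr (.inr (.inr (by simp [hu s (by omega), h])))
  refine ⟨key v' hne (by omega), fun h => ?_, fun h => ?_⟩
  · rw [if_pos (by omega), if_neg (by omega),
      run_split hf ha (show p + 1 ≤ x by omega)
        (fun y h1 h2 => hv2 y (by omega) (by omega) (by omega)) ?_,
      run_split hf (show x + 1 ≤ s by omega) hc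
        (fun y h1 h2 => hv2 y (by omega) (by omega) (by omega)) ?_]
    · ring
    · rcases hsc with h | h
      · exact .inr (.inr (.inl h))
      · exact .inr (.inr (.inr (by simp [h])))
    · rcases hap with h | h
      · exact .inl h
      · by_cases h' : a = p + 1
        · exact .inl h'
        · exact .inr (.inl ⟨by omega, by simp [h]⟩)
  · rw [key v (fun _ _ => rfl) h]
    by_cases hrx : r ≤ v x
    · have hrx' : v x = r := by omega
      have hlt : ∀ y, p < y → y < s → v y < r + 1 := by
        intro y h1 h2
        by_cases h : y = x
        · rw [h]; omega
        · exact (hv y h1 h2 h).trans (by omega)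
      rw [if_pos hrx, if_pos hrx'.symm,
        run_split hf (show p + 1 ≤ x by omega) (show x ≤ s by omega)
          (fun y h1 h2 => hlt y (by omega) h2) (.inr (.inr (.inr (by simpa using hrx')))),
        run_split hf (show x ≤ x + 1 by omega) (show x + 1 ≤ s by omega)
          (fun y h1 h2 => hlt y (by omega) h2) (.inr (.inl ⟨by omega, by simpa using hrx'⟩)),
        run_singleton (by simpa using hrx')]
      ring
    · rw [if_neg hrx]

end Carry

/-! ### Predecessors and successors in a stratified tree -/

/-- The name of a word of the data structure: a tag, a level, and three coordinates. -/
abbrev Cell := ℕ × ℕ × ℕ × ℕ × ℕ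

/-- The contents of the cells. -/
abbrev Mem := Cell → ℕ

/-- The size of the universe of a stratified tree of rank `k`. -/
def bsz (k : ℕ) : ℕ := 2 ^ 2 ^ k

theorem bsz_succ (k : ℕ) : bsz (k + 1) = bsz k * bsz k := by
  rw [bsz, bsz, ← pow_add, pow_succ, mul_two]

theorem two_le_bsz (k : ℕ) : 2 ≤ bsz k := by
  rw [bsz]; exact Nat.le_self_pow (by positivity) 2

theorem bsz_pos (k : ℕ) : 0 < bsz k := by have := two_le_bsz k; omega

/-- Some element of `S` has the prefix `y`, at the resolution `A`. -/
def Pre (S : Set ℕ) (A y : ℕ) : Prop := ∃ s ∈ S, s / A = y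

theorem pre_mul {S : Set ℕ} {A b z : ℕ} : Pre S (A * b) z ↔ ∃ y, y / b = z ∧ Pre S A y := by
  constructor
  · rintro ⟨s, hs, rfl⟩; exact ⟨s / A, by rw [Nat.div_div_eq_div_mul], s, hs, rfl⟩
  · rintro ⟨y, rfl, s, hs, rfl⟩; exact ⟨s, hs, by rw [Nat.div_div_eq_div_mul]⟩

/-- The cluster `c` of rank `k` at the resolution `A` is described correctly: the cell with tag `0`
tells whether it is empty, and, if it is not, those with tags `1` and `2` hold its minimum and its
maximum, as distances from the two ends of the cluster. With zero in all cells the cluster is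
full. -/
def ClusterOK (M : Mem) (r : ℕ) (S : Set ℕ) (k A c : ℕ) : Prop :=
  (M (0, r, A, k, c) = 0 ↔ Pre S (A * bsz k) c) ∧
  (Pre S (A * bsz k) c →
    IsLeast {y | y / bsz k = c ∧ Pre S A y} (c * bsz k + M (1, r, A, k, c)) ∧
    IsGreatest {y | y / bsz k = c ∧ Pre S A y} (c * bsz k + bsz k - 1 - M (2, r, A, k, c)))

/-- The cells at level `r` represent the part of `S` below the prefix `z` at the resolution
`A * bsz k`, where elements with the same prefix at the resolution `A` are identified: a stratified
tree (van Emde Boas) of rank `k`. It consists of clusters of rank `k - 1` and of a tree of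
rank `k - 1`, at a coarser resolution, for the set of clusters that are not empty.  Nothing is said
about a tree for the empty set. -/
def VEB (M : Mem) (r : ℕ) (S : Set ℕ) : ℕ → ℕ → ℕ → Prop
  | 0, _, _ => True
  | k + 1, A, z => Pre S (A * bsz (k + 1)) z →
      (∀ c, c / bsz k = z → ClusterOK M r S k A c ∧ VEB M r S k A c) ∧ VEB M r S k (A * bsz k) z

theorem clusterOK_congr {M M' : Mem} {r : ℕ} {S S' : Set ℕ} {k A c : ℕ}
    (hS : ∀ y, y / bsz k = c → (Pre S A y ↔ Pre S' A y))
    (hM : ∀ t ≤ 2, M (t, r, A, k, c) = M' (t, r, A, k, c)) :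
    ClusterOK M r S k A c ↔ ClusterOK M' r S' k A c := by
  have h1 : Pre S (A * bsz k) c ↔ Pre S' (A * bsz k) c := by
    rw [pre_mul, pre_mul]
    exact exists_congr fun y => and_congr_right fun h => hS y h
  have h2 : {y | y / bsz k = c ∧ Pre S A y} = {y | y / bsz k = c ∧ Pre S' A y} := by
    ext y; exact and_congr_right fun h => hS y h
  rw [ClusterOK, ClusterOK, h1, h2, hM 0 (by omega), hM 1 (by omega), hM 2 (by omega)]

theorem VEB.congr {M M' : Mem} {r : ℕ} {S S' : Set ℕ} {k A z : ℕ} (hA : 0 < A)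
    (hS : ∀ y, y / bsz k = z → (Pre S A y ↔ Pre S' A y))
    (hM : ∀ t ≤ 2, ∀ A', ∀ k' < k, ∀ c, A ∣ A' → A' * bsz k' ∣ A * bsz k →
      c * (A' * bsz k') / (A * bsz k) = z → M (t, r, A', k', c) = M' (t, r, A', k', c))
    (h : VEB M r S k A z) : VEB M' r S' k A z := by
  induction k generalizing A z with
  | zero => trivial
  | succ k ih =>
    intro hz
    have hb := bsz_pos k
    have hbb : A * bsz (k + 1) = A * bsz k * bsz k := by rw [bsz_succ, mul_assoc]
    have hz' : Pre S (A * bsz (k + 1)) z := by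
      rw [pre_mul] at hz ⊢
      obtain ⟨y, h1, h2⟩ := hz
      exact ⟨y, h1, (hS y h1).2 h2⟩
    have hdiv : ∀ y, y / bsz (k + 1) = y / bsz k / bsz k := fun y => by
      rw [bsz_succ, Nat.div_div_eq_div_mul]
    obtain ⟨h1, h2⟩ := h hz'
    refine ⟨fun c hc => ?_, ?_⟩
    · obtain ⟨h3, h4⟩ := h1 c hc
      have hSc : ∀ y, y / bsz k = c → (Pre S A y ↔ Pre S' A y) := fun y hy =>
        hS y (by rw [hdiv, hy, hc])
      refine ⟨(clusterOK_congr hSc fun t ht => hM t ht A k k.lt_succ_self c dvd_rfl ?_ ?_).1 h3,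
        ih hA hSc (fun t ht A' k' hk c' hd1 hd2 h5 => hM t ht A' k' (by omega) c' hd1 ?_ ?_) h4⟩
      · rw [hbb]; exact dvd_mul_right _ _
      · rw [hbb, ← Nat.div_div_eq_div_mul, Nat.mul_div_cancel _ (Nat.mul_pos hA hb), hc]
      · rw [hbb]; exact hd2.trans (dvd_mul_right _ _)
      · rw [hbb, ← Nat.div_div_eq_div_mul, h5, hc]
    · refine ih (Nat.mul_pos hA hb) (fun y hy => ?_) (fun t ht A' k' hk c' hd1 hd2 h5 =>
        hM t ht A' k' (by omega) c' ((dvd_mul_right _ _).trans hd1) ?_ ?_) h2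
      · rw [pre_mul, pre_mul]
        exact exists_congr fun u => and_congr_right fun h => hS u (by rw [hdiv, h, hy])
      · rwa [hbb]
      · rwa [hbb]

theorem veb_univ (r k A z : ℕ) (hA : 0 < A) : VEB (fun _ => 0) r Set.univ k A z := by
  have hpre : ∀ A, 0 < A → ∀ y, Pre Set.univ A y := fun A hA y =>
    ⟨y * A, trivial, Nat.mul_div_cancel _ hA⟩
  induction k generalizing A z with
  | zero => trivial
  | succ k ih =>
    intro _
    have hb := bsz_pos k
    refine ⟨fun c hc => ⟨⟨?_, fun _ => ⟨⟨⟨?_, hpre A hA _⟩, ?_⟩, ⟨⟨?_, hpre A hA _⟩, ?_⟩⟩⟩,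
      ih A c hA⟩, ih _ z (Nat.mul_pos hA hb)⟩
    · simp [hpre _ (Nat.mul_pos hA hb)]
    · simp [Nat.mul_div_cancel _ hb]
    · rintro y ⟨rfl, -⟩; simpa using Nat.div_mul_le_self y _
    · rw [Nat.div_eq_iff hb]; simp only [Nat.sub_zero]; omega
    · rintro y ⟨rfl, -⟩
      have := Nat.lt_div_mul_add (a := y) hb
      simp only [Nat.sub_zero]
      omega

/-- The deletion of `x`, with the neighbours `p` and `s`, from a tree of rank `k` at the
resolution `A`, in which `x` is the only element with its prefix. If `x` is the only element of its
cluster, then the cluster becomes empty and is deleted from the tree of clusters. Otherwise `x` is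
deleted from its cluster; when it is the minimum or the maximum of the cluster, then `s` or `p`
takes its place. -/
def vebDel (r x p s : ℕ) : ℕ → ℕ → Mem → Mem
  | 0, _, M => M
  | k + 1, A, M =>
      let D := A * bsz k
      let z := x / D
      if p / D = z then
        if s / D = z then vebDel r x p s k A M
        else vebDel r x p s k A
          (Function.update M (2, r, A, k, z) (z * bsz k + bsz k - 1 - p / A))
      else
        if s / D = z then vebDel r x p s k A
          (Function.update M (1, r, A, k, z) (s / A - z * bsz k))
        else vebDel r x p s k D (Function.update M (0, r, A, k, z) 1)

theorem vebDel_apply_of_ne {r x p s k A : ℕ} {M : Mem} {c : Cell} (hA : 0 < A)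
    (h : ∀ t ≤ 2, ∀ A', ∀ k' < k, A ∣ A' → A' * bsz k' ∣ A * bsz k →
      c ≠ (t, r, A', k', x / (A' * bsz k'))) : vebDel r x p s k A M c = M c := by
  induction k generalizing A M with
  | zero => rfl
  | succ k ih =>
    have hbb : A * bsz (k + 1) = A * bsz k * bsz k := by rw [bsz_succ, mul_assoc]
    have hc : ∀ t ≤ 2, c ≠ (t, r, A, k, x / (A * bsz k)) := fun t ht =>
      h t ht A k k.lt_succ_self dvd_rfl (by rw [hbb]; exact dvd_mul_right _ _)
    have h1 : ∀ M, vebDel r x p s k A M c = M c := fun M => ih hA fun t ht A' k' hk h1 h2 =>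
      h t ht A' k' (by omega) h1 (by rw [hbb]; exact h2.trans (dvd_mul_right _ _))
    have h2 : ∀ M, vebDel r x p s k (A * bsz k) M c = M c := fun M =>
      ih (Nat.mul_pos hA (bsz_pos k)) fun t ht A' k' hk h1 h2 =>
        h t ht A' k' (by omega) ((dvd_mul_right _ _).trans h1) (by rwa [hbb])
    simp only [vebDel]
    split_ifs <;> simp [h1, h2, Function.update_of_ne (hc _ _)]

section Del
variable {S : Set ℕ} {r x p s : ℕ}

/-- `p < x < s` are consecutive elements of `S`. -/
structure Nbrs (S : Set ℕ) (p x s : ℕ) : Prop where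
  px : p < x
  xs : x < s
  mp : p ∈ S
  mx : x ∈ S
  ms : s ∈ S
  gap : ∀ y ∈ S, p < y → y < s → y = x

theorem Nbrs.pre_alone (h : Nbrs S p x s) {D y : ℕ} (hp : p / D ≠ x / D) (hs : s / D ≠ x / D) :
    Pre (S \ {x}) D y ↔ Pre S D y ∧ y ≠ x / D := by
  constructor
  · rintro ⟨u, ⟨hu, hux⟩, rfl⟩
    refine ⟨⟨u, hu, rfl⟩, fun he => ?_⟩
    rcases lt_or_ge p u with h1 | h1
    · rcases lt_or_ge u s with h2 | h2
      · exact hux (h.gap u hu h1 h2)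
      · have h3 := Nat.div_le_div_right (c := D) h2
        have h4 := Nat.div_le_div_right (c := D) h.xs.le
        omega
    · have h3 := Nat.div_le_div_right (c := D) h1
      have h4 := Nat.div_le_div_right (c := D) h.px.le
      omega
  · rintro ⟨⟨u, hu, rfl⟩, hne⟩
    exact ⟨u, ⟨hu, by rintro rfl; exact hne rfl⟩, rfl⟩

theorem Nbrs.pre_not_alone (h : Nbrs S p x s) {D y : ℕ} (hps : p / D = x / D ∨ s / D = x / D) :
    Pre (S \ {x}) D y ↔ Pre S D y := by
  constructor
  · rintro ⟨u, ⟨hu, -⟩, rfl⟩; exact ⟨u, hu, rfl⟩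
  · rintro ⟨u, hu, rfl⟩
    by_cases hux : u = x
    · subst hux
      rcases hps with he | he
      · exact ⟨p, ⟨h.mp, by have := h.px; simp; omega⟩, he⟩
      · exact ⟨s, ⟨h.ms, by have := h.xs; simp; omega⟩, he⟩
    · exact ⟨u, ⟨hu, hux⟩, rfl⟩

theorem div_mul_div_of_dvd {x a b : ℕ} (hb : 0 < b) (h : a ∣ b) : x / a * a / b = x / b := by
  obtain ⟨c, rfl⟩ := h
  have ha : 0 < a := Nat.pos_of_mul_pos_right hb
  rw [← Nat.div_div_eq_div_mul, Nat.mul_div_cancel _ ha, Nat.div_div_eq_div_mul]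

theorem vebDel_spec (h : Nbrs S p x s) {k A : ℕ} {M : Mem} (hA : 0 < A)
    (hp : p / A ≠ x / A) (hs : s / A ≠ x / A)
    (hps : p / (A * bsz k) = x / (A * bsz k) ∨ s / (A * bsz k) = x / (A * bsz k))
    (hM : VEB M r S k A (x / (A * bsz k))) :
    VEB (vebDel r x p s k A M) r (S \ {x}) k A (x / (A * bsz k)) := by
  induction k generalizing A M with
  | zero => trivial
  | succ k ih =>
    intro _
    have hb := bsz_pos k
    have hbb : A * bsz (k + 1) = A * bsz k * bsz k := by rw [bsz_succ, mul_assoc]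
    obtain ⟨h1, h2⟩ := hM ⟨x, h.mx, rfl⟩
    set D := A * bsz k with hD
    have hDpos : 0 < D := Nat.mul_pos hA hb
    set z := x / D with hz
    have hcz : z / bsz k = x / (A * bsz (k + 1)) := by rw [hbb, hz, Nat.div_div_eq_div_mul]
    rw [← hcz] at h1 h2 ⊢
    have hdd : ∀ y, y / A / bsz k = y / D := fun y => Nat.div_div_eq_div_mul _ _ _
    have hSA : ∀ y, Pre (S \ {x}) A y ↔ Pre S A y ∧ y ≠ x / A := fun y => h.pre_alone hp hs
    have hSc : ∀ c, c ≠ z → ∀ y, y / bsz k = c → (Pre S A y ↔ Pre (S \ {x}) A y) := by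
      intro c hc y hy
      rw [hSA, iff_self_and]
      rintro - rfl
      exact hc (by rw [← hy, hdd])
    -- the other clusters are not affected by a change of the cells on the path of `x`
    have hother : ∀ M' : Mem, (∀ t ≤ 2, ∀ A' k' c, (A' * bsz k' ∣ D) → c ≠ x / (A' * bsz k') →
        M' (t, r, A', k', c) = M (t, r, A', k', c)) → ∀ c, c / bsz k = z / bsz k → c ≠ z →
        ClusterOK M' r (S \ {x}) k A c ∧ VEB M' r (S \ {x}) k A c := by
      intro M' hM' c hc hcne
      obtain ⟨h3, h4⟩ := h1 c hc
      refine ⟨(clusterOK_congr (hSc c hcne) fun t ht => ?_).1 h3,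
        h4.congr hA (hSc c hcne) fun t ht A' k' _ c' hd1 hd2 h5 => ?_⟩
      · exact (hM' t ht A k c dvd_rfl hcne).symm
      · refine (hM' t ht A' k' c' hd2 ?_).symm
        rintro rfl
        apply hcne
        rw [div_mul_div_of_dvd hDpos hd2] at h5
        exact h5.symm
    have hnd : ∀ {A' k'}, A' * bsz k' ∣ D → D ∣ A' → False := by
      intro A' k' hd1 hd2
      have h3 := Nat.le_of_dvd hDpos hd1
      have h4 : 0 < A' := Nat.pos_of_mul_pos_right (Nat.pos_of_dvd_of_pos hd1 hDpos)
      have h5 := Nat.le_of_dvd h4 hd2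
      have := two_le_bsz k'
      nlinarith
    by_cases hal : p / D = z ∨ s / D = z
    · -- some other element has the prefix `z`
      have hSD : ∀ y, Pre (S \ {x}) D y ↔ Pre S D y := fun y => h.pre_not_alone hal
      obtain ⟨h3, h4⟩ := h1 z rfl
      have hPz : Pre S D z := ⟨x, h.mx, rfl⟩
      obtain ⟨hL0, hG0⟩ := h3.2 hPz
      have main : ∀ M' : Mem, M' (0, r, A, k, z) = M (0, r, A, k, z) →
          (∀ c, (∀ t ≤ 2, c ≠ (t, r, A, k, z)) → M' c = M c) →
          IsLeast {y | y / bsz k = z ∧ Pre (S \ {x}) A y} (z * bsz k + M' (1, r, A, k, z)) →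
          IsGreatest {y | y / bsz k = z ∧ Pre (S \ {x}) A y}
            (z * bsz k + bsz k - 1 - M' (2, r, A, k, z)) →
          (∀ c, c / bsz k = z / bsz k → ClusterOK (vebDel r x p s k A M') r (S \ {x}) k A c ∧
            VEB (vebDel r x p s k A M') r (S \ {x}) k A c) ∧
          VEB (vebDel r x p s k A M') r (S \ {x}) k D (z / bsz k) := by
        intro M' hM0 hM' hL hG
        have happ : ∀ t ≤ 2, ∀ A' k' c, (A' * bsz k' ∣ D → c ≠ x / (A' * bsz k')) →
            vebDel r x p s k A M' (t, r, A', k', c) = M' (t, r, A', k', c) := by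
          intro t ht A' k' c hne
          refine vebDel_apply_of_ne hA fun t' ht' A'' k'' _ hd1 hd2 he => ?_
          simp only [Prod.mk.injEq] at he
          obtain ⟨rfl, -, rfl, rfl, rfl⟩ := he
          exact hne hd2 rfl
        have happ2 : ∀ t ≤ 2, vebDel r x p s k A M' (t, r, A, k, z) = M' (t, r, A, k, z) := by
          intro t ht
          refine vebDel_apply_of_ne hA fun t' ht' A'' k'' hk hd1 hd2 he => ?_
          simp only [Prod.mk.injEq] at he
          omega
        refine ⟨fun c hc => ?_, ?_⟩
        · by_cases hcz' : c = z
          · subst hcz'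
            refine ⟨⟨?_, fun _ => ?_⟩, ih hA hp hs hal (h4.congr hA (fun _ _ => Iff.rfl) ?_)⟩
            · rw [happ2 0 (by omega), hM0, hSD]; exact h3.1
            · rw [happ2 1 (by omega), happ2 2 (by omega)]; exact ⟨hL, hG⟩
            · intro t ht A' k' hk c' _ _ _
              refine (hM' _ fun t' ht' he => ?_).symm
              simp only [Prod.mk.injEq] at he
              omega
          · refine hother _ (fun t ht A' k' c' hd hne => ?_) c hc hcz'
            rw [happ t ht A' k' c' fun _ => hne]
            refine hM' _ fun t' ht' he => ?_
            simp only [Prod.mk.injEq] at he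
            obtain ⟨rfl, -, rfl, rfl, rfl⟩ := he
            exact hne rfl
        · refine h2.congr hDpos (fun y _ => (hSD y).symm) fun t ht A' k' hk c' hd1 hd2 h5 => ?_
          rw [happ t ht A' k' c' fun hd => (hnd hd hd1).elim]
          refine (hM' _ fun t' ht' he => ?_).symm
          simp only [Prod.mk.injEq] at he
          omega
      have hxA := Nat.div_le_div_right (c := A) h.px.le
      have hxs := Nat.div_le_div_right (c := A) h.xs.le
      have hTz : ∀ {y}, y / bsz k = z → z * bsz k ≤ y ∧ y < z * bsz k + bsz k := by
        rintro y hy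
        rw [← hy]
        exact ⟨Nat.div_mul_le_self _ _, Nat.lt_div_mul_add hb⟩
      have hLp : p / D = z →
          IsLeast {y | y / bsz k = z ∧ Pre (S \ {x}) A y} (z * bsz k + M (1, r, A, k, z)) := by
        intro hpz
        have : _ ≤ p / A := hL0.2 ⟨by rw [hdd, hpz], p, h.mp, rfl⟩
        exact ⟨⟨hL0.1.1, (hSA _).2 ⟨hL0.1.2, by omega⟩⟩, fun y hy => hL0.2 ⟨hy.1, ((hSA y).1 hy.2).1⟩⟩
      have hGs : s / D = z → IsGreatest {y | y / bsz k = z ∧ Pre (S \ {x}) A y}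
          (z * bsz k + bsz k - 1 - M (2, r, A, k, z)) := by
        intro hsz
        have : s / A ≤ _ := hG0.2 ⟨by rw [hdd, hsz], s, h.ms, rfl⟩
        exact ⟨⟨hG0.1.1, (hSA _).2 ⟨hG0.1.2, by omega⟩⟩, fun y hy => hG0.2 ⟨hy.1, ((hSA y).1 hy.2).1⟩⟩
      have hxD := Nat.div_le_div_right (c := D) h.px.le
      have hsD := Nat.div_le_div_right (c := D) h.xs.le
      simp only [vebDel, ← hD, ← hz]
      rcases Decidable.em (p / D = z) with hpz | hpz <;>
        rcases Decidable.em (s / D = z) with hsz | hsz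
      · rw [if_pos hpz, if_pos hsz]
        exact main M rfl (fun _ _ => rfl) (hLp hpz) (hGs hsz)
      · rw [if_pos hpz, if_neg hsz]
        refine main _ (by simp) (fun c hc => ?_) (by simpa using hLp hpz) ?_
        · rw [Function.update_of_ne (hc 2 le_rfl)]
        · have hpT := hTz ((hdd p).trans hpz)
          rw [Function.update_self, show z * bsz k + bsz k - 1 - (z * bsz k + bsz k - 1 - p / A) =
            p / A by omega]
          refine ⟨⟨(hdd p).trans hpz, (hSA _).2 ⟨⟨p, h.mp, rfl⟩, hp⟩⟩, ?_⟩
          rintro y ⟨hy, u, ⟨hu, hux⟩, rfl⟩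
          rcases lt_or_ge p u with h1 | h1
          · rcases lt_or_ge u s with h2 | h2
            · exact absurd (h.gap u hu h1 h2) hux
            · have := Nat.div_le_div_right (c := D) h2
              rw [hdd] at hy
              omega
          · exact Nat.div_le_div_right h1
      · rw [if_neg hpz, if_pos hsz]
        refine main _ (by simp) (fun c hc => ?_) ?_ (by simpa using hGs hsz)
        · rw [Function.update_of_ne (hc 1 (by omega))]
        · have hsT := hTz ((hdd s).trans hsz)
          rw [Function.update_self, show z * bsz k + (s / A - z * bsz k) = s / A by omega]
          refine ⟨⟨(hdd s).trans hsz, (hSA _).2 ⟨⟨s, h.ms, rfl⟩, hs⟩⟩, ?_⟩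
          rintro y ⟨hy, u, ⟨hu, hux⟩, rfl⟩
          rcases lt_or_ge p u with h1 | h1
          · rcases lt_or_ge u s with h2 | h2
            · exact absurd (h.gap u hu h1 h2) hux
            · exact Nat.div_le_div_right h2
          · have := Nat.div_le_div_right (c := D) h1
            rw [hdd] at hy
            omega
      · exact absurd hal (by tauto)
    · -- the cluster of `x` becomes empty
      push Not at hal
      simp only [vebDel, ← hD, ← hz, if_neg hal.1, if_neg hal.2]
      have hSD : ∀ y, Pre (S \ {x}) D y ↔ Pre S D y ∧ y ≠ z := fun y => h.pre_alone hal.1 hal.2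
      set M' := Function.update M (0, r, A, k, z) 1 with hM'
      have hDA : ¬ D ∣ A := fun hd => hnd (A' := A) (k' := k) dvd_rfl hd
      have happ : ∀ t ≤ 2, ∀ A' k' c, ¬ D ∣ A' →
          vebDel r x p s k D M' (t, r, A', k', c) = M' (t, r, A', k', c) := by
        intro t ht A' k' c hne
        refine vebDel_apply_of_ne hDpos fun t' ht' A'' k'' _ hd1 hd2 he => ?_
        simp only [Prod.mk.injEq] at he
        obtain ⟨rfl, -, rfl, rfl, rfl⟩ := he
        exact hne hd1
      refine ⟨fun c hc => ?_, ?_⟩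
      · by_cases hcz' : c = z
        · subst hcz'
          have hno : ¬ Pre (S \ {x}) D z := fun hc => ((hSD z).1 hc).2 rfl
          refine ⟨⟨?_, fun hc => absurd hc hno⟩, ?_⟩
          · rw [happ 0 (by omega) A k z hDA]
            simp [hM', hno, ← hD]
          · rcases k with _ | k
            · trivial
            · exact fun hc => absurd hc hno
        · refine hother _ (fun t ht A' k' c' hd hne => ?_) c hc hcz'
          rw [happ t ht A' k' c' fun hd' => hnd hd hd', hM', Function.update_of_ne]
          rintro he
          simp only [Prod.mk.injEq] at he
          obtain ⟨rfl, -, rfl, rfl, rfl⟩ := he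
          exact hne rfl
      · have hzz : z / bsz k = x / (D * bsz k) := by rw [hz, Nat.div_div_eq_div_mul]
        rw [hzz] at h2 ⊢
        rw [hbb] at hps
        refine ih hDpos hal.1 hal.2 hps (h2.congr hDpos (fun _ _ => Iff.rfl) ?_)
        intro t ht A' k' hk c' hd1 hd2 h5
        rw [hM', Function.update_of_ne]
        rintro he
        simp only [Prod.mk.injEq] at he
        omega

/-- Search in a tree of rank `k` at the resolution `A` for a neighbour of an element `x` whose
prefix does not occur: it descends into the cluster of `x` unless that is empty, and otherwise finds
a neighbouring cluster. The result tells whether the neighbour is on the right, and gives its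
prefix. -/
def vebFind (r x : ℕ) (M : Mem) : ℕ → ℕ → Bool × ℕ
  | 0, A => if x / A / 2 * 2 = x / A then (true, x / A + 1) else (false, x / A - 1)
  | k + 1, A =>
      if M (0, r, A, k, x / (A * bsz k)) = 0 then vebFind r x M k A
      else
        let q := vebFind r x M k (A * bsz k)
        (q.1, if q.1 then q.2 * bsz k + M (1, r, A, k, q.2)
          else q.2 * bsz k + bsz k - 1 - M (2, r, A, k, q.2))

/-- The conditions under which the search is called: the prefix of `x` does not occur, and the tree
is not empty. -/
structure FindOK (M : Mem) (r x : ℕ) (S : Set ℕ) (k A : ℕ) : Prop where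
  no : ¬ Pre S A (x / A)
  pre : Pre S (A * bsz k) (x / (A * bsz k))
  veb : VEB M r S k A (x / (A * bsz k))

theorem FindOK.clusterOK {M : Mem} {k A : ℕ} (h : FindOK M r x S (k + 1) A) {c : ℕ}
    (hc : c / bsz k = x / (A * bsz (k + 1))) : ClusterOK M r S k A c :=
  ((h.veb h.pre).1 c hc).1

theorem FindOK.left {M : Mem} {k A : ℕ} (h : FindOK M r x S (k + 1) A)
    (he : M (0, r, A, k, x / (A * bsz k)) = 0) : FindOK M r x S k A := by
  have hcz : x / (A * bsz k) / bsz k = x / (A * bsz (k + 1)) := by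
    rw [bsz_succ, ← mul_assoc, Nat.div_div_eq_div_mul]
  have h3 := (h.veb h.pre).1 _ hcz
  exact ⟨h.no, h3.1.1.1 he, h3.2⟩

theorem FindOK.right {M : Mem} {k A : ℕ} (h : FindOK M r x S (k + 1) A)
    (he : M (0, r, A, k, x / (A * bsz k)) ≠ 0) : FindOK M r x S k (A * bsz k) := by
  have hcz : x / (A * bsz k) / bsz k = x / (A * bsz (k + 1)) := by
    rw [bsz_succ, ← mul_assoc, Nat.div_div_eq_div_mul]
  have hbb : A * bsz k * bsz k = A * bsz (k + 1) := by rw [bsz_succ, mul_assoc]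
  refine ⟨fun hp => he ((h.clusterOK hcz).1.2 hp), ?_, ?_⟩
  · rw [hbb]; exact h.pre
  · rw [hbb]; exact (h.veb h.pre).2

theorem vebFind_spec {M : Mem} {k A : ℕ} (h : FindOK M r x S k A) :
    (vebFind r x M k A).2 / bsz k = x / (A * bsz k) ∧ Pre S A (vebFind r x M k A).2 ∧
      if (vebFind r x M k A).1 then x / A < (vebFind r x M k A).2 ∧
        ∀ y, Pre S A y → x / A < y → (vebFind r x M k A).2 ≤ y
      else (vebFind r x M k A).2 < x / A ∧
        ∀ y, Pre S A y → y < x / A → y ≤ (vebFind r x M k A).2 := by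
  induction k generalizing A with
  | zero =>
    obtain ⟨hx, hz, -⟩ := h
    have hb : bsz 0 = 2 := rfl
    rw [hb] at hz ⊢
    rw [pre_mul, ← Nat.div_div_eq_div_mul] at hz
    rw [← Nat.div_div_eq_div_mul]
    obtain ⟨y, hy, hyS⟩ := hz
    have hne : y ≠ x / A := by rintro rfl; exact hx hyS
    by_cases he : x / A / 2 * 2 = x / A
    · obtain rfl : y = x / A + 1 := by omega
      simp only [vebFind, if_pos he]
      exact ⟨hy, hyS, by omega, fun y _ h => h⟩
    · obtain rfl : y = x / A - 1 := by omega
      simp only [vebFind, if_neg he, Bool.false_eq_true, if_false]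
      exact ⟨hy, hyS, by omega, fun y _ h => by omega⟩
  | succ k ih =>
    have hb := bsz_pos k
    have hbb : A * bsz (k + 1) = A * bsz k * bsz k := by rw [bsz_succ, mul_assoc]
    have hdiv : ∀ y, y / bsz (k + 1) = y / bsz k / bsz k := fun y => by
      rw [bsz_succ, Nat.div_div_eq_div_mul]
    by_cases he : M (0, r, A, k, x / (A * bsz k)) = 0
    · simp only [vebFind, if_pos he]
      obtain ⟨i1, i2, i3⟩ := ih (h.left he)
      exact ⟨by rw [hdiv, i1, hbb, Nat.div_div_eq_div_mul], i2, i3⟩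
    · have hih := ih (h.right he)
      have hno := (h.right he).no
      simp only [vebFind, if_neg he]
      rw [hbb]
      set q := vebFind r x M k (A * bsz k) with hq
      obtain ⟨i1, i2, i3⟩ := hih
      have hxA : x / A / bsz k = x / (A * bsz k) := Nat.div_div_eq_div_mul _ _ _
      obtain ⟨hL, hG⟩ := (h.clusterOK (c := q.2) (by rw [i1, hbb])).2 i2
      have hpre : ∀ {y}, Pre S A y → Pre S (A * bsz k) (y / bsz k) := fun {y} hy =>
        pre_mul.2 ⟨y, rfl, hy⟩
      have hlt : ∀ {y y'}, y / bsz k < y' / bsz k → y < y' := fun h => by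
        by_contra hc
        exact absurd (Nat.div_le_div_right (c := bsz k) (not_lt.1 hc)) (not_le.2 h)
      rcases hdir : q.1 with _ | _
      · simp only [hdir, Bool.false_eq_true, if_false] at i3 ⊢
        refine ⟨by rw [hdiv, hG.1.1, i1], hG.1.2, hlt (by rw [hG.1.1, hxA]; exact i3.1),
          fun y hy hyx => ?_⟩
        have h5 := Nat.div_le_div_right (c := bsz k) hyx.le
        rw [hxA] at h5
        have h6 : y / bsz k ≠ x / (A * bsz k) := fun h => hno (h ▸ hpre hy)
        have h7 := i3.2 _ (hpre hy) (by omega)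
        rcases h7.eq_or_lt with h8 | h8
        · exact hG.2 ⟨h8, hy⟩
        · exact (hlt (by rw [hG.1.1]; exact h8)).le
      · simp only [hdir, if_true] at i3 ⊢
        refine ⟨by rw [hdiv, hL.1.1, i1], hL.1.2, hlt (by rw [hL.1.1, hxA]; exact i3.1),
          fun y hy hyx => ?_⟩
        have h5 := Nat.div_le_div_right (c := bsz k) hyx.le
        rw [hxA] at h5
        have h6 : y / bsz k ≠ x / (A * bsz k) := fun h => hno (h ▸ hpre hy)
        have h7 := i3.2 _ (hpre hy) (by omega)
        rcases h7.eq_or_lt with h8 | h8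
        · exact hL.2 ⟨h8.symm, hy⟩
        · exact (hlt (by rw [hL.1.1]; exact h8)).le

end Del

/-! ### Addresses and logged writes -/

/-- The address of a cell in word array `1`: its coordinates are digits in base `W`. -/
def enc (W : ℕ) (c : Cell) : ℕ :=
  (((c.1 * W + c.2.1) * W + c.2.2.1) * W + c.2.2.2.1) * W + c.2.2.2.2

/-- The coordinates of the cell are digits in base `W`. -/
def InR (W : ℕ) (c : Cell) : Prop :=
  c.1 < W ∧ c.2.1 < W ∧ c.2.2.1 < W ∧ c.2.2.2.1 < W ∧ c.2.2.2.2 < W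

theorem digit_inj {W a b a' b' : ℕ} (hb : b < W) (hb' : b' < W) (h : a * W + b = a' * W + b') :
    a = a' ∧ b = b' := by
  have h1 := congrArg (· / W) h
  have h2 := congrArg (· % W) h
  have hW : 0 < W := by omega
  simp only [Nat.add_comm _ b, Nat.add_comm _ b', Nat.add_mul_div_right _ _ hW,
    Nat.div_eq_of_lt hb, Nat.div_eq_of_lt hb', zero_add] at h1
  simp only [Nat.add_comm _ b, Nat.add_comm _ b', Nat.add_mul_mod_self_right,
    Nat.mod_eq_of_lt hb, Nat.mod_eq_of_lt hb'] at h2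
  exact ⟨h1, h2⟩

theorem enc_inj {W : ℕ} {c c' : Cell} (hc : InR W c) (hc' : InR W c') (h : enc W c = enc W c') :
    c = c' := by
  obtain ⟨t, r, A, k, z⟩ := c
  obtain ⟨t', r', A', k', z'⟩ := c'
  obtain ⟨h1, h2, h3, h4, h5⟩ := hc
  obtain ⟨h1', h2', h3', h4', h5'⟩ := hc'
  obtain ⟨h, rfl⟩ := digit_inj h5 h5' h
  obtain ⟨h, rfl⟩ := digit_inj h4 h4' h
  obtain ⟨h, rfl⟩ := digit_inj h3 h3' h
  obtain ⟨rfl, rfl⟩ := digit_inj h2 h2' h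
  rfl

theorem digit_lt {W a b N : ℕ} (ha : a < N) (hb : b < W) : a * W + b < N * W := by
  calc a * W + b < a * W + W := by omega
    _ = (a + 1) * W := by ring
    _ ≤ N * W := Nat.mul_le_mul_right _ ha

/-- The memory `mem` after the last `j` of the logged writes, those from number `base` on, have
been undone. `la` and `lv` hold the addresses and the overwritten values. -/
def rollback (la lv : ℕ → ℕ) : ℕ → ℕ → (ℕ → ℕ) → ℕ → ℕ
  | 0, _, mem => mem
  | j + 1, base, mem => rollback la lv j base (Function.update mem (la (base + j)) (lv (base + j)))

theorem rollback_congr {la lv la' lv' : ℕ → ℕ} {j base : ℕ} (mem : ℕ → ℕ)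
    (h : ∀ i, base ≤ i → i < base + j → la i = la' i ∧ lv i = lv' i) :
    rollback la lv j base mem = rollback la' lv' j base mem := by
  induction j generalizing mem with
  | zero => rfl
  | succ j ih =>
    rw [rollback, rollback, (h (base + j) (by omega) (by omega)).1,
      (h (base + j) (by omega) (by omega)).2]
    exact ih _ fun i h1 h2 => h i h1 (by omega)

/-- The constants and tables in the memory: the rank `K` of the stratified trees, the base of the
digits, and the sizes of the universes of smaller rank. -/
structure Env (B K : ℕ) (σ₀ : RamState) : Prop where
  hB : (2 * bsz K) ^ 5 ≤ B
  hK : 1 ≤ K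
  nv3 : σ₀.nv 3 = K
  nv4 : σ₀.nv 4 = 2 * bsz K
  tab : ∀ k ≤ K, σ₀.na 6 k = bsz k

/-- The memory `σ`, reached from `σ₀` by at most `q` logged writes, has the cells `M`. -/
structure Sim (B K : ℕ) (σ₀ : RamState) (q : ℕ) (M : Mem) (σ : RamState) : Prop where
  nv : ∀ v < 8, v ≠ 6 → σ.nv v = σ₀.nv v
  na : ∀ a, a ≠ 1 → a ≠ 2 → a ≠ 3 → a ≠ 10 → σ.na a = σ₀.na a
  rv : σ.rv = σ₀.rv
  ra : σ.ra = σ₀.ra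
  rep : ∀ c, InR (2 * bsz K) c → σ.na 1 (enc (2 * bsz K) c) = M c
  bd : ∀ a, σ.na 1 a ≤ 2 * bsz K
  lp0 : σ₀.nv 6 ≤ σ.nv 6
  lp : σ.nv 6 ≤ σ₀.nv 6 + q
  old : ∀ j < σ₀.nv 6, σ.na 2 j = σ₀.na 2 j ∧ σ.na 3 j = σ₀.na 3 j
  log : ∀ j, σ₀.nv 6 ≤ j → j < σ.nv 6 → σ.na 2 j ≤ B ∧ σ.na 3 j ≤ B
  back : rollback (σ.na 2) (σ.na 3) (σ.nv 6 - σ₀.nv 6) (σ₀.nv 6) (σ.na 1) = σ₀.na 1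

section Sim
variable {B K q : ℕ} {σ₀ σ : RamState} {M : Mem} {Q : ℕ → RamState → Prop}

theorem bsz_le_bsz {k : ℕ} (h : k ≤ K) : bsz k ≤ bsz K :=
  Nat.pow_le_pow_right (by norm_num) (Nat.pow_le_pow_right (by norm_num) h)

theorem lt_bsz (K : ℕ) : K < bsz K :=
  K.lt_two_pow_self.trans (Nat.lt_two_pow_self (n := 2 ^ K))

theorem Env.four_le (hE : Env B K σ₀) : 4 ≤ bsz K := bsz_le_bsz (K := K) hE.hK

theorem Env.base_le (hE : Env B K σ₀) : 2 * bsz K ≤ B :=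
  (Nat.le_self_pow (by norm_num) _).trans hE.hB

theorem Env.sq_le (hE : Env B K σ₀) : 2 * bsz K * (2 * bsz K) ≤ B := by
  refine le_trans ?_ hE.hB
  rw [← pow_two]
  exact Nat.pow_le_pow_right (by have := hE.four_le; omega) (by norm_num)

theorem Env.mul_le (hE : Env B K σ₀) : 16 * bsz K ≤ B := by
  have := hE.four_le
  have := hE.sq_le
  nlinarith

theorem Sim.setNV {v x : ℕ} (hv : 8 ≤ v) (h : Sim B K σ₀ q M σ) :
    Sim B K σ₀ q M (σ.setNV v x) where
  nv u hu hu6 := by rw [nv_setNV, if_neg (by omega)]; exact h.nv u hu hu6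
  na := h.na
  rv := h.rv
  ra := h.ra
  rep := h.rep
  bd := h.bd
  lp0 := by rw [nv_setNV, if_neg (by omega)]; exact h.lp0
  lp := by rw [nv_setNV, if_neg (by omega)]; exact h.lp
  old := h.old
  log := by rw [nv_setNV, if_neg (by omega)]; exact h.log
  back := by rw [nv_setNV, if_neg (by omega)]; exact h.back

theorem Sim.setNA {i x : ℕ} (h : Sim B K σ₀ q M σ) : Sim B K σ₀ q M (σ.setNA 10 i x) where
  nv := h.nv
  na a h1 h2 h3 h10 := by rw [na_setNA, if_neg h10]; exact h.na a h1 h2 h3 h10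
  rv := h.rv
  ra := h.ra
  rep := by simpa using h.rep
  bd := by simpa using h.bd
  lp0 := h.lp0
  lp := h.lp
  old := by simpa using h.old
  log := by simpa using h.log
  back := by simpa using h.back

theorem Sim.mono {q' : ℕ} (hq : q ≤ q') (h : Sim B K σ₀ q M σ) : Sim B K σ₀ q' M σ :=
  { h with lp := h.lp.trans (by omega) }

/-- The address of a cell as an expression. -/
def encE (t r A k z : NExp) : NExp :=
  (((t * var 4 + r) * var 4 + A) * var 4 + k) * var 4 + z

/-- A register or a constant. -/
def Atom (e : NExp) : Prop := (∀ B σ, e.Fits B σ ↔ e.eval σ ≤ B) ∧ e.time = 1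

@[simp] theorem atom_var (v : ℕ) : Atom (var v) := ⟨fun _ _ => Iff.rfl, rfl⟩
@[simp] theorem atom_lit (k : ℕ) : Atom (lit k) := ⟨fun _ _ => Iff.rfl, rfl⟩

theorem encE_spec (hE : Env B K σ₀) (h4 : σ.nv 4 = σ₀.nv 4) {t r A k z : NExp}
    (ha : Atom t ∧ Atom r ∧ Atom A ∧ Atom k ∧ Atom z) {c : Cell}
    (hc : (t.eval σ, r.eval σ, A.eval σ, k.eval σ, z.eval σ) = c) (hr : InR (2 * bsz K) c) :
    (encE t r A k z).Fits B σ ∧ (encE t r A k z).eval σ = enc (2 * bsz K) c ∧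
      (encE t r A k z).time = 17 ∧ enc (2 * bsz K) c ≤ B := by
  obtain ⟨h1, h2, h3, h5, h6⟩ := ha
  subst hc
  have hW : σ.nv 4 = 2 * bsz K := h4.trans hE.nv4
  obtain ⟨i1, i2, i3, i4, i5⟩ := hr
  simp only at i1 i2 i3 i4 i5
  have hBW := hE.base_le
  have hBW5 := hE.hB
  simp only [encE, fits_add, fits_mul, fits_var, eval_add, eval_mul, eval_var, hW, enc,
    time_add, h1.1, h2.1, h3.1, h5.1, h6.1, h1.2, h2.2, h3.2, h5.2, h6.2, NExp.time]
  generalize 2 * bsz K = W at *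
  have b1 := digit_lt i1 i2
  have b2 := digit_lt b1 i3
  have b3 := digit_lt b2 i4
  have b4 := digit_lt b3 i5
  have e5 : W * W * W * W * W = W ^ 5 := by ring
  rw [e5] at b4
  have hW1 : 1 ≤ W := by omega
  have s1 : ∀ a, a ≤ a * W := fun a => Nat.le_mul_of_pos_right a hW1
  have c1 := s1 (t.eval σ * W + r.eval σ)
  have c2 := s1 ((t.eval σ * W + r.eval σ) * W + A.eval σ)
  have c3 := s1 (((t.eval σ * W + r.eval σ) * W + A.eval σ) * W + k.eval σ)
  refine ⟨?_, trivial, trivial, ?_⟩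
  · refine ⟨⟨⟨⟨⟨⟨⟨⟨?_, ?_, ?_⟩, ?_, ?_⟩, ?_, ?_⟩, ?_, ?_⟩, ?_, ?_⟩, ?_, ?_⟩, ?_, ?_⟩, ?_, ?_⟩ <;> omega
  · omega

/-- Read a cell. -/
def ld (v : ℕ) (t r A k z : NExp) : Cmd := .nset v (arr 1 (encE t r A k z))

theorem run_ld (hE : Env B K σ₀) (hS : Sim B K σ₀ q M σ) {v : ℕ} {t r A k z : NExp}
    (ha : Atom t ∧ Atom r ∧ Atom A ∧ Atom k ∧ Atom z) {c : Cell}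
    (hc : (t.eval σ, r.eval σ, A.eval σ, k.eval σ, z.eval σ) = c) (hr : InR (2 * bsz K) c)
    (hQ : M c ≤ 2 * bsz K → Q 19 (σ.setNV v (M c))) : Run B (ld v t r A k z) σ Q := by
  obtain ⟨h1, h2, h3, h4⟩ := encE_spec hE (hS.nv 4 (by norm_num) (by norm_num)) ha hc hr
  have h5 := hS.rep c hr
  have h6 := hS.bd (enc (2 * bsz K) c)
  rw [ld, run_nset, fits_arr, eval_arr, NExp.time, h2, h3, h5]
  rw [h5] at h6
  exact ⟨⟨h1, h6.trans hE.base_le⟩, hQ h6⟩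

/-- Write a cell, and add the address and the old contents to the log. -/
def wr (t r A k z e : NExp) : Cmd :=
  block [.nset 30 (encE t r A k z), .nset 31 e, .nstore 2 (var 6) (var 30),
    .nstore 3 (var 6) (arr 1 (var 30)), .nstore 1 (var 30) (var 31), .nset 6 (var 6 + lit 1)]

theorem run_wr (hE : Env B K σ₀) (hS : Sim B K σ₀ q M σ) {t r A k z e : NExp}
    (ha : Atom t ∧ Atom r ∧ Atom A ∧ Atom k ∧ Atom z) {c : Cell}
    (hc : (t.eval σ, r.eval σ, A.eval σ, k.eval σ, z.eval σ) = c) (hr : InR (2 * bsz K) c) {x : ℕ}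
    (he : ∀ a, e.Fits B (σ.setNV 30 a) ∧ e.eval (σ.setNV 30 a) = x) (hx : x ≤ 2 * bsz K)
    (hq : σ₀.nv 6 + q + 1 ≤ B)
    (hQ : ∀ σ', Sim B K σ₀ (q + 1) (Function.update M c x) σ' →
      (∀ v, v ≠ 6 → v ≠ 30 → v ≠ 31 → σ'.nv v = σ.nv v) → σ'.na 10 = σ.na 10 →
      Q (34 + e.time) σ') :
    Run B (wr t r A k z e) σ Q := by
  obtain ⟨h1, h2, h3, h4⟩ := encE_spec hE (hS.nv 4 (by norm_num) (by norm_num)) ha hc hr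
  have hlp := hS.lp
  have hlp0 := hS.lp0
  have hxB := hx.trans hE.base_le
  have hbd := hS.bd (enc (2 * bsz K) c)
  have hbdB := hbd.trans hE.base_le
  have h1B : 1 ≤ B := by have := hE.base_le; have := hE.four_le; omega
  simp [wr, h1, h2, h3, h4, he, hxB, hbdB, h1B]
  refine ⟨by omega, ?_⟩
  rw [show 18 + (e.time + 1 + 15) = 34 + e.time by omega]
  refine ⟨by omega, hQ _ ?_ ?_ ?_⟩
  rotate_left
  · intro v h6 h30 h31
    simp [h6, h30, h31]
  · simp
  refine ⟨?_, ?_, by simpa using hS.rv, by simpa using hS.ra, ?_, ?_, ?_, ?_, ?_, ?_, ?_⟩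
  · intro v hv h6
    simp [h6, show v ≠ 30 by omega, show v ≠ 31 by omega, hS.nv v hv h6]
  · intro a h1 h2 h3 h10
    simp [h1, h2, h3, hS.na a h1 h2 h3 h10]
  · intro c' hc'
    simp only [na_setNV, na_setNA, if_true, OfNat.one_ne_ofNat, if_false]
    by_cases h : c' = c
    · subst h; simp
    · rw [Function.update_of_ne h, Function.update_of_ne fun he => h (enc_inj hc' hr he), hS.rep c' hc']
  · intro a
    simp only [na_setNV, na_setNA, if_true, OfNat.one_ne_ofNat, if_false, Function.update_apply]
    split_ifs
    exacts [hx, hS.bd a]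
  · simp; omega
  · simp; omega
  · intro j hj
    have := hS.old j hj
    simp [Function.update_of_ne (show j ≠ σ.nv 6 by omega), this]
  · intro j hj1 hj2
    rcases Nat.lt_or_ge j (σ.nv 6) with h | h
    · have := hS.log j hj1 h
      simpa [Function.update_of_ne (show j ≠ σ.nv 6 by omega)] using this
    · have hj : j = σ.nv 6 := by simp at hj2; omega
      simp [hj, h4, hbdB]
  · have := hS.back
    simp only [nv_setNV, if_true, na_setNV, na_setNA, OfNat.one_ne_ofNat, if_false,
      Nat.succ_ne_self, show σ.nv 6 + 1 - σ₀.nv 6 = (σ.nv 6 - σ₀.nv 6) + 1 by omega, rollback,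
      show σ₀.nv 6 + (σ.nv 6 - σ₀.nv 6) = σ.nv 6 by omega]
    simp only [show (2 : ℕ) ≠ 3 by norm_num, show (3 : ℕ) ≠ 1 by norm_num, if_false,
      Function.update_self]
    rw [Function.update_idem, Function.update_eq_self, ← this]
    refine rollback_congr _ fun i h1 h2 => ?_
    rw [Function.update_of_ne (by omega), Function.update_of_ne (by omega)]
    exact ⟨rfl, rfl⟩

/-! ### Programs for the stratified tree -/

/-- One step of the deletion of the element in register `10`, with its neighbours in registers `15`
and `16`, from the tree of the level in register `11`. -/
def vebDelStep : Cmd :=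
  block [.nset 20 (var 20 - lit 1), .nset 22 (arr 6 (var 20)), .nset 23 (var 21 * var 22),
    .nset 24 (var 10 / var 23),
    .ite (.neq (var 15 / var 23) (var 24))
      (.ite (.neq (var 16 / var 23) (var 24)) .skip
        (wr (lit 2) (var 11) (var 21) (var 20) (var 24)
          (var 24 * var 22 + var 22 - lit 1 - var 15 / var 21)))
      (.ite (.neq (var 16 / var 23) (var 24))
        (wr (lit 1) (var 11) (var 21) (var 20) (var 24) (var 16 / var 21 - var 24 * var 22))
        (block [wr (lit 0) (var 11) (var 21) (var 20) (var 24) (lit 1), .nset 21 (var 23)]))]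

/-- Delete the item in register `10`, with neighbours in registers `15` and `16`, from the tree of the
level in register `11`. -/
def vebDelP : Cmd :=
  block [.nset 20 (var 3), .nset 21 (lit 1), .loop (.nle (lit 1) (var 20)) vebDelStep]

theorem run_vebDelStep (hE : Env B K σ₀) (hS : Sim B K σ₀ q M σ) {r x p s k A : ℕ}
    (hr : σ.nv 11 = r) (hx : σ.nv 10 = x) (hp : σ.nv 15 = p) (hs : σ.nv 16 = s)
    (hk : σ.nv 20 = k + 1) (hA : σ.nv 21 = A) (hrW : r < 2 * bsz K) (hxU : x < bsz K)
    (hpU : p < bsz K) (hsU : s < bsz K) (hkK : k < K) (hA0 : 0 < A)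
    (hAU : A * bsz (k + 1) ≤ bsz K) (hq : σ₀.nv 6 + q + 1 ≤ B)
    (hQ : ∀ t σ' A' M', t ≤ 100 → Sim B K σ₀ (q + 1) M' σ' →
      (∀ v < 20, v ≠ 6 → σ'.nv v = σ.nv v) → σ'.nv 20 = k → σ'.nv 21 = A' → 0 < A' →
      A' * bsz k ≤ bsz K → vebDel r x p s (k + 1) A M = vebDel r x p s k A' M' → Q t σ') :
    Run B vebDelStep σ Q := by
  have h4 := hE.four_le
  have hBW := hE.base_le
  have hsq := hE.sq_le
  have hb := bsz_pos k
  have hD : A * bsz k ≤ bsz K := by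
    refine le_trans ?_ hAU
    rw [bsz_succ, ← mul_assoc]; exact Nat.le_mul_of_pos_right _ hb
  have hAD : A ≤ A * bsz k := Nat.le_mul_of_pos_right _ hb
  have hbD : bsz k ≤ A * bsz k := Nat.le_mul_of_pos_left _ hA0
  have htab : σ.na 6 k = bsz k := by
    rw [hS.na 6 (by norm_num) (by norm_num) (by norm_num) (by norm_num)]; exact hE.tab k hkK.le
  have hK := lt_bsz K
  have hz : x / (A * bsz k) ≤ x := Nat.div_le_self _ _
  have hzb : x / (A * bsz k) * bsz k ≤ x := by
    rw [← Nat.div_div_eq_div_mul]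
    exact (Nat.div_mul_le_self _ _).trans (Nat.div_le_self _ _)
  have hpA : p / A ≤ p := Nat.div_le_self _ _
  have hsA : s / A ≤ s := Nat.div_le_self _ _
  have hpD : p / (A * bsz k) ≤ p := Nat.div_le_self _ _
  have hsD : s / (A * bsz k) ≤ s := Nat.div_le_self _ _
  have hin : ∀ t ≤ 2, InR (2 * bsz K) (t, r, A, k, x / (A * bsz k)) := fun t ht => by
    refine ⟨?_, ?_, ?_, ?_, ?_⟩ <;> dsimp only <;> omega
  have hmx : x / (A * bsz k) * bsz k + bsz k - 1 - p / A ≤ 2 * bsz K := by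
    exact (Nat.sub_le _ _).trans ((Nat.sub_le _ _).trans (by omega))
  simp [vebDelStep, hx, hp, hs, hk, hA, htab]
  refine ⟨by omega, by omega, by omega, by omega, by omega, fun h1 => ⟨by omega, fun h2 => ?_, fun h2 => ?_⟩,
    fun h1 => ⟨by omega, fun h2 => ?_, fun h2 => ?_⟩⟩
  · refine hQ _ _ A M (by norm_num) ?_ ?_ (by simp) (by simpa using hA) hA0 hD ?_
    · exact ((((hS.setNV (by norm_num)).setNV (by norm_num)).setNV (by norm_num)).setNV
        (by norm_num)).mono (by omega)
    · intro v hv h6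
      simp [show v ≠ 20 by omega, show v ≠ 22 by omega, show v ≠ 23 by omega, show v ≠ 24 by omega]
    · simp only [vebDel, h1, h2, if_true]
  · refine run_wr hE ((((hS.setNV (by norm_num)).setNV (by norm_num)).setNV (by norm_num)).setNV
      (by norm_num)) (by simp) (c := (2, r, A, k, x / (A * bsz k))) (by simp [hr, hA])
      (hin _ (by norm_num)) (x := x / (A * bsz k) * bsz k + bsz k - 1 - p / A)
      (fun a => ?_) hmx hq ?_
    · simp [hA, hp]
      generalize x / (A * bsz k) * bsz k = y at hzb ⊢
      omega
    · intro σ' h3 h4 h5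
      refine hQ _ _ A _ (by simp) h3 (fun v hv h6 => ?_) ?_ ?_ hA0 hD ?_
      · rw [h4 v h6 (by omega) (by omega)]
        simp [show v ≠ 20 by omega, show v ≠ 22 by omega, show v ≠ 23 by omega, show v ≠ 24 by omega]
      · rw [h4 20 (by norm_num) (by norm_num) (by norm_num)]; simp
      · rw [h4 21 (by norm_num) (by norm_num) (by norm_num)]; simp [hA]
      · simp only [vebDel, h1, h2, if_true, if_false]
  · refine run_wr hE ((((hS.setNV (by norm_num)).setNV (by norm_num)).setNV (by norm_num)).setNV
      (by norm_num)) (by simp) (c := (1, r, A, k, x / (A * bsz k))) (by simp [hr, hA])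
      (hin _ (by norm_num)) (x := s / A - x / (A * bsz k) * bsz k)
      (fun a => ?_) (by omega) hq ?_
    · simp [hA, hs]; omega
    · intro σ' h3 h4 h5
      refine hQ _ _ A _ (by simp) h3 (fun v hv h6 => ?_) ?_ ?_ hA0 hD ?_
      · rw [h4 v h6 (by omega) (by omega)]
        simp [show v ≠ 20 by omega, show v ≠ 22 by omega, show v ≠ 23 by omega, show v ≠ 24 by omega]
      · rw [h4 20 (by norm_num) (by norm_num) (by norm_num)]; simp
      · rw [h4 21 (by norm_num) (by norm_num) (by norm_num)]; simp [hA]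
      · simp only [vebDel, h1, h2, if_true, if_false]
  · refine run_wr hE ((((hS.setNV (by norm_num)).setNV (by norm_num)).setNV (by norm_num)).setNV
      (by norm_num)) (by simp) (c := (0, r, A, k, x / (A * bsz k))) (by simp [hr, hA])
      (hin _ (by norm_num)) (x := 1)
      (fun a => ?_) (by omega) hq ?_
    · simp; omega
    · intro σ' h3 h4 h5
      have h23 : σ'.nv 23 = A * bsz k := by
        rw [h4 23 (by norm_num) (by norm_num) (by norm_num)]; simp
      rw [h23]
      refine ⟨by omega, hQ _ _ (A * bsz k) _ (by simp) (h3.setNV (by norm_num))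
        (fun v hv h6 => ?_) ?_ (by simp) (by omega) ?_ ?_⟩
      · rw [nv_setNV, if_neg (by omega), h4 v h6 (by omega) (by omega)]
        simp [show v ≠ 20 by omega, show v ≠ 22 by omega, show v ≠ 23 by omega, show v ≠ 24 by omega]
      · rw [nv_setNV, if_neg (by omega), h4 20 (by norm_num) (by norm_num) (by norm_num)]; simp
      · rw [mul_assoc, ← bsz_succ]; exact hAU
      · simp only [vebDel, h1, h2, if_false]

theorem run_vebDelP (hE : Env B K σ₀) (hS : Sim B K σ₀ q M σ) {r x p s : ℕ}
    (hr : σ.nv 11 = r) (hx : σ.nv 10 = x) (hp : σ.nv 15 = p) (hs : σ.nv 16 = s)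
    (hrW : r < 2 * bsz K) (hxU : x < bsz K)
    (hpU : p < bsz K) (hsU : s < bsz K) (hq : σ₀.nv 6 + q + K ≤ B)
    (hQ : ∀ t σ', t ≤ 105 * K + 10 → Sim B K σ₀ (q + K) (vebDel r x p s K 1 M) σ' →
      (∀ v < 20, v ≠ 6 → σ'.nv v = σ.nv v) → Q t σ') :
    Run B vebDelP σ Q := by
  have h4 := hE.four_le
  have hBW := hE.base_le
  have hK := lt_bsz K
  have h3 : σ.nv 3 = K := (hS.nv 3 (by norm_num) (by norm_num)).trans hE.nv3
  simp [vebDelP, h3]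
  refine ⟨by omega, by omega, ?_⟩
  refine (run_loop (c := 100) (fun j σ' => ∃ A M', Sim B K σ₀ (q + j) M' σ' ∧
    (∀ v < 20, v ≠ 6 → σ'.nv v = σ.nv v) ∧ σ'.nv 20 = K - j ∧ σ'.nv 21 = A ∧ 0 < A ∧
    A * bsz (K - j) ≤ bsz K ∧ vebDel r x p s K 1 M = vebDel r x p s (K - j) A M') K
    ?_ ?_ ?_).mono ?_
  · rintro j hj σ₁ ⟨A, M', i1, i2, i3, i4, i5, i6, i7⟩
    obtain ⟨k, hk⟩ : ∃ k, K - j = k + 1 := ⟨K - j - 1, by omega⟩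
    have hk' : K - (j + 1) = k := by omega
    rw [hk] at i3 i6 i7
    refine ⟨by simp [i3]; omega, by simp [i3], ?_⟩
    refine run_vebDelStep hE i1 (by rw [i2 11 (by norm_num) (by norm_num), hr])
      (by rw [i2 10 (by norm_num) (by norm_num), hx])
      (by rw [i2 15 (by norm_num) (by norm_num), hp])
      (by rw [i2 16 (by norm_num) (by norm_num), hs]) i3 i4 hrW hxU hpU hsU (by omega) i5 i6
      (by omega) ?_
    intro t σ' A' M'' ht j1 j2 j3 j4 j5 j6 j7
    refine ⟨ht, A', M'', j1, fun v hv h6 => (j2 v hv h6).trans (i2 v hv h6), ?_⟩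
    rw [hk']
    exact ⟨j3, j4, j5, j6, i7.trans j7⟩
  · rintro σ₁ ⟨A, M', i1, i2, i3, -⟩
    simp [i3]; omega
  · refine ⟨1, M, (hS.setNV (by norm_num)).setNV (by norm_num), fun v hv h6 => ?_, ?_⟩
    · simp [show v ≠ 20 by omega, show v ≠ 21 by omega]
    · simp
  · rintro t σ' ⟨ht, A, M', i1, i2, i3, i4, i5, i6, i7⟩
    refine hQ _ _ ?_ ?_ i2
    · simp at ht; omega
    · rw [i7, Nat.sub_self]; exact i1

end Sim

section Sim
variable {B K q : ℕ} {σ₀ σ : RamState} {M : Mem} {Q : ℕ → RamState → Prop}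

/-- One step of the descent of the search for the element in register `10` in the tree of the level
in register `11`. The resolutions on the way are put into word array `10`. -/
def vebDownStep : Cmd :=
  block [.nset 20 (var 20 - lit 1), .nset 22 (arr 6 (var 20)), .nset 23 (var 21 * var 22),
    .nset 24 (var 10 / var 23), ld 27 (lit 0) (var 11) (var 21) (var 20) (var 24),
    .ite (.neq (var 27) (lit 0)) .skip (.nset 21 (var 23)), .nstore 10 (var 20) (var 21)]

/-- One step of the way back from the result for the clusters to that for the elements. -/
def vebUpStep : Cmd :=
  block [.nset 26 (arr 10 (var 20 + lit 1)),
    .ite (.neq (var 26) (var 21)) .skip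
      (block [.nset 22 (arr 6 (var 20)),
        .ite (.neq (var 25) (lit 1))
          (block [ld 27 (lit 1) (var 11) (var 26) (var 20) (var 24),
            .nset 24 (var 24 * var 22 + var 27)])
          (block [ld 27 (lit 2) (var 11) (var 26) (var 20) (var 24),
            .nset 24 (var 24 * var 22 + var 22 - lit 1 - var 27)])]),
    .nset 21 (var 26), .nset 20 (var 20 + lit 1)]

/-- Find a neighbour, on the side of the sibling at the bottom of the search, of the item in register
`10` in the tree of the level in register `11`: register `24` gets it, and register `25` the side (`1`
for a successor). Array `10` keeps the resolutions visited on the way down for the way back up. -/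
def vebFindP : Cmd :=
  block [.nset 20 (var 3), .nset 21 (lit 1), .nstore 10 (var 3) (lit 1),
    .loop (.nle (lit 1) (var 20)) vebDownStep,
    .nset 24 (var 10 / var 21),
    .ite (.neq (var 24 / lit 2 * lit 2) (var 24))
      (block [.nset 24 (var 24 + lit 1), .nset 25 (lit 1)])
      (block [.nset 24 (var 24 - lit 1), .nset 25 (lit 0)]),
    .loop (.not (.nle (var 3) (var 20))) vebUpStep]

/-- `P` holds the resolutions visited by the search, from rank `K` down to rank `k`. -/
structure Trail (M : Mem) (r x K : ℕ) (S : Set ℕ) (P : ℕ → ℕ) (k : ℕ) : Prop where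
  top : P K = 1
  ok : ∀ i, k ≤ i → i ≤ K → 0 < P i ∧ P i * bsz i ≤ bsz K ∧ FindOK M r x S i (P i)
  step : ∀ i, k ≤ i → i < K → P i = if M (0, r, P (i + 1), i, x / (P (i + 1) * bsz i)) = 0
    then P (i + 1) else P (i + 1) * bsz i

theorem run_vebDownStep (hE : Env B K σ₀) (hS : Sim B K σ₀ q M σ) {r x k : ℕ} {S : Set ℕ}
    (hr : σ.nv 11 = r) (hx : σ.nv 10 = x) (hrW : r < 2 * bsz K) (hxU : x < bsz K)
    (hk : σ.nv 20 = k + 1) (hkK : k < K) (hP : Trail M r x K S (σ.na 10) (k + 1))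
    (hA : σ.nv 21 = σ.na 10 (k + 1))
    (hQ : ∀ t σ', t ≤ 60 → Sim B K σ₀ q M σ' → (∀ v < 20, σ'.nv v = σ.nv v) →
      σ'.nv 20 = k → Trail M r x K S (σ'.na 10) k → σ'.nv 21 = σ'.na 10 k → Q t σ') :
    Run B vebDownStep σ Q := by
  have h4 := hE.four_le
  have hBW := hE.mul_le
  have hb := bsz_pos k
  obtain ⟨hA0, hAU, hF⟩ := hP.ok (k + 1) le_rfl hkK
  set A := σ.na 10 (k + 1) with hAdef
  have hAbU : A * bsz k * bsz k ≤ bsz K := by rwa [mul_assoc, ← bsz_succ]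
  have hD : A * bsz k ≤ bsz K := (Nat.le_mul_of_pos_right _ hb).trans hAbU
  have hAD : A ≤ A * bsz k := Nat.le_mul_of_pos_right _ hb
  have hbD : bsz k ≤ A * bsz k := Nat.le_mul_of_pos_left _ hA0
  have htab : σ.na 6 k = bsz k := by
    rw [hS.na 6 (by norm_num) (by norm_num) (by norm_num) (by norm_num)]; exact hE.tab k hkK.le
  have hK := lt_bsz K
  have hz : x / (A * bsz k) ≤ x := Nat.div_le_self _ _
  simp [vebDownStep, hx, hk, hA, htab]
  and_intros <;> try omega
  refine run_ld hE ((((hS.setNV (by norm_num)).setNV (by norm_num)).setNV (by norm_num)).setNV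
    (by norm_num)) (by simp) (c := (0, r, A, k, x / (A * bsz k))) (by simp [hr, hA]) ?_ fun hM => ?_
  · refine ⟨?_, ?_, ?_, ?_, ?_⟩ <;> dsimp only <;> omega
  have hpath : ∀ A', (A' = if M (0, r, A, k, x / (A * bsz k)) = 0 then A else A * bsz k) →
      Trail M r x K S (Function.update (σ.na 10) k A') k := by
    intro A' hA'
    constructor
    · rw [Function.update_of_ne (by omega)]; exact hP.top
    · intro i hi1 hi2
      rcases hi1.eq_or_lt with rfl | hi1
      · rw [Function.update_self, hA']
        split_ifs with he
        · exact ⟨hA0, hD, hF.left he⟩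
        · exact ⟨by omega, hAbU, hF.right he⟩
      · rw [Function.update_of_ne (by omega)]
        exact hP.ok i hi1 hi2
    · intro i hi1 hi2
      rcases hi1.eq_or_lt with rfl | hi1
      · rw [Function.update_self, Function.update_of_ne (by omega), hA']
      · rw [Function.update_of_ne (by omega), Function.update_of_ne (by omega)]
        exact hP.step i hi1 hi2
  simp [hA]
  and_intros <;> try omega
  all_goals
    intro he
    and_intros <;> try omega
  · refine hQ _ _ (by norm_num) ?_ ?_ (by simp) ?_ ?_
    · exact (((((hS.setNV (by norm_num)).setNV (by norm_num)).setNV (by norm_num)).setNV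
        (by norm_num)).setNV (by norm_num)).setNA
    · intro v hv
      simp [show v ≠ 20 by omega, show v ≠ 22 by omega, show v ≠ 23 by omega,
        show v ≠ 24 by omega, show v ≠ 27 by omega]
    · simpa using hpath A (by rw [if_pos he])
    · simp [hA]
  · refine hQ _ _ (by norm_num) ?_ ?_ (by simp) ?_ ?_
    · exact ((((((hS.setNV (by norm_num)).setNV (by norm_num)).setNV (by norm_num)).setNV
        (by norm_num)).setNV (by norm_num)).setNV (by norm_num)).setNA
    · intro v hv
      simp [show v ≠ 20 by omega, show v ≠ 21 by omega, show v ≠ 22 by omega,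
        show v ≠ 23 by omega, show v ≠ 24 by omega, show v ≠ 27 by omega]
    · simpa using hpath (A * bsz k) (by rw [if_neg he])
    · simp

theorem run_vebUpStep (hE : Env B K σ₀) (hS : Sim B K σ₀ q M σ) {r x k : ℕ} {S : Set ℕ}
    (hr : σ.nv 11 = r) (hrW : r < 2 * bsz K) (hxU : x < bsz K)
    (hk : σ.nv 20 = k) (hkK : k < K) (hP : Trail M r x K S (σ.na 10) 0)
    (hA : σ.nv 21 = σ.na 10 k)
    (hy : σ.nv 24 = (vebFind r x M k (σ.na 10 k)).2)
    (hd : σ.nv 25 = if (vebFind r x M k (σ.na 10 k)).1 then 1 else 0)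
    (hQ : ∀ t σ', t ≤ 80 → Sim B K σ₀ q M σ' → (∀ v < 20, σ'.nv v = σ.nv v) →
      σ'.na 10 = σ.na 10 → σ'.nv 20 = k + 1 → σ'.nv 21 = σ.na 10 (k + 1) →
      σ'.nv 24 = (vebFind r x M (k + 1) (σ.na 10 (k + 1))).2 →
      σ'.nv 25 = (if (vebFind r x M (k + 1) (σ.na 10 (k + 1))).1 then 1 else 0) → Q t σ') :
    Run B vebUpStep σ Q := by
  have h4 := hE.four_le
  have hBW := hE.mul_le
  have hb := two_le_bsz k
  obtain ⟨hA0, hAU, hF⟩ := hP.ok k (by omega) hkK.le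
  obtain ⟨hA0', hAU', hF'⟩ := hP.ok (k + 1) (by omega) hkK
  have hstep := hP.step k (by omega) hkK
  set A' := σ.na 10 (k + 1) with hA'
  set A := σ.na 10 k with hAd
  have hAbU : A' * bsz k * bsz k ≤ bsz K := by rwa [mul_assoc, ← bsz_succ]
  have hD : A' * bsz k ≤ bsz K := (Nat.le_mul_of_pos_right _ (by omega)).trans hAbU
  have hAD : A' < A' * bsz k := by nlinarith
  have htab : σ.na 6 k = bsz k := by
    rw [hS.na 6 (by norm_num) (by norm_num) (by norm_num) (by norm_num)]; exact hE.tab k hkK.le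
  have hK := lt_bsz K
  obtain ⟨s1, -, -⟩ := vebFind_spec hF
  simp [vebUpStep, hk, hA, ← hA']
  by_cases he : M (0, r, A', k, x / (A' * bsz k)) = 0
  · have hAA : A = A' := by rw [hstep, if_pos he]
    simp only [hAA, not_true_eq_false, false_imp_iff, and_true, true_imp_iff]
    and_intros <;> try omega
    have hv : vebFind r x M (k + 1) A' = vebFind r x M k A := by
      rw [hAA]; simp only [vebFind, if_pos he]
    refine hQ _ _ (by norm_num) (((hS.setNV (by norm_num)).setNV (by norm_num)).setNV
      (by norm_num)) (fun v hv => ?_) rfl (by simp) (by simp) ?_ ?_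
    · simp [show v ≠ 20 by omega, show v ≠ 21 by omega, show v ≠ 26 by omega]
    · rw [hv]; simp [hy]
    · rw [hv]; simp [hd]
  · have hAA : A = A' * bsz k := by rw [hstep, if_neg he]
    have hne : A' ≠ A := by omega
    simp only [hne, not_false_eq_true, false_imp_iff, true_imp_iff, true_and, htab]
    set y := (vebFind r x M k A).2 with hyd
    have hyb : (y + 1) * bsz k ≤ 2 * bsz K := by
      have e1 : y < (x / (A * bsz k) + 1) * bsz k := by
        rw [← Nat.div_lt_iff_lt_mul (by omega), s1]; omega
      have e2 : x / (A * bsz k) * (bsz k * bsz k) ≤ x := by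
        rw [hAA, mul_assoc A', ← Nat.div_div_eq_div_mul]
        exact (Nat.div_mul_le_self _ _).trans (Nat.div_le_self _ _)
      have e3 : bsz k * bsz k ≤ bsz K := by
        rw [← bsz_succ]; exact bsz_le_bsz hkK
      have e4 := Nat.mul_le_mul_right (bsz k) e1
      nlinarith
    have hyy : y + 1 ≤ (y + 1) * bsz k := Nat.le_mul_of_pos_right _ (by omega)
    rw [add_mul, one_mul] at hyb
    have hy2 : y < 2 * bsz K := by rw [add_mul] at hyy; omega
    have hbU := bsz_le_bsz hkK.le
    have hin : ∀ t ≤ 2, InR (2 * bsz K) (t, r, A', k, y) := fun t ht => by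
      refine ⟨?_, ?_, ?_, ?_, ?_⟩ <;> dsimp only <;> omega
    have hv1 : (vebFind r x M (k + 1) A').1 = (vebFind r x M k A).1 := by
      simp only [vebFind, if_neg he, hAA]
    have hv2 : (vebFind r x M (k + 1) A').2 = if (vebFind r x M k A).1 then
        y * bsz k + M (1, r, A', k, y) else y * bsz k + bsz k - 1 - M (2, r, A', k, y) := by
      simp only [vebFind, if_neg he, hyd, hAA]
    have hSim := (hS.setNV (v := 26) (x := A') (by norm_num)).setNV (v := 22) (x := bsz k)
      (by norm_num)
    have h25 : σ.nv 25 ≤ 1 := by rw [hd]; split_ifs <;> omega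
    and_intros <;> try omega
    · intro h25
      have hdir : (vebFind r x M k A).1 = true := by
        by_contra h; rw [if_neg h] at hd; omega
      rw [hdir] at hv1
      rw [if_pos hdir] at hv2
      refine run_ld hE hSim (by simp) (c := (1, r, A', k, y)) (by simp [hr, hk, hy])
        (hin _ (by norm_num)) fun hM => ?_
      simp [hy, hk]
      and_intros <;> try omega
      refine hQ _ _ (by norm_num) ((((hSim.setNV (by norm_num)).setNV (by norm_num)).setNV
        (by norm_num)).setNV (by norm_num)) (fun v hv => ?_) rfl (by simp) (by simp) ?_ ?_
      · simp [show v ≠ 20 by omega, show v ≠ 21 by omega, show v ≠ 22 by omega,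
          show v ≠ 24 by omega, show v ≠ 26 by omega, show v ≠ 27 by omega]
      · simp [hv2]
      · simp [hv1, h25]
    · intro h25
      have hdir : (vebFind r x M k A).1 = false := by
        by_contra h; rw [if_pos (by simpa using h)] at hd; omega
      rw [hdir] at hv1
      rw [if_neg (by simp [hdir])] at hv2
      have hd0 : σ.nv 25 = 0 := by omega
      refine run_ld hE hSim (by simp) (c := (2, r, A', k, y)) (by simp [hr, hk, hy])
        (hin _ (by norm_num)) fun hM => ?_
      simp [hy, hk]
      and_intros <;> try omega
      refine hQ _ _ (by norm_num) ((((hSim.setNV (by norm_num)).setNV (by norm_num)).setNV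
        (by norm_num)).setNV (by norm_num)) (fun v hv => ?_) rfl (by simp) (by simp) ?_ ?_
      · simp [show v ≠ 20 by omega, show v ≠ 21 by omega, show v ≠ 22 by omega,
          show v ≠ 24 by omega, show v ≠ 26 by omega, show v ≠ 27 by omega]
      · simp [hv2]
      · simp [hv1, hd0]

theorem run_vebFindP (hE : Env B K σ₀) (hS : Sim B K σ₀ q M σ) {r x : ℕ} {S : Set ℕ}
    (hr : σ.nv 11 = r) (hx : σ.nv 10 = x) (hrW : r < 2 * bsz K) (hxU : x < bsz K)
    (hF : FindOK M r x S K 1)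
    (hQ : ∀ t σ', t ≤ 150 * K + 50 → Sim B K σ₀ q M σ' → (∀ v < 20, σ'.nv v = σ.nv v) →
      σ'.nv 24 = (vebFind r x M K 1).2 →
      σ'.nv 25 = (if (vebFind r x M K 1).1 then 1 else 0) → Q t σ') :
    Run B vebFindP σ Q := by
  have h4 := hE.four_le
  have hBW := hE.mul_le
  have hsq := hE.sq_le
  have hK := lt_bsz K
  have h3 : σ.nv 3 = K := (hS.nv 3 (by norm_num) (by norm_num)).trans hE.nv3
  have h3' : ∀ σ' : RamState, (∀ v < 20, σ'.nv v = σ.nv v) → σ'.nv 3 = K := fun σ' h => by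
    rw [h 3 (by norm_num), h3]
  simp [vebFindP, h3]
  and_intros <;> try omega
  refine (run_loop (c := 60) (fun j σ' => Sim B K σ₀ q M σ' ∧ (∀ v < 20, σ'.nv v = σ.nv v) ∧
    σ'.nv 20 = K - j ∧ Trail M r x K S (σ'.na 10) (K - j) ∧ σ'.nv 21 = σ'.na 10 (K - j)) K
    ?_ ?_ ?_).mono ?_
  · rintro j hj σ₁ ⟨i1, i2, i3, i4, i5⟩
    obtain ⟨k, hk⟩ : ∃ k, K - j = k + 1 := ⟨K - j - 1, by omega⟩
    have hk' : K - (j + 1) = k := by omega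
    rw [hk] at i3 i4 i5
    refine ⟨by simp [i3]; omega, by simp [i3], ?_⟩
    refine run_vebDownStep hE i1 (by rw [i2 11 (by norm_num), hr]) (by rw [i2 10 (by norm_num), hx])
      hrW hxU i3 (by omega) i4 i5 ?_
    intro t σ' ht j1 j2 j3 j4 j5
    rw [hk']
    exact ⟨ht, j1, fun v hv => (j2 v hv).trans (i2 v hv), j3, j4, j5⟩
  · rintro σ₁ ⟨i1, i2, i3, -⟩
    simp [i3]; omega
  · refine ⟨((hS.setNV (by norm_num)).setNV (by norm_num)).setNA, fun v hv => ?_, ?_, ?_, ?_⟩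
    · simp [show v ≠ 20 by omega, show v ≠ 21 by omega]
    · simp
    · rw [Nat.sub_zero]
      constructor
      · simp
      · intro i hi1 hi2
        obtain rfl : i = K := by omega
        simpa using hF
      · intro i hi1 hi2; omega
    · simp
  · rintro t σ₁ ⟨ht, i1, i2, i3, i4, i5⟩
    rw [Nat.sub_self] at i3 i4 i5
    simp only [BExp.time, NExp.time] at ht
    obtain ⟨hA0, hAU, -⟩ := i4.ok 0 le_rfl (by omega)
    set A := σ₁.na 10 0 with hA
    have hb0 : bsz 0 = 2 := rfl
    rw [hb0] at hAU
    have hxA : x / A ≤ x := Nat.div_le_self _ _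
    have hx1 : σ₁.nv 10 = x := by rw [i2 10 (by norm_num), hx]
    simp [hx1, i5]
    -- the loop on the way back
    have up : ∀ σ₂, Sim B K σ₀ q M σ₂ → (∀ v < 20, σ₂.nv v = σ.nv v) → σ₂.na 10 = σ₁.na 10 →
        σ₂.nv 20 = 0 → σ₂.nv 21 = A → σ₂.nv 24 = (vebFind r x M 0 A).2 →
        σ₂.nv 25 = (if (vebFind r x M 0 A).1 then 1 else 0) →
        Run B (.loop (.not (.nle (var 3) (var 20))) vebUpStep) σ₂ fun t' σ' => t' ≤ K * 85 + 5 ∧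
          Sim B K σ₀ q M σ' ∧ (∀ v < 20, σ'.nv v = σ.nv v) ∧ σ'.nv 24 = (vebFind r x M K 1).2 ∧
          σ'.nv 25 = (if (vebFind r x M K 1).1 then 1 else 0) := by
      intro σ₂ j1 j2 j3 j4 j5 j6 j7
      refine (run_loop (c := 80) (fun k σ' => Sim B K σ₀ q M σ' ∧ (∀ v < 20, σ'.nv v = σ.nv v) ∧
        σ'.na 10 = σ₁.na 10 ∧ σ'.nv 20 = k ∧ σ'.nv 21 = σ₁.na 10 k ∧
        σ'.nv 24 = (vebFind r x M k (σ₁.na 10 k)).2 ∧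
        σ'.nv 25 = (if (vebFind r x M k (σ₁.na 10 k)).1 then 1 else 0)) K ?_ ?_ ?_).mono ?_
      · rintro k hk σ₃ ⟨l1, l2, l3, l4, l5, l6, l7⟩
        have hn3 := h3' σ₃ l2
        refine ⟨by simp [l4, hn3]; omega, by simp [l4, hn3]; omega, ?_⟩
        refine run_vebUpStep hE l1 (x := x) (S := S) (by rw [l2 11 (by norm_num), hr]) hrW hxU l4 hk
          (by rw [l3]; exact i4) (by rw [l3]; exact l5) (by rw [l3]; exact l6)
          (by rw [l3]; exact l7) ?_
        rw [l3]
        exact fun t σ' ht m1 m2 m3 m4 m5 m6 m7 =>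
          ⟨ht, m1, fun v hv => (m2 v hv).trans (l2 v hv), m3, m4, m5, m6, m7⟩
      · rintro σ₃ ⟨l1, l2, l3, l4, -⟩
        have hn3 := h3' σ₃ l2
        simp [l4, hn3]; omega
      · exact ⟨j1, j2, j3, j4, j5, j6, j7⟩
      · rintro t' σ' ⟨ht', l1, l2, l3, l4, l5, l6, l7⟩
        simp only [BExp.time, NExp.time] at ht'
        rw [i4.top] at l6 l7
        exact ⟨by omega, l1, l2, l6, l7⟩
    and_intros <;> try omega
    · intro he
      and_intros <;> try omega
      refine (up _ (((i1.setNV (by norm_num)).setNV (by norm_num)).setNV (by norm_num))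
        (fun v hv => ?_) rfl (by simpa using i3) (by simpa using i5) ?_ ?_).mono
        fun t' σ' ⟨h1, h2, h3, h4, h5⟩ => hQ _ _ (by omega) h2 h3 h4 h5
      · simp [show v ≠ 24 by omega, show v ≠ 25 by omega, i2 v hv]
      · simp [vebFind, he]
      · simp [vebFind, he]
    · intro he
      and_intros <;> try omega
      refine (up _ (((i1.setNV (by norm_num)).setNV (by norm_num)).setNV (by norm_num))
        (fun v hv => ?_) rfl (by simpa using i3) (by simpa using i5) ?_ ?_).mono
        fun t' σ' ⟨h1, h2, h3, h4, h5⟩ => hQ _ _ (by omega) h2 h3 h4 h5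
      · simp [show v ≠ 24 by omega, show v ≠ 25 by omega, i2 v hv]
      · simp [vebFind, he]
      · simp [vebFind, he]
end Sim

/-! ### Levels -/

/-- The cells of level `r` are right for the threshold numbers `v`: the stratified tree holds the
set of separators, that is, of positions `x` with `r ≤ v x`, and each two consecutive separators
`p < s` know their distance (tags `3` and `4`) and the count of the run between them (tag `5`). -/
structure GoodLevel (f : ℕ → ℕ) (n K : ℕ) (v : ℕ → ℕ) (M : Mem) (r : ℕ) : Prop where
  veb : VEB M r {x | r ≤ v x} K 1 0
  link : ∀ p s, p < s → s ≤ n + 1 → r ≤ v p → r ≤ v s → (∀ y, p < y → y < s → v y < r) →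
    M (3, r, 0, 0, p) = s - p - 1 ∧ M (4, r, 0, 0, s) = s - p - 1 ∧
      M (5, r, 0, 0, s) = run f r v (p + 1) s

section Level
variable {f v v' : ℕ → ℕ} {n K m r x p s r₀ : ℕ} {M M' : Mem}

/-- A level depends only on its own cells and on the numbers below it. -/
theorem GoodLevel.congr (h : GoodLevel f n K v M r) (hM : ∀ c : Cell, c.2.1 = r → M c = M' c)
    (hS : ∀ y, r ≤ v y ↔ r ≤ v' y) (hv : ∀ y, v y < r → v y = v' y) : GoodLevel f n K v' M' r where
  veb := h.veb.congr one_pos (fun y _ => by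
    have : {x | r ≤ v x} = {x | r ≤ v' x} := Set.ext hS
    rw [this]) fun t _ A' k' _ c _ _ _ => hM _ rfl
  link p s h1 h2 h3 h4 h5 := by
    have h5' : ∀ y, p < y → y < s → v y < r := fun y h6 h7 => by
      have := h5 y h6 h7; have := hS y; omega
    have := h.link p s h1 h2 ((hS p).2 h3) ((hS s).2 h4) h5'
    rw [hM _ rfl, hM _ rfl, hM _ rfl, run_congr fun y h6 h7 => hv y (h5' y h6 h7)] at this
    exact this

/-- Positions `p` and `s` are the separators of level `r` next to `x`. -/
structure Between (v : ℕ → ℕ) (n r p x s : ℕ) : Prop where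
  px : p < x
  xs : x < s
  sn : s ≤ n + 1
  hp : r ≤ v p
  hs : r ≤ v s
  hv : ∀ y, p < y → y < s → y ≠ x → v y < r

theorem Between.exists (h0 : r ≤ v 0) (hn : r ≤ v (n + 1)) (h1 : 1 ≤ x) (h2 : x ≤ n) :
    ∃ p s, Between v n r p x s := by
  classical
  have hs : ∃ s, x < s ∧ r ≤ v s := ⟨n + 1, by omega, hn⟩
  have hp : ∃ j, j < x ∧ r ≤ v (x - 1 - j) := ⟨x - 1, by omega, by simpa using h0⟩
  refine ⟨x - 1 - Nat.find hp, Nat.find hs, by omega, (Nat.find_spec hs).1,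
    Nat.find_min' hs ⟨by omega, hn⟩, (Nat.find_spec hp).2, (Nat.find_spec hs).2, fun y h3 h4 h5 => ?_⟩
  have hpx := (Nat.find_spec hp).1
  rcases Nat.lt_or_gt_of_ne h5 with h | h
  · have := Nat.find_min hp (m := x - 1 - y) (by omega)
    rw [show x - 1 - (x - 1 - y) = y by omega] at this
    by_contra hc
    exact this ⟨by omega, by omega⟩
  · have := Nat.find_min hs h4
    by_contra hc
    exact this ⟨h, by omega⟩

theorem Between.link_left (h : Between v n r p x s) (hG : GoodLevel f n K v M r) (hx : r ≤ v x) :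
    M (4, r, 0, 0, x) = x - p - 1 ∧ M (5, r, 0, 0, x) = run f r v (p + 1) x :=
  (hG.link p x h.px (by have := h.xs; have := h.sn; omega) h.hp hx fun y h1 h2 =>
    h.hv y h1 (h2.trans h.xs) h2.ne).2

theorem Between.link_right (h : Between v n r p x s) (hG : GoodLevel f n K v M r) (hx : r ≤ v x) :
    M (3, r, 0, 0, x) = s - x - 1 ∧ M (5, r, 0, 0, s) = run f r v (x + 1) s := by
  have := hG.link x s h.xs h.sn hx h.hs fun y h1 h2 => h.hv y (h.px.trans h1) h2 h1.ne'
  exact ⟨this.1, this.2.2⟩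

theorem Between.link_both (h : Between v n r p x s) (hG : GoodLevel f n K v M r) (hx : v x < r) :
    M (3, r, 0, 0, p) = s - p - 1 ∧ M (5, r, 0, 0, s) = run f r v (p + 1) s := by
  have := hG.link p s (h.px.trans h.xs) h.sn h.hp h.hs fun y h1 h2 => by
    by_cases he : y = x
    · rwa [he]
    · exact h.hv y h1 h2 he
  exact ⟨this.1, this.2.2⟩

/-- The cells after the deletion of the separator `x` of level `r`. -/
def delCells (r p x s K new : ℕ) (M : Mem) : Mem :=
  vebDel r x p s K 1 (Function.update (Function.update (Function.update M
    (3, r, 0, 0, p) (s - p - 1)) (4, r, 0, 0, s) (s - p - 1)) (5, r, 0, 0, s) new)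

theorem delCells_of_ne {new : ℕ} {c : Cell} (hc : c.2.1 ≠ r) :
    delCells r p x s K new M c = M c := by
  rw [delCells, vebDel_apply_of_ne one_pos, Function.update_of_ne, Function.update_of_ne,
    Function.update_of_ne]
  · rintro rfl; exact hc rfl
  · rintro rfl; exact hc rfl
  · rintro rfl; exact hc rfl
  · rintro t _ A' k' _ _ _ rfl; exact hc rfl

theorem Between.good_delCells (h : Between v n r p x s) (hG : GoodLevel f n K v M r)
    (hx : r ≤ v x) (hr₀ : r₀ < r) (hn : n + 1 < bsz K) {new : ℕ}
    (hnew : new = run f r (Function.update v x r₀) (p + 1) s) :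
    GoodLevel f n K (Function.update v x r₀) (delCells r p x s K new M) r := by
  have hne : ∀ y, y ≠ x → Function.update v x r₀ y = v y := fun y hy => by simp [hy]
  have hself : Function.update v x r₀ x = r₀ := by simp
  have hset : {y | r ≤ Function.update v x r₀ y} = {y | r ≤ v y} \ {x} := by
    ext y
    by_cases hy : y = x
    · subst hy; simp; omega
    · simp [hy]
  have hpx := h.px
  have hxs := h.xs
  have hsn := h.sn
  constructor
  · have h0 : ∀ y, y ≤ n + 1 → y / (1 * bsz K) = 0 := fun y hy => by
      rw [one_mul]; exact Nat.div_eq_of_lt (by omega)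
    have hN : Nbrs {y | r ≤ v y} p x s := ⟨hpx, hxs, h.hp, hx, h.hs, fun y hy h1 h2 => by
      by_contra hc
      have h3 := h.hv y h1 h2 hc
      have h4 : r ≤ v y := hy
      omega⟩
    rw [hset, ← h0 x (by omega)]
    refine vebDel_spec hN one_pos (by simpa using hpx.ne) (by simpa using hxs.ne')
      (.inl (by rw [h0 p (by omega), h0 x (by omega)])) ?_
    rw [h0 x (by omega)]
    refine hG.veb.congr one_pos (fun y _ => Iff.rfl) fun t ht A' k' _ c _ _ _ => ?_
    rw [Function.update_of_ne, Function.update_of_ne, Function.update_of_ne] <;>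
      · intro he
        have := congrArg Prod.fst he
        simp only at this
        omega
  · have hcell : ∀ t y, 3 ≤ t → delCells r p x s K new M (t, r, 0, 0, y) =
        Function.update (Function.update (Function.update M
          (3, r, 0, 0, p) (s - p - 1)) (4, r, 0, 0, s) (s - p - 1)) (5, r, 0, 0, s) new
          (t, r, 0, 0, y) := fun t y ht => by
      rw [delCells, vebDel_apply_of_ne one_pos]
      intro t' ht' A' k' _ _ _ he
      have := congrArg Prod.fst he
      simp only at this
      omega
    intro a b hab hbn ha hb hy
    have hax : a ≠ x := by rintro rfl; rw [hself] at ha; omega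
    have hbx : b ≠ x := by rintro rfl; rw [hself] at hb; omega
    rw [hne a hax] at ha
    rw [hne b hbx] at hb
    have hy' : ∀ y, a < y → y < b → y ≠ x → v y < r := fun y h1 h2 h3 => by
      have := hy y h1 h2; rwa [hne y h3] at this
    rw [hcell _ _ le_rfl, hcell _ _ (by norm_num), hcell _ _ (by norm_num)]
    by_cases hin : a < x ∧ x < b
    · have hap : a = p := by
        rcases Nat.lt_trichotomy a p with h1 | h1 | h1
        · have := hy' p h1 (by omega) (by omega); have := h.hp; omega
        · exact h1
        · have := h.hv a h1 (by omega) hax; omega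
      have hbs : b = s := by
        rcases Nat.lt_trichotomy b s with h1 | h1 | h1
        · have := h.hv b (by omega) h1 hbx; omega
        · exact h1
        · have := hy' s (by omega) h1 (by omega); have := h.hs; omega
      subst hap hbs
      simp [hnew]
    · have hxab : ∀ y, a < y → y < b → y ≠ x := fun y h1 h2 h3 => hin ⟨h3 ▸ h1, h3 ▸ h2⟩
      have hap : a ≠ p := by
        rintro rfl
        by_cases hbs : s < b
        · have := hy' s (by omega) hbs (by omega); have := h.hs; omega
        · rcases Nat.lt_or_ge b s with h1 | h1
          · have := h.hv b (by omega) h1 hbx; omega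
          · exact hin ⟨hpx, by omega⟩
      have hbs : b ≠ s := by
        rintro rfl
        rcases Nat.lt_trichotomy a p with h1 | h1 | h1
        · have := hy' p h1 (by omega) (by omega); have := h.hp; omega
        · exact hap h1
        · have := h.hv a h1 (by omega) hax; omega
      have := hG.link a b hab hbn ha hb fun y h1 h2 => hy' y h1 h2 (hxab y h1 h2)
      simp only [Function.update_apply, Prod.mk.injEq, hap, hbs, and_false,
        Nat.reduceEqDiff, false_and, if_false]
      rw [this.1, this.2.1, this.2.2]
      refine ⟨rfl, rfl, run_congr fun y h1 h2 => (hne y (hxab y (by omega) h2)).symm⟩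

theorem Between.good_update (h : Between v n r p x s) (hG : GoodLevel f n K v M r)
    (hx : v x < r) (hr₀ : r₀ < r) {new : ℕ}
    (hnew : new = run f r (Function.update v x r₀) (p + 1) s) :
    GoodLevel f n K (Function.update v x r₀) (Function.update M (5, r, 0, 0, s) new) r := by
  have hne : ∀ y, y ≠ x → Function.update v x r₀ y = v y := fun y hy => by simp [hy]
  have hself : Function.update v x r₀ x = r₀ := by simp
  have hiff : ∀ y, r ≤ Function.update v x r₀ y ↔ r ≤ v y := fun y => by
    by_cases hy : y = x
    · subst hy; rw [hself]; omega
    · rw [hne y hy]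
  have hset : {y | r ≤ Function.update v x r₀ y} = {y | r ≤ v y} := Set.ext hiff
  have hpx := h.px
  have hxs := h.xs
  have hsn := h.sn
  constructor
  · rw [hset]
    refine hG.veb.congr one_pos (fun y _ => Iff.rfl) fun t ht A' k' _ c _ _ _ => ?_
    rw [Function.update_of_ne]
    intro he
    have := congrArg Prod.fst he
    simp only at this
    omega
  · intro a b hab hbn ha hb hy
    rw [hiff] at ha hb
    have hy' : ∀ y, a < y → y < b → v y < r := fun y h1 h2 => by
      have := hy y h1 h2; have := hiff y; omega
    have := hG.link a b hab hbn ha hb hy'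
    by_cases hbs : b = s
    · subst hbs
      have hap : a = p := by
        rcases Nat.lt_trichotomy a p with h1 | h1 | h1
        · have := hy' p h1 (by omega); have := h.hp; omega
        · exact h1
        · by_cases hax : a = x
          · subst hax; omega
          · have := h.hv a h1 hab hax; omega
      subst hap
      simp [hnew, this.1, this.2.1]
    · have hxab : ∀ y, a < y → y < b → y ≠ x := by
        rintro y h1 h2 rfl
        rcases Nat.lt_trichotomy b s with h3 | h3 | h3
        · have := h.hv b (by omega) h3 (by omega); omega
        · exact hbs h3
        · have := hy' s (by omega) h3; have := h.hs; omega
      simp [hbs, this.1, this.2.1, this.2.2]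
      exact run_congr fun y h1 h2 => (hne y (hxab y (by omega) h2)).symm

theorem Between.findOK (h : Between v n r p x s) (hG : GoodLevel f n K v M r) (hx : v x < r)
    (hn : n + 1 < bsz K) : FindOK M r x {y | r ≤ v y} K 1 := by
  have h0 : ∀ y, y ≤ n + 1 → y / (1 * bsz K) = 0 := fun y hy => by
    rw [one_mul]; exact Nat.div_eq_of_lt (by omega)
  have hpx := h.px
  have hxs := h.xs
  have hsn := h.sn
  refine ⟨?_, ⟨p, h.hp, ?_⟩, ?_⟩
  · rintro ⟨y, hy, he⟩
    simp only [Nat.div_one, Set.mem_ofPred_eq] at he hy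
    subst he; omega
  · rw [h0 p (by omega), h0 x (by omega)]
  · rw [h0 x (by omega)]; exact hG.veb

/-- The search returns a neighbour of `x`. -/
theorem Between.find_eq (h : Between v n r p x s) (hG : GoodLevel f n K v M r) (hx : v x < r)
    (hn : n + 1 < bsz K) :
    (vebFind r x M K 1).2 = if (vebFind r x M K 1).1 then s else p := by
  obtain ⟨-, ⟨y, hy, he⟩, h3⟩ := vebFind_spec (h.findOK hG hx hn)
  have hpre : ∀ y, r ≤ v y → Pre {y | r ≤ v y} 1 y := fun y hy => ⟨y, hy, by simp⟩
  simp only [Nat.div_one] at he h3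
  rw [← he] at h3 ⊢
  have hy : r ≤ v y := hy
  split_ifs at h3 ⊢
  · have h4 := h3.2 s (hpre s h.hs) h.xs
    by_contra hc
    have := h.hv y (h.px.trans h3.1) (by omega) h3.1.ne'
    omega
  · have h4 := h3.2 p (hpre p h.hp) h.px
    by_contra hc
    have := h.hv y (by omega) (h3.1.trans h.xs) h3.1.ne
    omega

end Level

/-! ### The program that lowers an item -/

/-- At a level at which `x` is a separator: remove it, and join the two runs. -/
def mergeP : Cmd :=
  block [ld 24 (lit 4) (var 11) (lit 0) (lit 0) (var 10), .nset 15 (var 10 - lit 1 - var 24),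
    ld 24 (lit 3) (var 11) (lit 0) (lit 0) (var 10), .nset 16 (var 10 + lit 1 + var 24),
    ld 17 (lit 5) (var 11) (lit 0) (lit 0) (var 10),
    ld 18 (lit 5) (var 11) (lit 0) (lit 0) (var 16),
    .nset 19 (var 17 + var 18 - var 13 + var 14),
    wr (lit 3) (var 11) (lit 0) (lit 0) (var 15) (var 16 - var 15 - lit 1),
    wr (lit 4) (var 11) (lit 0) (lit 0) (var 16) (var 16 - var 15 - lit 1),
    wr (lit 5) (var 11) (lit 0) (lit 0) (var 16) (var 19), vebDelP]

/-- Update the count of the run that ends before the position in register `16`. -/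
def recountP : Cmd :=
  block [ld 18 (lit 5) (var 11) (lit 0) (lit 0) (var 16), .nset 17 (lit 0),
    .nset 19 (var 18 - var 13 + var 14),
    wr (lit 5) (var 11) (lit 0) (lit 0) (var 16) (var 19)]

/-- At a level at which `x` lies inside a run: find the end of the run, and update the count. -/
def adjustP : Cmd :=
  block [vebFindP,
    .ite (.neq (var 25) (lit 1)) (.nset 16 (var 24))
      (block [ld 17 (lit 3) (var 11) (lit 0) (lit 0) (var 24),
        .nset 16 (var 24 + lit 1 + var 17)]),
    recountP]

/-- Compute the old and the new contribution to the next level. The counts in registers `17`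
and `18` are those before the change. -/
def carryP : Cmd :=
  block [.nset 20 (arr 9 (var 11)),
    .nset 13 ((var 17 + var 20 - lit 1) / var 20 + (var 18 + var 20 - lit 1) / var 20),
    .ite (.neq (var 11) (var 12)) (.nset 13 (var 13 + lit 1)) .skip,
    .nset 14 ((var 19 + var 20 - lit 1) / var 20), .nset 11 (var 11 + lit 1)]

/-- Lower the item at the position in register `10` from the threshold number in register `12` to
the number before that in register `11`. -/
def lowerP : Cmd :=
  block [.nset 13 (lit 0), .nset 14 (lit 1),
    .loop (.nle (var 11) (var 5))
      (block [.ite (.nle (var 11) (var 12)) mergeP adjustP, carryP])]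

/-- The memory in which `lowerP` runs: `n` items, `m + 1` thresholds with numbers `0, …, m`, whose
distances from the first one are given by `f`, and table `9` with the ratios of the units of
consecutive levels (any number that acts like the ratio on counts at most `n` will do). -/
structure LowerEnv (B K n m : ℕ) (f : ℕ → ℕ) (σ₀ : RamState) : Prop extends Env B K σ₀ where
  hn : n + 1 < bsz K
  hm : m < 2 * bsz K
  nv5 : σ₀.nv 5 = m
  mono : Monotone f
  pos : ∀ r, 1 ≤ r → r ≤ m → 1 ≤ σ₀.na 9 r
  le : ∀ r, 1 ≤ r → r ≤ m → σ₀.na 9 r ≤ 2 * bsz K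
  step : ∀ r, 1 ≤ r → r ≤ m → ∀ N ≤ n, cd N (σ₀.na 9 r) = cd N (2 ^ (f r - f (r - 1)))

section Lower
variable {B K q n m r x p s o w r₀ : ℕ} {f v : ℕ → ℕ} {σ₀ σ : RamState} {M : Mem}
  {Q : ℕ → RamState → Prop}

theorem Between.run_le_n (h : Between v n r p x s) (hf : Monotone f) {a b : ℕ} (ha : p < a)
    (hb : b ≤ s) (hab : a ≤ x → b ≤ x ∨ v x < r) : run f r v a b ≤ n := by
  have h1 := h.px
  have h2 := h.xs
  have h3 := h.sn
  refine (run_le hf fun y h4 h5 => ?_).trans (by omega)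
  by_cases hy : y = x
  · subst hy; have := hab h4; omega
  · exact h.hv y (by omega) (by omega) hy

theorem Between.run_new_le (h : Between v n r p x s) (hf : Monotone f) (hr : r₀ < r) :
    run f r (Function.update v x r₀) (p + 1) s ≤ n := by
  have h1 := h.px
  have h2 := h.xs
  have h3 := h.sn
  refine (run_le hf fun y h4 h5 => ?_).trans (by omega)
  by_cases hy : y = x
  · subst hy; simpa using hr
  · rw [Function.update_of_ne hy]; exact h.hv y (by omega) (by omega) hy

theorem run_mergeP (hE : LowerEnv B K n m f σ₀) (hS : Sim B K σ₀ q M σ)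
    (hG : GoodLevel f n K v M r) (h : Between v n r p x s) (hx : r ≤ v x) (hr₀ : r₀ < r)
    (hrm : r ≤ m) (hC : Carry f r v (Function.update v x r₀) x o w)
    (h10 : σ.nv 10 = x) (h11 : σ.nv 11 = r) (h13 : σ.nv 13 = o) (h14 : σ.nv 14 = w)
    (hq : σ₀.nv 6 + q + (K + 3) ≤ B)
    (hQ : ∀ t σ' new, t ≤ 105 * K + 300 → new = run f r (Function.update v x r₀) (p + 1) s →
      Sim B K σ₀ (q + (K + 3)) (delCells r p x s K new M) σ' →
      (∀ v < 15, v ≠ 6 → σ'.nv v = σ.nv v) → σ'.nv 17 = run f r v (p + 1) x →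
      σ'.nv 18 = run f r v (x + 1) s → σ'.nv 19 = new → Q t σ') :
    Run B mergeP σ Q := by
  have hE' := hE.toEnv
  obtain ⟨l4, l5⟩ := h.link_left hG hx
  obtain ⟨l3, l5'⟩ := h.link_right hG hx
  have hpx := h.px
  have hxs := h.xs
  have hsn := h.sn
  have hn := hE.hn
  have hm := hE.hm
  have hBW := hE'.mul_le
  have h4 := hE'.four_le
  obtain ⟨ho, hnew⟩ := (hC.run_eq hpx hxs h.hv h.hp h.hs).1 hx
  have b1 : run f r v (p + 1) x ≤ n := h.run_le_n hE.mono (by omega) (by omega) (by omega)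
  have b2 : run f r v (x + 1) s ≤ n := h.run_le_n hE.mono (by omega) (by omega) (by omega)
  have b3 := h.run_new_le hE.mono hr₀
  have hin : ∀ t y, t ≤ 5 → y ≤ n + 1 → InR (2 * bsz K) (t, r, 0, 0, y) := fun t y ht hy => by
    refine ⟨?_, ?_, ?_, ?_, ?_⟩ <;> dsimp only <;> omega
  generalize hnn : run f r (Function.update v x r₀) (p + 1) s = new at *
  simp only [mergeP, run_block_cons]
  refine run_ld hE' hS (by simp) (by simp [h10, h11]) (hin 4 x (by omega) (by omega)) fun _ => ?_
  rw [l4]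
  simp [h10]
  refine ⟨by omega, ?_⟩
  have hp' : x - 1 - (x - p - 1) = p := by omega
  have hs' : x + 1 + (s - x - 1) = s := by omega
  rw [hp']
  refine run_ld hE' ((hS.setNV (by norm_num)).setNV (by norm_num)) (by simp)
    (by simp [h10, h11]) (hin 3 x (by omega) (by omega)) fun _ => ?_
  rw [l3]
  simp [h10, hs']
  refine ⟨by omega, ?_⟩
  refine run_ld hE' ((((hS.setNV (by norm_num)).setNV (by norm_num)).setNV (by norm_num)).setNV
    (by norm_num)) (by simp)
    (by simp [h10, h11]) (hin 5 x (by omega) (by omega)) fun _ => ?_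
  rw [l5]
  refine run_ld hE' (((((hS.setNV (by norm_num)).setNV (by norm_num)).setNV (by norm_num)).setNV
    (by norm_num)).setNV (by norm_num)) (by simp)
    (by simp [h11]) (hin 5 s (by omega) (by omega)) fun _ => ?_
  rw [l5']
  simp [h13, h14, ← hnew]
  refine ⟨by omega, ?_⟩
  refine run_wr hE' ((((((((hS.setNV (by norm_num)).setNV (by norm_num)).setNV (by norm_num)).setNV
    (by norm_num)).setNV (by norm_num))).setNV (by norm_num)).setNV (by norm_num)) (by simp)
    (c := (3, r, 0, 0, p)) (by simp [h11]) (hin 3 p (by omega) (by omega)) (x := s - p - 1)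
    (fun a => ?_) (by omega) (by omega) ?_
  · simp; omega
  intro σ₁ hS₁ f₁ _
  refine run_wr hE' hS₁ (by simp)
    (c := (4, r, 0, 0, s)) (by simp [f₁, h11]) (hin 4 s (by omega) (by omega)) (x := s - p - 1)
    (fun a => ?_) (by omega) (by omega) ?_
  · simp [f₁]; omega
  intro σ₂ hS₂ f₂ _
  refine run_wr hE' hS₂ (by simp)
    (c := (5, r, 0, 0, s)) (by simp [f₁, f₂, h11]) (hin 5 s (by omega) (by omega)) (x := new)
    (fun a => ?_) (by omega) (by omega) ?_
  · simp [f₁, f₂]; omega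
  intro σ₃ hS₃ f₃ _
  refine run_vebDelP hE' hS₃ (r := r) (x := x) (p := p) (s := s) (by simp [f₁, f₂, f₃, h11])
    (by simp [f₁, f₂, f₃, h10]) (by simp [f₁, f₂, f₃]) (by simp [f₁, f₂, f₃]) (by omega) (by omega)
    (by omega) (by omega) (by omega) ?_
  intro t σ₄ ht hS₄ f₄
  refine hQ _ _ new ?_ rfl (hS₄.mono (by omega)) (fun u hu h6 => ?_) ?_ ?_ ?_
  · simp; omega
  · rw [f₄ u (by omega) h6, f₃ u h6 (by omega) (by omega), f₂ u h6 (by omega) (by omega),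
      f₁ u h6 (by omega) (by omega)]
    simp [show u ≠ 24 by omega, show u ≠ 15 by omega, show u ≠ 16 by omega, show u ≠ 17 by omega,
      show u ≠ 18 by omega, show u ≠ 19 by omega]
  · rw [f₄ _ (by norm_num) (by norm_num)]; simp [f₁, f₂, f₃]
  · rw [f₄ _ (by norm_num) (by norm_num)]; simp [f₁, f₂, f₃]
  · rw [f₄ _ (by norm_num) (by norm_num)]; simp [f₁, f₂, f₃]

theorem run_adjustP (hE : LowerEnv B K n m f σ₀) (hS : Sim B K σ₀ q M σ)
    (hG : GoodLevel f n K v M r) (h : Between v n r p x s) (hx : v x < r) (hr₀ : r₀ < r)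
    (hrm : r ≤ m) (hC : Carry f r v (Function.update v x r₀) x o w)
    (h10 : σ.nv 10 = x) (h11 : σ.nv 11 = r) (h13 : σ.nv 13 = o) (h14 : σ.nv 14 = w)
    (hq : σ₀.nv 6 + q + (K + 3) ≤ B)
    (hQ : ∀ t σ' new, t ≤ 150 * K + 200 → new = run f r (Function.update v x r₀) (p + 1) s →
      Sim B K σ₀ (q + (K + 3)) (Function.update M (5, r, 0, 0, s) new) σ' →
      (∀ v < 15, v ≠ 6 → σ'.nv v = σ.nv v) → σ'.nv 17 = 0 →
      σ'.nv 18 = run f r v (p + 1) s → σ'.nv 19 = new → Q t σ') :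
    Run B adjustP σ Q := by
  have hE' := hE.toEnv
  obtain ⟨l3, l5⟩ := h.link_both hG hx
  have hpx := h.px
  have hxs := h.xs
  have hsn := h.sn
  have hn := hE.hn
  have hm := hE.hm
  have hBW := hE'.mul_le
  have h4 := hE'.four_le
  obtain ⟨ho, hnew⟩ := (hC.run_eq hpx hxs h.hv h.hp h.hs).2 hx
  have b1 : run f r v (p + 1) s ≤ n := h.run_le_n hE.mono (by omega) (by omega) (by omega)
  have b3 := h.run_new_le hE.mono hr₀
  have hin : ∀ t y, t ≤ 5 → y ≤ n + 1 → InR (2 * bsz K) (t, r, 0, 0, y) := fun t y ht hy => by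
    refine ⟨?_, ?_, ?_, ?_, ?_⟩ <;> dsimp only <;> omega
  generalize hnn : run f r (Function.update v x r₀) (p + 1) s = new at *
  have hfind := h.find_eq hG hx hn
  simp only [adjustP, run_block_cons]
  refine run_vebFindP hE' hS h11 h10 (by omega) (by omega) (h.findOK hG hx hn) ?_
  intro t σ₁ ht hS₁ f₁ hy hb
  -- Both branches end with the right end of the run in register `16`.
  have key : ∀ (t' : ℕ) (σ₂ : RamState), t' ≤ 35 → Sim B K σ₀ q M σ₂ →
      (∀ u < 15, σ₂.nv u = σ.nv u) → σ₂.nv 16 = s →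
      Run B recountP σ₂ fun t'' σ'' => Q (t + (t' + (t'' + 1))) σ'' := by
    intro t' σ₂ ht' hS₂ f₂ h16
    simp only [recountP, run_block_cons]
    refine run_ld hE' hS₂ (by simp) (by simp [f₂, h11, h16]) (hin 5 s (by omega) (by omega))
      fun _ => ?_
    rw [l5]
    simp [f₂, h13, h14, ← hnew]
    refine ⟨by omega, ?_⟩
    refine run_wr hE' (((hS₂.setNV (by norm_num)).setNV (by norm_num)).setNV (by norm_num))
      (by simp) (c := (5, r, 0, 0, s)) (by simp [f₂, h11, h16]) (hin 5 s (by omega) (by omega))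
      (x := new) (fun a => ?_) (by omega) (by omega) ?_
    · simp; omega
    intro σ₃ hS₃ f₃ _
    refine hQ _ _ new ?_ rfl (hS₃.mono (by omega)) (fun u hu h6 => ?_) ?_ ?_ ?_
    · simp; omega
    · rw [f₃ u h6 (by omega) (by omega)]
      simp [show u ≠ 17 by omega, show u ≠ 18 by omega, show u ≠ 19 by omega, f₂ u hu]
    · simp [f₃]
    · simp [f₃]
    · simp [f₃]
  by_cases hd : (vebFind r x M K 1).1
  · rw [hd, if_pos rfl] at hfind
    simp only [hd, if_true] at hb
    rw [hfind] at hy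
    simp [hb, hy]
    refine ⟨by omega, by omega, ?_⟩
    refine (key 6 (σ₁.setNV 16 s) (by norm_num) (hS₁.setNV (by norm_num)) (fun u hu => ?_)
      (by simp)).mono fun _ _ h => h
    simp [show u ≠ 16 by omega, f₁ u (by omega)]
  · rw [if_neg hd] at hfind
    simp only [hd] at hb
    rw [hfind] at hy
    simp at hb
    simp [hb, hy]
    refine ⟨by omega, ?_⟩
    refine run_ld hE' hS₁ (by simp) (by simp [f₁, h11, hy]) (hin 3 p (by omega) (by omega))
      fun _ => ?_
    rw [l3]
    simp [hy, show p + 1 + (s - p - 1) = s by omega]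
    refine ⟨by omega, ?_⟩
    refine (key _ ((σ₁.setNV 17 (s - p - 1)).setNV 16 s) (by norm_num)
      ((hS₁.setNV (by norm_num)).setNV (by norm_num)) (fun u hu => ?_)
      (by simp)).mono fun _ _ h => h
    simp [show u ≠ 16 by omega, show u ≠ 17 by omega, f₁ u (by omega)]

theorem cd_le_add (N P : ℕ) (hP : 0 < P) : cd N P ≤ N := by
  rw [cd_le_iff hP]; exact Nat.le_mul_of_pos_right _ hP

theorem run_carryP (hE : LowerEnv B K n m f σ₀) (hS : Sim B K σ₀ q M σ)
    (hr : 1 ≤ r) (hrm : r ≤ m) {NA NB N r₁ : ℕ} (hNA : NA ≤ n) (hNB : NB ≤ n) (hN : N ≤ n)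
    (h11 : σ.nv 11 = r) (h12 : σ.nv 12 = r₁) (hr₁ : r₁ ≤ m) (h17 : σ.nv 17 = NA)
    (h18 : σ.nv 18 = NB)
    (h19 : σ.nv 19 = N) (hQ : ∀ t σ', t ≤ 50 → Sim B K σ₀ q M σ' →
      (∀ u < 13, u ≠ 6 → u ≠ 11 → σ'.nv u = σ.nv u) → σ'.nv 11 = r + 1 →
      σ'.nv 13 = cd NA (2 ^ (f r - f (r - 1))) + cd NB (2 ^ (f r - f (r - 1))) +
        (if r = r₁ then 1 else 0) →
      σ'.nv 14 = cd N (2 ^ (f r - f (r - 1))) → Q t σ') :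
    Run B carryP σ Q := by
  have hBW := hE.mul_le
  have h4 := hE.four_le
  have hn := hE.hn
  have hm := hE.hm
  have hP1 := hE.pos r hr hrm
  have hPle := hE.le r hr hrm
  have hst := hE.step r hr hrm
  have h9 : σ.na 9 r = σ₀.na 9 r := by
    rw [hS.na 9 (by norm_num) (by norm_num) (by norm_num) (by norm_num)]
  rw [← hst NA hNA, ← hst NB hNB, ← hst N hN] at hQ
  generalize σ₀.na 9 r = P at *
  have c1 := cd_le_add NA P hP1
  have c2 := cd_le_add NB P hP1
  have c3 := cd_le_add N P hP1
  unfold cd at *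
  have hS' := hS
  simp [carryP, h11, h12, h17, h18, h19, h9]
  and_intros <;> try omega
  · intro he
    and_intros <;> try omega
    refine hQ _ _ (by norm_num) (((((hS.setNV (by norm_num)).setNV (by norm_num)).setNV
      (by norm_num)).setNV (by norm_num)).setNV (by norm_num)) (fun u hu h6 h11 => ?_) (by simp)
      (by simp [he]) (by simp)
    simp [h11, show u ≠ 13 by omega, show u ≠ 14 by omega, show u ≠ 20 by omega]
  · intro he
    and_intros <;> try omega
    refine hQ _ _ (by norm_num) ((((hS.setNV (by norm_num)).setNV (by norm_num)).setNV
      (by norm_num)).setNV (by norm_num)) (fun u hu h6 h11 => ?_) (by simp)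
      (by simp [he]) (by simp)
    simp [h11, show u ≠ 13 by omega, show u ≠ 14 by omega, show u ≠ 20 by omega]

/-- The cells of all levels are right. -/
def Good (f : ℕ → ℕ) (n K m : ℕ) (v : ℕ → ℕ) (M : Mem) : Prop :=
  ∀ r, 1 ≤ r → r ≤ m → GoodLevel f n K v M r

theorem run_lowerP (hE : LowerEnv B K n m f σ₀) (hS : Sim B K σ₀ q M σ)
    (hG : Good f n K m v M) (hv0 : m ≤ v 0) (hvn : m ≤ v (n + 1)) (hx1 : 1 ≤ x) (hxn : x ≤ n)
    (hxm : v x ≤ m) (hr₀ : r₀ < v x)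
    (h10 : σ.nv 10 = x) (h11 : σ.nv 11 = r₀ + 1) (h12 : σ.nv 12 = v x)
    (hq : σ₀.nv 6 + q + m * (K + 3) ≤ B)
    (hQ : ∀ t σ' M', t ≤ m * (150 * K + 400) + 20 → Sim B K σ₀ (q + m * (K + 3)) M' σ' →
      Good f n K m (Function.update v x r₀) M' → (∀ u < 10, u ≠ 6 → σ'.nv u = σ.nv u) →
      Q t σ') :
    Run B lowerP σ Q := by
  have hE' := hE.toEnv
  have hBW := hE'.mul_le
  have h4 := hE'.four_le
  have hn := hE.hn
  have hm := hE.hm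
  have h5 : σ.nv 5 = m := (hS.nv 5 (by norm_num) (by norm_num)).trans hE.nv5
  simp [lowerP]
  refine ⟨by omega, ?_⟩
  refine (run_loop (c := 150 * K + 390) (fun j σ' => ∃ M' o w, Sim B K σ₀ (q + j * (K + 3)) M' σ' ∧
    (∀ u < 13, u ≠ 6 → u ≠ 11 → σ'.nv u = σ.nv u) ∧ σ'.nv 11 = r₀ + 1 + j ∧ σ'.nv 13 = o ∧
    σ'.nv 14 = w ∧ (∀ r, 1 ≤ r → r ≤ m → r < r₀ + 1 + j →
      GoodLevel f n K (Function.update v x r₀) M' r) ∧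
    (∀ r, r ≤ m → r₀ + 1 + j ≤ r → GoodLevel f n K v M' r) ∧
    Carry f (r₀ + 1 + j) v (Function.update v x r₀) x o w) (m - r₀)
    ?_ ?_ ?_).mono ?_
  · rintro j hj σ₁ ⟨M', o, w, i1, i2, i3, i4, i5, i6, i7, i8⟩
    obtain ⟨r, hr⟩ : ∃ r, r = r₀ + 1 + j := ⟨_, rfl⟩
    rw [← hr] at i3 i6 i7 i8
    have hrm : r ≤ m := by omega
    obtain ⟨p, s, hb⟩ := Between.exists (n := n) (hrm.trans hv0) (hrm.trans hvn) hx1 hxn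
    have hGr := i7 r hrm le_rfl
    have h10' : σ₁.nv 10 = x := (i2 10 (by norm_num) (by norm_num) (by norm_num)).trans h10
    have h12' : σ₁.nv 12 = v x := (i2 12 (by norm_num) (by norm_num) (by norm_num)).trans h12
    have h5' : σ₁.nv 5 = m := (i2 5 (by norm_num) (by norm_num) (by norm_num)).trans h5
    have hq' : σ₀.nv 6 + (q + j * (K + 3)) + (K + 3) ≤ B := by
      have : (j + 1) * (K + 3) ≤ m * (K + 3) := Nat.mul_le_mul_right _ (by omega)
      rw [Nat.succ_mul] at this
      omega
    have hqe : q + j * (K + 3) + (K + 3) = q + (j + 1) * (K + 3) := by rw [Nat.succ_mul]; omega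
    refine ⟨by simp [i3, h5']; omega, by simp [i3, h5']; omega, ?_⟩
    have hcarry := Carry.succ (v := v) (v' := Function.update v x r₀) hE.mono (fun y hy => by simp [hy]) (by simp; omega) hb.px hb.xs hb.hv
      hb.hp hb.hs
    simp only [run_block_cons, run_block_nil, run_ite, BExp.Fits, BExp.Holds, fits_var, eval_var, i3, h12',
      BExp.time, NExp.time]
    refine ⟨by omega, fun hrx => ?_, fun hrx => ?_⟩
    · refine run_mergeP hE i1 hGr hb hrx (by omega) hrm i8 h10' i3 i4 i5 hq' ?_
      intro t σ₂ new ht hnew hS₂ f₂ h17 h18 h19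
      refine run_carryP hE hS₂ (by omega) hrm
        (hb.run_le_n hE.mono (by omega) (by have := hb.xs; omega) (by omega))
        (hb.run_le_n hE.mono (by have := hb.px; omega) (by omega) (by omega))
        (hb.run_new_le (x := x) (r₀ := r₀) hE.mono (by omega)) (by rw [f₂ 11 (by norm_num) (by norm_num), i3])
        (by rw [f₂ 12 (by norm_num) (by norm_num), h12']) hxm h17 h18 (h19.trans hnew) ?_
      intro t' σ₃ ht' hS₃ f₃ h11 h13 h14
      rw [if_pos hrx] at hcarry
      refine ⟨by omega, _, _, _, hqe ▸ hS₃, fun u hu h6 h11 => ?_, by omega, h13, h14, ?_, ?_, ?_⟩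
      · rw [f₃ u hu h6 h11, f₂ u (by omega) h6, i2 u hu h6 h11]
      · intro r' h1 h2 h3
        by_cases hrr : r' = r
        · subst hrr; exact hb.good_delCells hGr hrx (by omega) hn hnew
        · refine (i6 r' h1 h2 (by omega)).congr (fun c hc => (delCells_of_ne ?_).symm)
            (fun _ => Iff.rfl) fun _ _ => rfl
          rw [hc]; exact hrr
      · intro r' h1 h2
        refine (i7 r' h1 (by omega)).congr (fun c hc => (delCells_of_ne ?_).symm)
            (fun _ => Iff.rfl) fun _ _ => rfl
        rw [hc]; omega
      · rw [show r₀ + 1 + (j + 1) = r + 1 by omega]; exact hcarry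
    · refine run_adjustP hE i1 hGr hb (by omega) (by omega) hrm i8 h10' i3 i4 i5 hq' ?_
      intro t σ₂ new ht hnew hS₂ f₂ h17 h18 h19
      refine run_carryP hE hS₂ (by omega) hrm (Nat.zero_le _)
        (hb.run_le_n hE.mono (by omega) (by omega) (by omega))
        (hb.run_new_le (x := x) (r₀ := r₀) hE.mono (by omega)) (by rw [f₂ 11 (by norm_num) (by norm_num), i3])
        (by rw [f₂ 12 (by norm_num) (by norm_num), h12']) hxm h17 h18 (h19.trans hnew) ?_
      intro t' σ₃ ht' hS₃ f₃ h11 h13 h14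
      rw [if_neg (by omega)] at hcarry
      rw [cd_zero (by positivity), zero_add, if_neg (by omega), add_zero] at h13
      refine ⟨by omega, _, _, _, hqe ▸ hS₃, fun u hu h6 h11 => ?_, by omega, h13, h14, ?_, ?_, ?_⟩
      · rw [f₃ u hu h6 h11, f₂ u (by omega) h6, i2 u hu h6 h11]
      · intro r' h1 h2 h3
        by_cases hrr : r' = r
        · subst hrr; exact hb.good_update hGr (by omega) (by omega) hnew
        · refine (i6 r' h1 h2 (by omega)).congr (fun c hc => ?_)
            (fun _ => Iff.rfl) fun _ _ => rfl
          rw [Function.update_of_ne]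
          rintro rfl; exact hrr hc.symm
      · intro r' h1 h2
        refine (i7 r' h1 (by omega)).congr (fun c hc => ?_)
            (fun _ => Iff.rfl) fun _ _ => rfl
        rw [Function.update_of_ne]
        rintro rfl
        simp only at hc
        omega
      · rw [show r₀ + 1 + (j + 1) = r + 1 by omega]; exact hcarry
  · rintro σ₁ ⟨M', o, w, i1, i2, i3, -⟩
    have h5' : σ₁.nv 5 = m := (i2 5 (by norm_num) (by norm_num) (by norm_num)).trans h5
    simp [i3, h5']; omega
  · refine ⟨M, 0, 1, (by simpa using (hS.setNV (by norm_num)).setNV (by norm_num)),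
      fun u hu h6 h11 => ?_, by simpa using h11, by simp, by simp, ?_, ?_, ?_⟩
    · simp [show u ≠ 13 by omega, show u ≠ 14 by omega]
    · intro r h1 h2 h3
      refine (hG r h1 h2).congr (fun _ _ => rfl) (fun y => ?_) fun y hy => ?_
      · by_cases hy : y = x
        · subst hy; simp; omega
        · simp [hy]
      · rw [Function.update_of_ne]; rintro rfl; omega
    · exact fun r h1 h2 => hG r (by omega) h1
    · exact carry_base hE.mono hr₀
  · rintro t σ' ⟨ht, M', o, w, i1, i2, i3, i4, i5, i6, -⟩
    refine hQ _ _ M' ?_ (i1.mono ?_) (fun r h1 h2 => i6 r h1 h2 (by omega))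
      fun u hu h6 => i2 u (by omega) h6 (by omega)
    · simp at ht
      have : (m - r₀) * (150 * K + 390 + 3 + 1) ≤ m * (150 * K + 394) := by
        exact Nat.mul_le_mul (Nat.sub_le _ _) le_rfl
      have h3 : m * (150 * K + 400) = m * (150 * K + 394) + m * 6 := by ring
      omega
    · have : (m - r₀) * (K + 3) ≤ m * (K + 3) := Nat.mul_le_mul (Nat.sub_le _ _) le_rfl
      omega

end Lower

/-! ### Thresholds -/

/-- The thresholds: the values that a weight can take, before and after its bit is set, and one
more above them all, which is used for the ends of the sequence. -/
def thr (n : ℕ) (u : ℕ → ℤ) (mx : ℤ) : Finset ℤ :=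
  insert (mx + 1) ((Finset.range n).image u ∪ (Finset.range n).image fun i => u i - 1)

/-- The number of a threshold, from `0` on in increasing order. -/
def idx (Θ : Finset ℤ) (t : ℤ) : ℕ := (Θ.filter (· < t)).card

/-- The distance of the threshold with number `r` from `t₀`. -/
def thrDist (Θ : Finset ℤ) (t₀ : ℤ) (r : ℕ) : ℕ :=
  (Θ.filter fun s => idx Θ s ≤ r).sup fun s => (s - t₀).toNat

section Thr
variable {Θ : Finset ℤ} {s t t₀ mx : ℤ} {n : ℕ} {u : ℕ → ℤ}

theorem idx_mono (h : s ≤ t) : idx Θ s ≤ idx Θ t :=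
  Finset.card_le_card fun a ha => by
    rw [Finset.mem_filter] at ha ⊢
    exact ⟨ha.1, ha.2.trans_le h⟩

theorem idx_lt (hs : s ∈ Θ) (h : s < t) : idx Θ s < idx Θ t :=
  Finset.card_lt_card (Finset.ssubset_iff.2 ⟨s, by simp, fun a ha => by
    rw [Finset.mem_insert, Finset.mem_filter] at ha
    rw [Finset.mem_filter]
    rcases ha with rfl | ha
    · exact ⟨hs, h⟩
    · exact ⟨ha.1, ha.2.trans h⟩⟩)

theorem idx_lt_iff (hs : s ∈ Θ) : idx Θ s < idx Θ t ↔ s < t :=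
  ⟨fun h => lt_of_not_ge fun hc => absurd (idx_mono (Θ := Θ) hc) (by omega), idx_lt hs⟩

theorem idx_next (hs : s ∈ Θ) (h : s < t) (hn : ∀ a ∈ Θ, s < a → t ≤ a) :
    idx Θ t = idx Θ s + 1 := by
  rw [idx, idx, ← Finset.card_insert_of_notMem (a := s) (by simp)]
  congr 1
  ext a
  rw [Finset.mem_insert, Finset.mem_filter, Finset.mem_filter]
  constructor
  · rintro ⟨h1, h2⟩
    rcases lt_trichotomy a s with h3 | h3 | h3
    · exact .inr ⟨h1, h3⟩
    · exact .inl h3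
    · exact absurd (hn a h1 h3) (by omega)
  · rintro (rfl | ⟨h1, h2⟩)
    · exact ⟨hs, h⟩
    · exact ⟨h1, h2.trans h⟩

theorem thrDist_mono : Monotone (thrDist Θ t₀) := fun a b h =>
  Finset.sup_mono fun c hc => by
    rw [Finset.mem_filter] at hc ⊢
    exact ⟨hc.1, hc.2.trans h⟩

theorem thrDist_idx (hs : s ∈ Θ) : thrDist Θ t₀ (idx Θ s) = (s - t₀).toNat := by
  refine le_antisymm (Finset.sup_le fun a ha => ?_) ?_
  · rw [Finset.mem_filter] at ha
    have : a ≤ s := le_of_not_gt fun hc => absurd (idx_lt hs hc) (by omega)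
    exact Int.toNat_le_toNat (by omega)
  · exact Finset.le_sup (f := fun s => (s - t₀).toNat) (by simp [hs])

theorem mem_thr : t ∈ thr n u mx ↔ t = mx + 1 ∨ ∃ i < n, t = u i ∨ t = u i - 1 := by
  simp only [thr, Finset.mem_insert, Finset.mem_union, Finset.mem_image, Finset.mem_range]
  constructor
  · rintro (h | ⟨i, h, rfl⟩ | ⟨i, h, rfl⟩)
    exacts [.inl h, .inr ⟨i, h, .inl rfl⟩, .inr ⟨i, h, .inr rfl⟩]
  · rintro (h | ⟨i, h, rfl | rfl⟩)
    exacts [.inl h, .inr (.inl ⟨i, h, rfl⟩), .inr (.inr ⟨i, h, rfl⟩)]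

theorem mem_thr_self {i : ℕ} (hi : i < n) : u i ∈ thr n u mx := mem_thr.2 (.inr ⟨i, hi, .inl rfl⟩)

theorem mem_thr_sub {i : ℕ} (hi : i < n) : u i - 1 ∈ thr n u mx :=
  mem_thr.2 (.inr ⟨i, hi, .inr rfl⟩)

theorem mem_thr_top : mx + 1 ∈ thr n u mx := mem_thr.2 (.inl rfl)

theorem idx_sub_one {i : ℕ} (hi : i < n) :
    idx (thr n u mx) (u i) = idx (thr n u mx) (u i - 1) + 1 :=
  idx_next (mem_thr_sub hi) (by omega) fun a _ h => by omega

theorem idx_top_le :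
    idx (thr n u mx) (mx + 1) ≤ 2 * ((Finset.range n).image u).card := by
  have h1 : (thr n u mx).filter (· < mx + 1) ⊆
      (Finset.range n).image u ∪ ((Finset.range n).image u).image (· - 1) := fun a ha => by
    rw [Finset.mem_filter, mem_thr] at ha
    simp only [Finset.mem_union, Finset.mem_image, Finset.mem_range, exists_exists_and_eq_and]
    rcases ha.1 with h | ⟨i, hi, h | h⟩
    · exact absurd ha.2 (by omega)
    · exact .inl ⟨i, hi, h.symm⟩
    · exact .inr ⟨i, hi, h.symm⟩
  have h2 : (((Finset.range n).image u).image (· - 1)).card ≤ ((Finset.range n).image u).card :=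
    Finset.card_image_le
  have h3 := (Finset.card_le_card h1).trans (Finset.card_union_le _ _)
  rw [idx]
  omega

/-- On numbers at most `n`, division by a power of two that is at least `n` does not depend on
the power. -/
theorem cd_pow_cap {N j g : ℕ} (hN : N ≤ n) (hj : j ≤ g) (h : n ≤ 2 ^ j ∨ j = g) :
    cd N (2 ^ j) = cd N (2 ^ g) := by
  rcases h with h | rfl
  swap
  · rfl
  have hp : 2 ^ j ≤ 2 ^ g := Nat.pow_le_pow_right (by norm_num) hj
  have key : ∀ P, n ≤ P → 0 < P → cd N P = if N = 0 then 0 else 1 := fun P h1 h2 => by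
    split_ifs with h0
    · rw [h0, cd_zero h2]
    · refine le_antisymm ((cd_le_iff h2).2 (by omega)) ?_
      by_contra hc
      have := (cd_le_iff (a := N) (c := 0) h2).1 (by omega)
      omega
  rw [key _ h (by positivity), key _ (h.trans hp) (by positivity)]

end Thr

/-! ### Finding the thresholds -/

/-- Only the registers and arrays that serve to find the thresholds differ. -/
def ThrFrame (σ σ' : RamState) : Prop :=
  (∀ v < 8, v ≠ 5 → σ'.nv v = σ.nv v) ∧ (∀ a, a ≠ 8 → a ≠ 9 → σ'.na a = σ.na a) ∧
    (∀ v < 3, σ'.rv v = σ.rv v) ∧ σ'.ra = σ.ra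

theorem ThrFrame.trans {σ σ' σ'' : RamState} (h : ThrFrame σ σ') (h' : ThrFrame σ' σ'') :
    ThrFrame σ σ'' :=
  ⟨fun v hv h5 => (h'.1 v hv h5).trans (h.1 v hv h5),
    fun a h8 h9 => (h'.2.1 a h8 h9).trans (h.2.1 a h8 h9),
    fun v hv => (h'.2.2.1 v hv).trans (h.2.2.1 v hv), h'.2.2.2.trans h.2.2.2⟩

/-- Replace the candidate in real register `4` by the number in real register `5`, if it is a better
one for the next threshold after that in real register `3`. -/
def relaxP : Cmd :=
  .ite (.and (.not (.rle (.var 5) (.var 3))) (.rle (.var 5) (.var 4))) (.rset 4 (.var 5)) .skip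

/-- Compare the item with the number in register `8` with the threshold in real register `3`. -/
def scanStep : Cmd :=
  block [.ite (.req (.arr 1 (var 8)) (.var 3)) (.nstore 8 (var 8) (var 9)) .skip,
    .rset 5 (.arr 1 (var 8) - .ofWord (lit 1)), relaxP, .rset 5 (.arr 1 (var 8)), relaxP,
    .nset 8 (var 8 + lit 1)]

/-- Find the next threshold, and number the items whose weight is the present one. -/
def scanP : Cmd :=
  block [.rset 4 (.var 1 + .ofWord (lit 1)), .nset 8 (lit 0),
    .loop (.not (.nle (var 0) (var 8))) scanStep]

/-- Compute the power of two to the difference of the thresholds in real registers `3` and `4`,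
stopping at the first power that is at least `n`. -/
def powP : Cmd :=
  block [.rset 5 (.var 3), .nset 10 (lit 1),
    .loop (.and (.not (.nle (var 0) (var 10))) (.not (.rle (.var 4) (.var 5))))
      (block [.nset 10 (var 10 + var 10), .rset 5 (.var 5 + .ofWord (lit 1))])]

/-- Pass from the threshold in real register `3` to the next one. -/
def thrStep : Cmd :=
  block [scanP, powP, .nset 9 (var 9 + lit 1), .nstore 9 (var 9) (var 10), .rset 3 (.var 4)]

/-- Number the thresholds. -/
def thrP : Cmd :=
  block [.rset 3 (.var 2 - .ofWord (lit 1)), .nset 9 (lit 0), .loop (.rle (.var 3) (.var 1)) thrStep,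
    .nset 5 (var 9)]

section Scan
variable {B n r : ℕ} {u : ℕ → ℤ} {mx mn t nt : ℤ} {σ : RamState} {Q : ℕ → RamState → Prop}

theorem run_relaxP {a : ℤ} (h3 : σ.rv 3 = t) (h4 : σ.rv 4 = nt) (h5 : σ.rv 5 = a)
    (hQ : ∀ τ nt' : _, τ ≤ 15 → nt' ≤ nt → (t < a → nt' ≤ a) → (nt' = nt ∨ t < nt' ∧ nt' = a) →
      Q τ (σ.setRV 4 (nt' : ℤ))) : Run B relaxP σ Q := by
  have h0 : σ.setRV 4 nt = σ := by
    rw [← h4]; simp [RamState.setRV]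
  simp only [relaxP, run_ite, BExp.Fits, RExp.Fits, BExp.Holds, RExp.eval, h3, h4, h5, Int.cast_le,
    run_rset, run_skip, and_self, true_and]
  refine ⟨fun h => hQ _ _ (by simp) h.2 (fun _ => le_rfl) (.inr ⟨by omega, rfl⟩), fun h => ?_⟩
  have := hQ (BExp.time (.and (.not (.rle (.var 5) (.var 3))) (.rle (.var 5) (.var 4))) + 1 + 1) nt
    (by simp) le_rfl (fun ha => by by_contra hc; exact h ⟨by omega, by omega⟩) (.inl rfl)
  rwa [h0] at this

theorem run_scanStep {i : ℕ} (hnB : n + 1 ≤ B) (hi : i < n) (h8 : σ.nv 8 = i) (h9 : σ.nv 9 = r)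
    (hr : r ≤ B)
    (hu : σ.ra 1 i = u i) (h3 : σ.rv 3 = t) (h4 : σ.rv 4 = nt)
    (hQ : ∀ τ σ' nt', τ ≤ 60 → ThrFrame σ σ' → σ'.nv 8 = i + 1 → σ'.nv 9 = r →
      σ'.rv 3 = t → σ'.rv 4 = (nt' : ℤ) → nt' ≤ nt → (t < u i → nt' ≤ u i) →
      (t < u i - 1 → nt' ≤ u i - 1) → (nt' = nt ∨ t < nt' ∧ (nt' = u i ∨ nt' = u i - 1)) →
      σ'.na 8 = Function.update (σ.na 8) i (if u i = t then r else σ.na 8 i) →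
      σ'.na 9 = σ.na 9 → Q τ σ') :
    Run B scanStep σ Q := by
  have c1 : ((u i : ℝ) - 1) = ((u i - 1 : ℤ) : ℝ) := by push_cast; rfl
  rw [scanStep, run_block_cons]
  have h1B : 1 ≤ B := by omega
  have hiB : i + 1 ≤ B := by omega
  suffices H : ∀ τ₁ ≤ 10, Run B (block [.rset 5 (.arr 1 (var 8) - .ofWord (lit 1)), relaxP,
      .rset 5 (.arr 1 (var 8)), relaxP, .nset 8 (var 8 + lit 1)])
      (σ.setNA 8 i (if u i = t then r else σ.na 8 i)) fun τ σ' => Q (τ₁ + τ) σ' by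
    simp only [run_ite, run_nstore, run_skip, BExp.Fits, RExp.Fits, fits_var, BExp.Holds,
      RExp.eval, eval_var, h8, hu, h3, h9, Int.cast_inj]
    refine ⟨⟨by omega, trivial⟩, fun h => ⟨by omega, hr, ?_⟩, fun h => ?_⟩
    · have := H 8 (by norm_num)
      rw [if_pos h] at this
      exact this
    · have := H 6 (by norm_num)
      rw [if_neg h, show σ.setNA 8 i (σ.na 8 i) = σ by simp [RamState.setNA]] at this
      exact this
  intro τ₁ hτ₁
  simp [h8, hu, h1B, c1, -Int.cast_sub]
  refine ⟨by omega, run_relaxP (t := t) (nt := nt) (a := u i - 1) (by simpa using h3)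
    (by simpa using h4) (by simp) fun τ₂ nt₂ hτ₂ a1 a2 a3 => ?_⟩
  simp [h8, hu]
  refine ⟨by omega, run_relaxP (t := t) (nt := nt₂) (a := u i) (by simpa using h3)
    (by simp) (by simp) fun τ₃ nt₃ hτ₃ b1 b2 b3 => ?_⟩
  simp [h8]
  refine ⟨⟨by omega, by omega⟩, hQ _ _ nt₃ ?_ ⟨fun v hv h5 => ?_, fun a h8 h9 => ?_, fun v hv => ?_, ?_⟩
    (by simp) (by simp [h9]) (by simp [h3]) (by simp) ?_ ?_ ?_ ?_ ?_ ?_⟩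
  · omega
  · simp [show v ≠ 8 by omega]
  · simp [h8]
  · simp [show v ≠ 4 by omega, show v ≠ 5 by omega]
  · simp
  · omega
  · omega
  · omega
  · omega
  · simp
  · simp

theorem run_scanP (hnB : n + 1 ≤ B) (h0 : σ.nv 0 = n) (h9 : σ.nv 9 = r)
    (hr : r ≤ B) (hu : ∀ i < n, σ.ra 1 i = u i) (h1 : σ.rv 1 = mx) (h3 : σ.rv 3 = t) (ht : t ≤ mx)
    (hQ : ∀ τ σ' nt, τ ≤ 70 * n + 20 → ThrFrame σ σ' → σ'.nv 9 = r →
      σ'.rv 3 = t → σ'.rv 4 = (nt : ℤ) → t < nt → nt ∈ thr n u mx →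
      (∀ s ∈ thr n u mx, t < s → nt ≤ s) →
      (∀ i < n, σ'.na 8 i = if u i = t then r else σ.na 8 i) → σ'.na 9 = σ.na 9 → Q τ σ') :
    Run B scanP σ Q := by
  have c1 : ((mx : ℝ) + 1) = ((mx + 1 : ℤ) : ℝ) := by push_cast; rfl
  have h1B : 1 ≤ B := by omega
  simp [scanP, h1, h1B, c1, -Int.cast_add]
  refine (run_loop (c := 60) (fun i σ' => ∃ nt : ℤ, ThrFrame σ σ' ∧ σ'.nv 8 = i ∧ σ'.nv 9 = r ∧
    σ'.rv 3 = t ∧ σ'.rv 4 = nt ∧ t < nt ∧ nt ∈ thr n u mx ∧ nt ≤ mx + 1 ∧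
    (∀ k < i, (t < u k → nt ≤ u k) ∧ (t < u k - 1 → nt ≤ u k - 1)) ∧
    (∀ k < i, σ'.na 8 k = if u k = t then r else σ.na 8 k) ∧
    (∀ k, i ≤ k → σ'.na 8 k = σ.na 8 k) ∧ σ'.na 9 = σ.na 9) n ?_ ?_ ?_).mono ?_
  · rintro i hi σ₁ ⟨nt, i1, i2, i3, i4, i5, i6, i7, i8, i9, i10, i11, i12⟩
    have h0' : σ₁.nv 0 = n := (i1.1 0 (by norm_num) (by norm_num)).trans h0
    refine ⟨by simp [h0', i2]; omega, by simp [h0', i2, hi], ?_⟩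
    refine run_scanStep hnB hi i2 i3 hr (by rw [i1.2.2.2, hu i hi]) i4 i5 ?_
    intro τ σ₂ nt' hτ j1 j2 j3 j4 j5 j6 j7 j8 j9 j10 j11
    refine ⟨hτ, nt', i1.trans j1, j2, j3, j4, j5, by omega, ?_, by omega, ?_, ?_, ?_, j11.trans i12⟩
    · rcases j9 with rfl | ⟨-, rfl | rfl⟩
      exacts [i7, mem_thr_self hi, mem_thr_sub hi]
    · intro k hk
      rcases Nat.lt_succ_iff_lt_or_eq.1 hk with hk | rfl
      · have := i9 k hk; omega
      · exact ⟨j7, j8⟩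
    · intro k hk
      rw [j10]
      rcases Nat.lt_succ_iff_lt_or_eq.1 hk with hk | rfl
      · rw [Function.update_of_ne hk.ne, i10 k hk]
      · rw [Function.update_self, i11 k le_rfl]
    · intro k hk
      rw [j10, Function.update_of_ne (by omega), i11 k (by omega)]
  · rintro σ₁ ⟨nt, i1, i2, -⟩
    have h0' : σ₁.nv 0 = n := (i1.1 0 (by norm_num) (by norm_num)).trans h0
    simp [h0', i2]; omega
  · refine ⟨mx + 1, ⟨fun v hv _ => ?_, fun a _ _ => by simp, fun v hv => ?_, by simp⟩, by simp,
      by simp [h9], by simp [h3], by simp, by omega, mem_thr_top, le_rfl, by simp, by simp, by simp,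
      by simp⟩
    · simp [show v ≠ 8 by omega]
    · simp [show v ≠ 4 by omega]
  · rintro τ σ₁ ⟨hτ, nt, i1, i2, i3, i4, i5, i6, i7, i8, i9, i10, i11, i12⟩
    refine hQ _ _ nt ?_ i1 i3 i4 i5 i6 i7 (fun s hs hts => ?_) i10 i12
    · simp at hτ; omega
    · rcases mem_thr.1 hs with rfl | ⟨i, hi, rfl | rfl⟩
      exacts [i8, (i9 i hi).1 hts, (i9 i hi).2 hts]

theorem run_powP (hnB : 2 * n + 1 ≤ B) (hn : 1 ≤ n) (h0 : σ.nv 0 = n) (h9 : σ.nv 9 = r)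
    (h3 : σ.rv 3 = t) (h4 : σ.rv 4 = nt) (htn : t < nt)
    (hQ : ∀ τ σ' P, τ ≤ 30 * n + 20 → ThrFrame σ σ' → σ'.nv 9 = r → σ'.nv 10 = P →
      σ'.rv 4 = nt → 1 ≤ P → P ≤ 2 * n → (∀ N ≤ n, cd N P = cd N (2 ^ (nt - t).toNat)) →
      σ'.na = σ.na → Q τ σ') :
    Run B powP σ Q := by
  classical
  have hex : ∃ j, n ≤ 2 ^ j ∨ j = (nt - t).toNat := ⟨_, .inr rfl⟩
  set N := Nat.find hex with hN
  have hNn : N ≤ n := Nat.find_min' hex (.inl n.lt_two_pow_self.le)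
  have hNg : N ≤ (nt - t).toNat := Nat.find_min' hex (.inr rfl)
  have hlt : ∀ j < N, 2 ^ j < n ∧ j < (nt - t).toNat := fun j hj => by
    have := Nat.find_min hex hj
    omega
  simp [powP, h3]
  refine ⟨by omega, ?_⟩
  refine (run_loop (c := 20) (fun j σ' => ThrFrame σ σ' ∧ σ'.nv 9 = r ∧ σ'.nv 10 = 2 ^ j ∧
    σ'.rv 4 = nt ∧ σ'.rv 5 = ((t + j : ℤ) : ℝ) ∧ σ'.na = σ.na) N ?_ ?_ ?_).mono ?_
  · rintro j hj σ₁ ⟨i1, i2, i3, i4, i5, i6⟩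
    have h0' : σ₁.nv 0 = n := (i1.1 0 (by norm_num) (by norm_num)).trans h0
    obtain ⟨a1, a2⟩ := hlt j hj
    have c1 : ((t + j : ℤ) : ℝ) + 1 = ((t + (j + 1 : ℕ) : ℤ) : ℝ) := by push_cast; ring
    refine ⟨by simp [h0', i3]; omega, ?_, ?_⟩
    · simp only [BExp.Holds, eval_var, h0', i3, RExp.eval, i4, i5, Int.cast_le]
      omega
    · simp only [run_block_cons, run_block_nil, run_nset, run_rset, fits_add, fits_var, eval_add,
        eval_var, i3, RExp.Fits, RExp.eval, rv_setNV, i5, fits_lit, eval_lit,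
        Nat.cast_one, c1]
      refine ⟨⟨by omega, by omega, by omega⟩, ⟨trivial, by omega⟩, by simp, ?_, ?_, ?_, ?_, ?_, ?_⟩
      · refine i1.trans ⟨fun v hv _ => ?_, fun a _ _ => by simp, fun v hv => ?_, by simp⟩
        · simp [show v ≠ 10 by omega]
        · simp [show v ≠ 5 by omega]
      · simpa using i2
      · simp; ring
      · simpa using i4
      · simp
      · simpa using i6
  · rintro σ₁ ⟨i1, i2, i3, i4, i5, i6⟩
    have h0' : σ₁.nv 0 = n := (i1.1 0 (by norm_num) (by norm_num)).trans h0
    have hB : 2 ^ N ≤ B := by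
      rcases Nat.eq_zero_or_pos N with h | h
      · rw [h]; omega
      · have := (hlt (N - 1) (by omega)).1
        have h2 : 2 ^ N = 2 ^ (N - 1) * 2 := by rw [← pow_succ]; congr 1; omega
        omega
    refine ⟨by simp [h0', i3]; omega, ?_⟩
    simp only [BExp.Holds, eval_var, h0', i3, RExp.eval, i4, i5, Int.cast_le]
    have hsp : n ≤ 2 ^ N ∨ N = (nt - t).toNat := Nat.find_spec hex
    omega
  · refine ⟨⟨fun v hv _ => ?_, fun a _ _ => by simp, fun v hv => ?_, by simp⟩, by simp [h9],
      by simp, by simp [h4], by simp, by simp⟩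
    · simp [show v ≠ 10 by omega]
    · simp [show v ≠ 5 by omega]
  · rintro τ σ₁ ⟨hτ, i1, i2, i3, i4, i5, i6⟩
    refine hQ _ _ _ ?_ i1 i2 i3 i4 Nat.one_le_two_pow ?_ (fun N' hN' => ?_) i6
    · simp at hτ; omega
    · rcases Nat.eq_zero_or_pos N with h | h
      · rw [h]; omega
      · have := (hlt (N - 1) (by omega)).1
        have h2 : 2 ^ N = 2 ^ (N - 1) * 2 := by rw [← pow_succ]; congr 1; omega
        omega
    · exact cd_pow_cap hN' hNg (Nat.find_spec hex)

theorem run_thrP (hnB : 2 * n + 1 ≤ B) (hn : 1 ≤ n) (h0 : σ.nv 0 = n)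
    (hu : ∀ i < n, σ.ra 1 i = u i) (h1 : σ.rv 1 = mx) (h2 : σ.rv 2 = mn)
    (hmx : ∀ i < n, u i ≤ mx) (hmn : ∀ i < n, mn ≤ u i) (hmn' : ∃ i < n, u i = mn)
    (hB : idx (thr n u mx) (mx + 1) ≤ B)
    (hQ : ∀ τ σ', τ ≤ idx (thr n u mx) (mx + 1) * (100 * n + 70) + 20 → ThrFrame σ σ' →
      σ'.nv 5 = idx (thr n u mx) (mx + 1) → (∀ i < n, σ'.na 8 i = idx (thr n u mx) (u i)) →
      (∀ r, 1 ≤ r → r ≤ idx (thr n u mx) (mx + 1) → 1 ≤ σ'.na 9 r ∧ σ'.na 9 r ≤ 2 * n ∧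
        ∀ N ≤ n, cd N (σ'.na 9 r) = cd N (2 ^ (thrDist (thr n u mx) (mn - 1) r -
          thrDist (thr n u mx) (mn - 1) (r - 1)))) → Q τ σ') :
    Run B thrP σ Q := by
  set Θ := thr n u mx with hΘ
  set m := idx Θ (mx + 1) with hm
  have hlo : ∀ s ∈ Θ, mn - 1 ≤ s := fun s hs => by
    obtain ⟨i, hi, hi'⟩ := hmn'
    have h3 := hmx i hi
    rcases mem_thr.1 hs with rfl | ⟨i, hi, rfl | rfl⟩
    · omega
    · have := hmn i hi; omega
    · have := hmn i hi; omega
  have hhi : ∀ s ∈ Θ, s ≤ mx + 1 := fun s hs => by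
    rcases mem_thr.1 hs with rfl | ⟨i, hi, rfl | rfl⟩
    · omega
    · have := hmx i hi; omega
    · have := hmx i hi; omega
  have hmnΘ : mn - 1 ∈ Θ := by
    obtain ⟨i, hi, rfl⟩ := hmn'; exact mem_thr_sub hi
  have h0Θ : idx Θ (mn - 1) = 0 := by
    rw [idx, Finset.card_eq_zero, Finset.filter_eq_empty_iff]
    intro s hs h
    have := hlo s hs
    omega
  have c1 : ((mn : ℝ) - 1) = ((mn - 1 : ℤ) : ℝ) := by push_cast; rfl
  simp [thrP, h2, c1, -Int.cast_sub]
  refine ⟨by omega, ?_⟩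
  refine (run_loop (c := 100 * n + 60) (fun j σ' => ∃ t ∈ Θ, idx Θ t = j ∧ ThrFrame σ σ' ∧
    σ'.nv 9 = j ∧ σ'.rv 3 = (t : ℤ) ∧ (∀ i < n, u i < t → σ'.na 8 i = idx Θ (u i)) ∧
    (∀ r, 1 ≤ r → r ≤ j → 1 ≤ σ'.na 9 r ∧ σ'.na 9 r ≤ 2 * n ∧
        ∀ N ≤ n, cd N (σ'.na 9 r) = cd N (2 ^ (thrDist Θ (mn - 1) r -
          thrDist Θ (mn - 1) (r - 1))))) m ?_ ?_ ?_).mono ?_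
  · rintro j hj σ₁ ⟨t, htΘ, htj, i1, i2, i3, i4, i5⟩
    have h0' : σ₁.nv 0 = n := (i1.1 0 (by norm_num) (by norm_num)).trans h0
    have h1' : σ₁.rv 1 = mx := (i1.2.2.1 1 (by norm_num)).trans h1
    have hu' : ∀ i < n, σ₁.ra 1 i = u i := fun i hi => by rw [i1.2.2.2, hu i hi]
    have htm : t < mx + 1 := (idx_lt_iff htΘ).1 (by omega)
    refine ⟨by simp, by simp [i3, h1']; omega, ?_⟩
    simp only [thrStep, run_block_cons]
    refine run_scanP (by omega) h0' i2 (by omega) hu' h1' i3 (by omega) ?_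
    intro τ σ₂ nt hτ j1 j2 j3 j4 j5 j6 j7 j8 j9
    have h0'' : σ₂.nv 0 = n := (j1.1 0 (by norm_num) (by norm_num)).trans h0'
    refine run_powP hnB hn h0'' j2 j3 j4 j5 ?_
    intro τ' σ₃ P hτ' k1 k2 k3 k4 k5 k6 k7 k8
    have hnt : idx Θ nt = j + 1 := by rw [idx_next htΘ j5 j7, htj]
    have hntB : j + 1 ≤ B := by omega
    simp only [run_block_nil, run_nset, run_nstore, run_rset, fits_add, fits_var, eval_add, fits_lit,
      eval_lit, eval_var, k2, nv_setNV, if_true, RExp.Fits, RExp.eval, rv_setNA, rv_setNV, k4,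
      k3, Nat.reduceEqDiff, if_false]
    refine ⟨⟨by omega, by omega, hntB⟩, hntB, by omega, trivial, by simp; omega, nt, j6, hnt, ?_,
      by simp, by simp, ?_, ?_⟩
    · refine ((i1.trans j1).trans k1).trans ⟨fun v hv h5 => ?_, fun a _ h9 => ?_, fun v hv => ?_, by simp⟩
      · simp [show v ≠ 9 by omega]
      · simp [h9]
      · simp [show v ≠ 3 by omega]
    · intro i hi hui
      simp [k8, j8 i hi]
      split_ifs with h
      · rw [h, htj]
      · refine i4 i hi (lt_of_not_ge fun hc => ?_)
        have := j7 (u i) (mem_thr_self hi) (lt_of_le_of_ne hc (Ne.symm h))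
        omega
    · intro r hr1 hr2
      simp only [na_setRV, na_setNA, na_setNV, if_true, k8, j9]
      rcases Nat.lt_succ_iff_lt_or_eq.1 (Nat.lt_succ_of_le hr2) with hr | rfl
      · rw [Function.update_of_ne hr.ne]
        exact i5 r hr1 (by omega)
      · rw [Function.update_self]
        refine ⟨k5, k6, fun N hN => ?_⟩
        have := hlo t htΘ
        rw [k7 N hN, ← hnt, thrDist_idx j6, hnt, Nat.add_sub_cancel, ← htj, thrDist_idx htΘ]
        congr 2
        omega
  · rintro σ₁ ⟨t, htΘ, htj, i1, i2, i3, i4, i5⟩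
    have h1' : σ₁.rv 1 = mx := (i1.2.2.1 1 (by norm_num)).trans h1
    have := (idx_lt_iff (Θ := Θ) (t := mx + 1) htΘ).not.1 (by omega)
    simp [i3, h1']; omega
  · refine ⟨mn - 1, hmnΘ, h0Θ, ⟨fun v hv _ => ?_, fun a _ _ => by simp, fun v hv => ?_, by simp⟩,
      by simp, by simp, fun i hi hui => ?_, fun r h1 h2 => by omega⟩
    · simp [show v ≠ 9 by omega]
    · simp [show v ≠ 3 by omega]
    · have := hmn i hi; omega
  · rintro τ σ₁ ⟨hτ, t, htΘ, htj, i1, i2, i3, i4, i5⟩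
    have h3 := (idx_lt_iff (Θ := Θ) (t := mx + 1) htΘ).not.1 (by omega)
    simp [i2]
    refine ⟨by omega, hQ _ _ ?_ ?_ (by simp) (fun i hi => ?_) (fun r hr1 hr2 => ?_)⟩
    · simp at hτ
      have : m * (100 * n + 60 + 3 + 1) ≤ m * (100 * n + 70) := Nat.mul_le_mul le_rfl (by omega)
      omega
    · exact i1.trans ⟨fun v hv h5 => by simp [h5], fun a _ _ => by simp, fun v hv => by simp, by simp⟩
    · simpa using i4 i hi (by have := hmx i hi; omega)
    · simpa using i5 r hr1 hr2

end Scan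

/-! ### Initialization of the levels -/

/-- The number of thresholds, not counting the one for the ends of the sequence. -/
def numThr (n : ℕ) (u : ℕ → ℤ) (mx : ℤ) : ℕ := idx (thr n u mx) (mx + 1)

/-- The numbers of the thresholds of the first `j` items, which stand at the positions `1, …, j`,
and the highest number elsewhere. -/
def initLev (n : ℕ) (u : ℕ → ℤ) (mx : ℤ) (j y : ℕ) : ℕ :=
  if 1 ≤ y ∧ y ≤ j then idx (thr n u mx) (u (y - 1)) else numThr n u mx

/-- The rank `K` and the word size `B` suit `n` items with integer weights `u`, of which `mx` is the
greatest and `mn` the least. -/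
structure Fit (B K n : ℕ) (u : ℕ → ℤ) (mx mn : ℤ) : Prop where
  hn : 1 ≤ n
  hK : 1 ≤ K
  hnK : n + 1 < bsz K
  hB : (2 * bsz K) ^ 5 ≤ B
  le : ∀ i < n, u i ≤ mx
  eq : ∃ i < n, u i = mx
  ge : ∀ i < n, mn ≤ u i
  eq' : ∃ i < n, u i = mn
  log : n * (numThr n u mx * (K + 3)) ≤ B

section Init
variable {B K n : ℕ} {u : ℕ → ℤ} {mx mn : ℤ} {σ : RamState} {Q : ℕ → RamState → Prop}

theorem numThr_le : numThr n u mx ≤ 2 * n := by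
  refine idx_top_le.trans (Nat.mul_le_mul le_rfl ?_)
  exact Finset.card_image_le.trans (Finset.card_range n).le

theorem Fit.idx_lt (h : Fit B K n u mx mn) {i : ℕ} (hi : i < n) :
    idx (thr n u mx) (u i) < numThr n u mx :=
  _root_.idx_lt (mem_thr_self hi) (by have := h.le i hi; omega)

theorem Fit.base_le (h : Fit B K n u mx mn) : 2 * bsz K ≤ B :=
  (Nat.le_self_pow (by norm_num) _).trans h.hB

theorem good_zero {f : ℕ → ℕ} {n K m : ℕ} : Good f n K m (fun _ => m) fun _ => 0 := by
  refine fun r _ hr => ⟨?_, fun p s h1 _ _ _ h5 => ?_⟩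
  · rw [show {x : ℕ | r ≤ m} = Set.univ by ext; simp [hr]]
    exact veb_univ r K 1 0 one_pos
  · have : s = p + 1 := by
      by_contra hc
      have := h5 (p + 1) (by omega) (by omega)
      omega
    subst this
    simp

/-- Lower all items from the highest number to their own, one after the other. -/
def initP : Cmd :=
  block [thrP, .nset 8 (lit 0),
    .loop (.not (.nle (var 0) (var 8)))
      (block [.nset 10 (var 8 + lit 1), .nset 11 (arr 8 (var 8) + lit 1), .nset 12 (var 5), lowerP,
        .nset 8 (var 8 + lit 1)]),
    .nset 6 (lit 0), .nset 2 (lit 1)]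

theorem run_initP (h : Fit B K n u mx mn) (h0 : σ.nv 0 = n) (h3 : σ.nv 3 = K)
    (h4 : σ.nv 4 = 2 * bsz K) (h6 : σ.nv 6 = 0) (htab : ∀ k ≤ K, σ.na 6 k = bsz k)
    (hzero : ∀ i, σ.na 1 i = 0) (hu : ∀ i < n, σ.ra 1 i = u i) (h1 : σ.rv 1 = mx)
    (h2 : σ.rv 2 = mn)
    (hQ : ∀ t σ' M, t ≤ n * numThr n u mx * (150 * K + 800) →
      LowerEnv B K n (numThr n u mx) (thrDist (thr n u mx) (mn - 1)) σ' →
      (∀ v < 8, v ≠ 2 → v ≠ 5 → σ'.nv v = σ.nv v) → σ'.nv 2 = 1 →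
      (∀ a, a = 0 ∨ a = 4 ∨ a = 5 ∨ a = 6 ∨ a = 7 ∨ a = 11 → σ'.na a = σ.na a) →
      (∀ i < n, σ'.na 8 i = idx (thr n u mx) (u i)) → σ'.ra = σ.ra → σ'.rv 1 = σ.rv 1 →
      (∀ c, InR (2 * bsz K) c → σ'.na 1 (enc (2 * bsz K) c) = M c) →
      (∀ a, σ'.na 1 a ≤ 2 * bsz K) →
      Good (thrDist (thr n u mx) (mn - 1)) n K (numThr n u mx) (initLev n u mx n) M → Q t σ') :
    Run B initP σ Q := by
  have hnK := h.hnK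
  have hn := h.hn
  have hBW := h.base_le
  have hm2 := numThr_le (n := n) (u := u) (mx := mx)
  have hlog := h.log
  simp only [initP, run_block_cons]
  refine run_thrP (by omega) hn h0 hu h1 h2 h.le h.ge h.eq' (by unfold numThr at hm2; omega) ?_
  rw [← numThr]
  have hilt := fun i hi => h.idx_lt (i := i) hi
  have hm0 : 0 < numThr n u mx := by have := hilt 0 (by omega); omega
  set Θ := thr n u mx with hΘ
  set m := numThr n u mx with hm
  set f := thrDist Θ (mn - 1) with hf
  intro τ σ₁ hτ hF h5 h8 h9
  have hL : LowerEnv B K n m f (σ₁.setNV 8 0) :=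
    { hB := h.hB
      hK := h.hK
      nv3 := by simp [hF.1, h3]
      nv4 := by simp [hF.1, h4]
      tab := fun k hk => by simp [hF.2.1, htab k hk]
      hn := hnK
      hm := by omega
      nv5 := by simp [h5]
      mono := thrDist_mono
      pos := fun r hr1 hr2 => by simpa using (h9 r hr1 hr2).1
      le := fun r hr1 hr2 => by have := (h9 r hr1 hr2).2.1; simp; omega
      step := fun r hr1 hr2 N hN => by simpa using (h9 r hr1 hr2).2.2 N hN }
  simp
  refine (run_loop (c := m * (150 * K + 400) + 50) (fun j σ' => ∃ M, Sim B K (σ₁.setNV 8 0)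
    (j * (m * (K + 3))) M σ' ∧ Good f n K m (initLev n u mx j) M ∧ σ'.nv 8 = j) n
    ?_ ?_ ?_).mono ?_
  · rintro j hj σ₂ ⟨M, hS, hG, h8'⟩
    have h0' : σ₂.nv 0 = n := by rw [hS.nv 0 (by norm_num) (by norm_num)]; simp [hF.1, h0]
    have h5' : σ₂.nv 5 = m := by rw [hS.nv 5 (by norm_num) (by norm_num)]; simp [h5]
    have h8'' : σ₂.na 8 j = idx Θ (u j) := by
      rw [hS.na 8 (by norm_num) (by norm_num) (by norm_num) (by norm_num)]; simp [h8 j hj]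
    have hlt := hilt j hj
    have hle : (j + 1) * (m * (K + 3)) ≤ n * (m * (K + 3)) := Nat.mul_le_mul_right _ hj
    rw [Nat.succ_mul] at hle
    have hv : initLev n u mx j (j + 1) = m := by simp [initLev, hm]
    refine ⟨by simp [h0', h8']; omega, by simp [h0', h8']; omega, ?_⟩
    simp only [run_block_cons, run_block_nil, run_nset, fits_add, fits_var, h8', fits_lit, eval_add,
      eval_var, eval_lit, fits_arr, eval_arr, nv_setNV, na_setNV, h8'', Nat.reduceEqDiff, if_false,
      h5']
    refine ⟨by omega, by omega, by omega, ?_⟩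
    refine run_lowerP hL (((hS.setNV (by norm_num)).setNV (by norm_num)).setNV (by norm_num)) hG
      (by simp [initLev, hm]) (le_of_eq (by rw [initLev, if_neg (by omega)])) (x := j + 1) (r₀ := idx Θ (u j)) (by omega)
      (by omega) hv.le (by rw [hv]; exact hlt) (by simp) (by simp) (by rw [hv]; simp) ?_ ?_
    · rw [nv_setNV, if_neg (by norm_num), hF.1 6 (by norm_num) (by norm_num), h6]; omega
    intro t σ₃ M' ht hS' hG' f'
    rw [f' 8 (by norm_num) (by norm_num)]
    simp only [nv_setNV, Nat.reduceEqDiff, if_false, h8', if_true]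
    refine ⟨by omega, by simp; omega, M', ?_, ?_, trivial⟩
    · rw [Nat.succ_mul]; exact hS'.setNV (by norm_num)
    · convert hG' using 1
      ext y
      by_cases hy : y = j + 1
      · subst hy; simp [initLev, hΘ]
      · rw [Function.update_of_ne hy, initLev, initLev]
        congr 1
        simp; omega
  · rintro σ₂ ⟨M, hS, hG, h8'⟩
    have h0' : σ₂.nv 0 = n := by rw [hS.nv 0 (by norm_num) (by norm_num)]; simp [hF.1, h0]
    simp [h0', h8']; omega
  · refine ⟨fun _ => 0, ⟨fun _ _ _ => rfl, fun _ _ _ _ _ => rfl, rfl, rfl, fun c _ => ?_, fun a => ?_,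
      le_rfl, by simp, fun _ _ => ⟨rfl, rfl⟩, fun j h1 h2 => absurd h2 (by omega), by
      rw [Nat.sub_self, rollback]⟩, ?_, by simp⟩
    · simp [hF.2.1, hzero]
    · simp [hF.2.1, hzero]
    · convert good_zero using 1
      ext y
      rw [initLev, if_neg (by omega)]
  · rintro t σ₂ ⟨ht, M, hS, hG, h8'⟩
    refine ⟨by omega, hQ _ _ M ?_ ?_ ?_ (by simp) ?_ ?_ ?_ ?_ ?_ ?_ hG⟩
    · simp at ht
      have e1 : n * (m * (150 * K + 400) + 50 + 4 + 1) = n * m * (150 * K + 400) + n * 55 := by ring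
      have e2 : m * (100 * n + 70) = n * m * 100 + m * 70 := by ring
      have e3 : n * m * (150 * K + 800) = n * m * (150 * K + 400) + n * m * 400 := by ring
      have e4 : n * 1 ≤ n * m := Nat.mul_le_mul le_rfl hm0
      have e5 : 1 * m ≤ n * m := Nat.mul_le_mul hn le_rfl
      omega
    · have hnv : ∀ v < 6, v ≠ 2 → (((σ₂.setNV 6 0).setNV 2 1)).nv v = (σ₁.setNV 8 0).nv v :=
        fun v hv h2 => by
          simp only [nv_setNV, h2, if_false, show v ≠ 6 by omega]
          rw [hS.nv v (by omega) (by omega), nv_setNV]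
      have hna : ∀ a, a = 6 ∨ a = 9 → (((σ₂.setNV 6 0).setNV 2 1)).na a = (σ₁.setNV 8 0).na a :=
        fun a ha => hS.na a (by omega) (by omega) (by omega) (by omega)
      exact
        { hB := hL.hB
          hK := hL.hK
          nv3 := (hnv 3 (by norm_num) (by norm_num)).trans hL.nv3
          nv4 := (hnv 4 (by norm_num) (by norm_num)).trans hL.nv4
          tab := by rw [hna 6 (by simp)]; exact hL.tab
          hn := hnK
          hm := by omega
          nv5 := (hnv 5 (by norm_num) (by norm_num)).trans hL.nv5
          mono := thrDist_mono
          pos := by rw [hna 9 (by simp)]; exact hL.pos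
          le := by rw [hna 9 (by simp)]; exact hL.le
          step := by rw [hna 9 (by simp)]; exact hL.step }
    · intro v hv h2 h5
      by_cases hv6 : v = 6
      · subst hv6; simp [h6]
      · simp only [nv_setNV, h2, if_false, hv6]
        rw [hS.nv v hv hv6, nv_setNV, if_neg (by omega), hF.1 v hv h5]
    · intro a ha
      simp only [na_setNV]
      rw [hS.na a (by omega) (by omega) (by omega) (by omega), na_setNV,
        hF.2.1 a (by omega) (by omega)]
    · intro i hi
      simp only [na_setNV]
      rw [hS.na 8 (by norm_num) (by norm_num) (by norm_num) (by norm_num), na_setNV, h8 i hi]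
    · simp only [ra_setNV]
      rw [hS.ra, ra_setNV, hF.2.2.2]
    · simp only [rv_setNV]
      rw [hS.rv, rv_setNV, hF.2.2.1 1 (by norm_num)]
    · simpa using hS.rep
    · simpa using hS.bd

end Init

/-! ### The program that builds the data structure -/

/-- Compute the rank of the stratified trees, and table `6` of the sizes of universes. -/
def rankP : Cmd :=
  block [.nstore 6 (lit 0) (lit 2),
    .loop (.nle (arr 6 (var 3)) (var 0 + lit 1))
      (block [.nstore 6 (var 3 + lit 1) (arr 6 (var 3) * arr 6 (var 3)), .nset 3 (var 3 + lit 1)]),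
    .nset 4 (arr 6 (var 3) + arr 6 (var 3))]

/-- Compute table `7` of the binary logarithms, rounded up, of the numbers up to `2 * n`. -/
def clogP : Cmd :=
  block [.nset 8 (lit 2),
    .loop (.nle (var 8) (var 0 + var 0))
      (block [.nstore 7 (var 8) (arr 7 ((var 8 + lit 1) / lit 2) + lit 1),
        .nset 8 (var 8 + lit 1)])]

/-- Real register `1` takes the maximum with real register `3`. -/
def maxP : Cmd := .ite (.rle (.var 3) (.var 1)) .skip (.rset 1 (.var 3))

/-- Real register `2` takes the minimum with real register `3`. -/
def minP : Cmd := .ite (.rle (.var 2) (.var 3)) .skip (.rset 2 (.var 3))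

/-- Round the weights up, and find the greatest and the least of the resulting integers. -/
def ceilP : Cmd :=
  block [.rset 1 (.ceil (.arr 0 (lit 0))), .rset 2 (.var 1), .nset 8 (lit 0),
    .loop (.not (.nle (var 0) (var 8)))
      (block [.rset 3 (.ceil (.arr 0 (var 8))), .rstore 1 (var 8) (.var 3), maxP, minP,
        .nset 8 (var 8 + lit 1)])]

/-- The program that builds the data structure: tables and rounded weights, all in linear time. -/
def buildP : Cmd := block [rankP, clogP, ceilP]

/-- The weights rounded up, as a sequence. -/
noncomputable def ceilAt {n : ℕ} (w : Fin n → ℝ) (i : ℕ) : ℤ :=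
  if h : i < n then ⌈w ⟨i, h⟩⌉ else 0

section Build
variable {B n : ℕ} {σ : RamState} {Q : ℕ → RamState → Prop}

theorem run_rankP (hn : 1 ≤ n) (hB : 2 * (n + 1) ^ 2 ≤ B) (h0 : σ.nv 0 = n) (h3 : σ.nv 3 = 0)
    (hQ : ∀ t σ' K, t ≤ 40 * n + 60 → 1 ≤ K → n + 1 < bsz K → bsz (K - 1) ≤ n + 1 →
      (∀ v, v ≠ 3 → v ≠ 4 → σ'.nv v = σ.nv v) → σ'.nv 3 = K → σ'.nv 4 = 2 * bsz K →
      (∀ a, a ≠ 6 → σ'.na a = σ.na a) → (∀ k ≤ K, σ'.na 6 k = bsz k) → σ'.rv = σ.rv →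
      σ'.ra = σ.ra → Q t σ') :
    Run B rankP σ Q := by
  classical
  have hex : ∃ k, n + 1 < bsz k := ⟨n + 1, lt_bsz _⟩
  set K := Nat.find hex with hK
  have hsp : n + 1 < bsz K := Nat.find_spec hex
  have hlt : ∀ k < K, bsz k ≤ n + 1 := fun k hk => not_lt.1 (Nat.find_min hex hk)
  have hK1 : 1 ≤ K := by
    by_contra hc
    have h : K = 0 := by omega
    rw [h] at hsp
    have : bsz 0 = 2 := rfl
    omega
  have hKn : K ≤ n + 1 := by
    have := lt_bsz (K - 1)
    have := hlt (K - 1) (by omega)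
    omega
  have hsq : ∀ k < K, bsz k * bsz k ≤ (n + 1) ^ 2 := fun k hk => by
    rw [pow_two]; exact Nat.mul_le_mul (hlt k hk) (hlt k hk)
  have hn2 : n + 1 ≤ (n + 1) ^ 2 := Nat.le_self_pow (by norm_num) _
  have hKle : ∀ k ≤ K, bsz k ≤ (n + 1) ^ 2 := fun k hk => by
    rcases hk.lt_or_eq with h | rfl
    · exact (hlt k h).trans hn2
    · have := hsq (K - 1) (by omega)
      rwa [← bsz_succ, Nat.sub_add_cancel hK1] at this
  have hnB : 2 * (n + 1) ≤ B := (Nat.mul_le_mul le_rfl hn2).trans hB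
  simp [rankP]
  refine ⟨by omega, ?_⟩
  refine (run_loop (c := 20) (fun j σ' => (∀ v, v ≠ 3 → v ≠ 4 → σ'.nv v = σ.nv v) ∧ σ'.nv 3 = j ∧
    (∀ a, a ≠ 6 → σ'.na a = σ.na a) ∧ (∀ k ≤ j, σ'.na 6 k = bsz k) ∧ σ'.rv = σ.rv ∧
    σ'.ra = σ.ra) K ?_ ?_ ?_).mono ?_
  · rintro j hj σ₁ ⟨i1, i2, i3, i4, i5, i6⟩
    have h0' : σ₁.nv 0 = n := (i1 0 (by norm_num) (by norm_num)).trans h0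
    have h6 := i4 j le_rfl
    have b1 := hlt j hj
    have b2 := hsq j hj
    refine ⟨by simp [h0', i2, h6]; omega, by simp [h0', i2, h6, b1], ?_⟩
    simp [i2, h6]
    refine ⟨by omega, by omega, by omega, fun v h3 h4 => ?_, fun a ha => ?_, fun k hk => ?_, i5, i6⟩
    · simp [h3, i1 v h3 h4]
    · simp [ha, i3 a ha]
    · rcases Nat.lt_succ_iff_lt_or_eq.1 (Nat.lt_succ_of_le hk) with h | rfl
      · rw [Function.update_of_ne h.ne, i4 k (by omega)]
      · rw [Function.update_self, bsz_succ]
  · rintro σ₁ ⟨i1, i2, i3, i4, i5, i6⟩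
    have h0' : σ₁.nv 0 = n := (i1 0 (by norm_num) (by norm_num)).trans h0
    have h6 := i4 K le_rfl
    have := hKle K le_rfl
    refine ⟨by simp [h0', i2, h6]; omega, by simp [h0', i2, h6]; omega⟩
  · refine ⟨fun v _ _ => rfl, h3, fun a ha => by simp [ha], fun k hk => ?_, rfl, rfl⟩
    obtain rfl : k = 0 := by omega
    simp [bsz]
  · rintro t σ₁ ⟨ht, i1, i2, i3, i4, i5, i6⟩
    have h6 := i4 K le_rfl
    have := hKle K le_rfl
    simp [i2, h6]
    refine ⟨by omega, hQ _ _ K ?_ hK1 hsp (hlt _ (by omega)) (fun v h3 h4 => ?_) ?_ ?_ ?_ ?_ ?_ ?_⟩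
    · simp at ht; omega
    · simp [h4, i1 v h3 h4]
    · simp [i2]
    · simp; omega
    · simpa using i3
    · simpa using i4
    · simpa using i5
    · simpa using i6

theorem clog_le_self (N : ℕ) : Nat.clog 2 N ≤ N :=
  Nat.clog_le_of_le_pow N.lt_two_pow_self.le

theorem run_clogP (hn : 1 ≤ n) (hB : 4 * n + 4 ≤ B) (h0 : σ.nv 0 = n) (h7 : ∀ i, σ.na 7 i = 0)
    (hQ : ∀ t σ', t ≤ 60 * n + 20 → (∀ v, v ≠ 8 → σ'.nv v = σ.nv v) →
      (∀ a, a ≠ 7 → σ'.na a = σ.na a) → (∀ N ≤ 2 * n, σ'.na 7 N = Nat.clog 2 N) → σ'.rv = σ.rv →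
      σ'.ra = σ.ra → Q t σ') :
    Run B clogP σ Q := by
  simp [clogP]
  refine ⟨by omega, ?_⟩
  refine (run_loop (c := 20) (fun j σ' => (∀ v, v ≠ 8 → σ'.nv v = σ.nv v) ∧ σ'.nv 8 = j + 2 ∧
    (∀ a, a ≠ 7 → σ'.na a = σ.na a) ∧ (∀ N < j + 2, σ'.na 7 N = Nat.clog 2 N) ∧ σ'.rv = σ.rv ∧
    σ'.ra = σ.ra) (2 * n - 1) ?_ ?_ ?_).mono ?_
  · rintro j hj σ₁ ⟨i1, i2, i3, i4, i5, i6⟩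
    have h0' : σ₁.nv 0 = n := (i1 0 (by norm_num)).trans h0
    have h7 := i4 ((j + 2 + 1) / 2) (by omega)
    have hcl := clog_le_self ((j + 2 + 1) / 2)
    have hrec : Nat.clog 2 (j + 2) = Nat.clog 2 ((j + 2 + 1) / 2) + 1 :=
      Nat.clog_of_two_le (by norm_num) (by omega)
    refine ⟨by simp [h0', i2]; omega, by simp [h0', i2]; omega, ?_⟩
    simp [i2, h7]
    refine ⟨by omega, by omega, by omega, fun v h8 => ?_, fun a ha => ?_, fun N hN => ?_, i5, i6⟩
    · simp [h8, i1 v h8]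
    · simp [ha, i3 a ha]
    · rcases Nat.lt_succ_iff_lt_or_eq.1 hN with h | rfl
      · rw [Function.update_of_ne (by omega), i4 N (by omega)]
      · rw [Function.update_self, hrec]
  · rintro σ₁ ⟨i1, i2, i3, i4, i5, i6⟩
    have h0' : σ₁.nv 0 = n := (i1 0 (by norm_num)).trans h0
    refine ⟨by simp [h0', i2]; omega, by simp [h0', i2]; omega⟩
  · refine ⟨fun v h8 => by simp [h8], by simp, fun a _ => rfl, fun N hN => ?_, rfl, rfl⟩
    have : N = 0 ∨ N = 1 := by omega
    rcases this with rfl | rfl <;> simp [h7]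
  · rintro t σ₁ ⟨ht, i1, i2, i3, i4, i5, i6⟩
    refine hQ _ _ ?_ i1 i3 (fun N hN => i4 N (by omega)) i5 i6
    simp at ht; omega

theorem run_maxP {a b : ℤ} (h1 : σ.rv 1 = a) (h3 : σ.rv 3 = b)
    (hQ : ∀ τ ≤ 10, Q τ (σ.setRV 1 (max a b : ℤ))) : Run B maxP σ Q := by
  simp only [maxP, run_ite, BExp.Fits, RExp.Fits, BExp.Holds, RExp.eval, h1, h3, Int.cast_le, run_skip,
    run_rset]
  refine ⟨by simp, fun h => ?_, fun h => ⟨trivial, ?_⟩⟩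
  · have := hQ 5 (by norm_num)
    rwa [max_eq_left h, ← h1, show σ.setRV 1 (σ.rv 1) = σ by simp [RamState.setRV]] at this
  · have := hQ 6 (by norm_num)
    rwa [max_eq_right (by omega)] at this

theorem run_minP {a b : ℤ} (h2 : σ.rv 2 = a) (h3 : σ.rv 3 = b)
    (hQ : ∀ τ ≤ 10, Q τ (σ.setRV 2 (min a b : ℤ))) : Run B minP σ Q := by
  simp only [minP, run_ite, BExp.Fits, RExp.Fits, BExp.Holds, RExp.eval, h2, h3, Int.cast_le, run_skip,
    run_rset]
  refine ⟨by simp, fun h => ?_, fun h => ⟨trivial, ?_⟩⟩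
  · have := hQ 5 (by norm_num)
    rwa [min_eq_left h, ← h2, show σ.setRV 2 (σ.rv 2) = σ by simp [RamState.setRV]] at this
  · have := hQ 6 (by norm_num)
    rwa [min_eq_right (by omega)] at this

theorem run_ceilP {w : Fin n → ℝ} (hn : 1 ≤ n) (hB : n + 1 ≤ B) (h0 : σ.nv 0 = n)
    (hw : ∀ i : Fin n, σ.ra 0 i = w i)
    (hQ : ∀ t σ' (mx mn : ℤ), t ≤ 50 * n + 20 → (∀ v, v ≠ 8 → σ'.nv v = σ.nv v) →
      σ'.na = σ.na → σ'.ra 0 = σ.ra 0 → (∀ i < n, σ'.ra 1 i = (ceilAt w i : ℝ)) →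
      σ'.rv 1 = (mx : ℝ) → σ'.rv 2 = (mn : ℝ) → (∀ i < n, ceilAt w i ≤ mx) → (∃ i < n, ceilAt w i = mx) →
      (∀ i < n, mn ≤ ceilAt w i) → (∃ i < n, ceilAt w i = mn) → Q t σ') :
    Run B ceilP σ Q := by
  have hc : ∀ i, i < n → (⌈σ.ra 0 i⌉ : ℤ) = ceilAt w i := fun i hi => by
    rw [ceilAt, dif_pos hi, ← hw ⟨i, hi⟩]
  simp [ceilP, hc 0 hn]
  refine (run_loop (c := 40) (fun j σ' => ∃ mx mn : ℤ, (∀ v, v ≠ 8 → σ'.nv v = σ.nv v) ∧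
    σ'.nv 8 = j ∧ σ'.na = σ.na ∧ σ'.ra 0 = σ.ra 0 ∧ (∀ i < j, σ'.ra 1 i = (ceilAt w i : ℝ)) ∧
    σ'.rv 1 = mx ∧ σ'.rv 2 = mn ∧ (∀ i < j, ceilAt w i ≤ mx) ∧ (∃ i < n, ceilAt w i = mx) ∧
      (∀ i < j, mn ≤ ceilAt w i) ∧ (∃ i < n, ceilAt w i = mn)) n ?_ ?_ ?_).mono ?_
  · rintro j hj σ₁ ⟨mx, mn, i1, i2, i3, i4, i5, i6, i7, i8, i9, i10, i11⟩
    have h0' : σ₁.nv 0 = n := (i1 0 (by norm_num)).trans h0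
    refine ⟨by simp [h0', i2]; omega, by simp [h0', i2]; omega, ?_⟩
    simp only [run_block_cons, run_rset, run_rstore, RExp.Fits, fits_var, RExp.eval, eval_var, i2, i4,
      hc j hj, nv_setRV, rv_setRV, if_true]
    refine ⟨by omega, by omega, trivial, ?_⟩
    refine run_maxP (a := mx) (b := ceilAt w j) (by simp [i6]) (by simp) fun τ hτ => ?_
    refine run_minP (a := mn) (b := ceilAt w j) (by simp [i7]) (by simp) fun τ' hτ' => ?_
    simp only [run_nset, run_block_nil, fits_add, fits_var, fits_lit, eval_add, eval_var, eval_lit,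
      nv_setRV, nv_setRA, i2]
    refine ⟨by omega, by simp; omega, max mx (ceilAt w j), min mn (ceilAt w j), fun v h8 => ?_, by simp, by simp [i3],
      by simp [i4], fun i hi => ?_, by simp, by simp, fun i hi => ?_, ?_, fun i hi => ?_, ?_⟩
    · simp [h8, i1 v h8]
    · rcases Nat.lt_succ_iff_lt_or_eq.1 hi with h | rfl
      · simp [Function.update_of_ne h.ne, i5 i h]
      · simp
    · rcases Nat.lt_succ_iff_lt_or_eq.1 hi with h | rfl
      · have := i8 i h; omega
      · omega
    · rcases le_total mx (ceilAt w j) with h | h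
      · exact ⟨j, hj, by omega⟩
      · obtain ⟨i, hi, he⟩ := i9; exact ⟨i, hi, by omega⟩
    · rcases Nat.lt_succ_iff_lt_or_eq.1 hi with h | rfl
      · have := i10 i h; omega
      · omega
    · rcases le_total (ceilAt w j) mn with h | h
      · exact ⟨j, hj, by omega⟩
      · obtain ⟨i, hi, he⟩ := i11; exact ⟨i, hi, by omega⟩
  · rintro σ₁ ⟨mx, mn, i1, i2, -⟩
    have h0' : σ₁.nv 0 = n := (i1 0 (by norm_num)).trans h0
    refine ⟨by simp [h0', i2]; omega, by simp [h0', i2]⟩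
  · refine ⟨ceilAt w 0, ceilAt w 0, fun v h8 => by simp [h8], by simp, rfl, rfl, by simp, by simp,
      by simp, by simp, ⟨0, hn, rfl⟩, by simp, ⟨0, hn, rfl⟩⟩
  · rintro t σ₁ ⟨ht, mx, mn, i1, i2, i3, i4, i5, i6, i7, i8, i9, i10, i11⟩
    refine hQ _ _ mx mn ?_ i1 i3 i4 i5 i6 i7 i8 i9 i10 i11
    simp at ht; omega

end Build

/-! ### The cost from the counts of the two highest levels -/

/-- The numbers of the present weights, when the set operations `H` are in force. -/
def lev {n : ℕ} (u : ℕ → ℤ) (mx : ℤ) (H : List (Fin n)) (y : ℕ) : ℕ :=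
  if h : 1 ≤ y ∧ y ≤ n then idx (thr n u mx) (u (y - 1)) - bitOf H ⟨y - 1, by omega⟩
  else numThr n u mx

section Lev
variable {B K n : ℕ} {u : ℕ → ℤ} {mx mn : ℤ} {H : List (Fin n)}

theorem lev_item (i : Fin n) : lev u mx H (i + 1) = idx (thr n u mx) (u i) - bitOf H i := by
  rw [lev, dif_pos ⟨by omega, i.2⟩]; rfl

theorem lev_zero : lev u mx H 0 = numThr n u mx := by rw [lev, dif_neg (by omega)]

theorem lev_last : lev u mx H (n + 1) = numThr n u mx := by rw [lev, dif_neg (by omega)]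

theorem lev_nil : lev u mx ([] : List (Fin n)) = initLev n u mx n := by
  ext y
  rw [lev, initLev]
  split_ifs
  · simp [bitOf]
  · rfl

theorem bitOf_cons (i j : Fin n) : bitOf (i :: H) j = if j = i then 1 else bitOf H j := by
  by_cases h : j = i <;> simp [bitOf, h]

theorem lev_cons_of_mem {i : Fin n} (hi : i ∈ H) : lev u mx (i :: H) = lev u mx H := by
  have : ∀ j, bitOf (i :: H) j = bitOf H j := fun j => by
    rw [bitOf_cons]
    split_ifs with h
    · rw [h, bitOf, if_pos hi]
    · rfl
  ext y
  simp only [lev, this]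

theorem lev_cons_of_notMem (i : Fin n) : lev u mx (i :: H) =
    Function.update (lev u mx H) (i + 1) (idx (thr n u mx) (u i) - 1) := by
  ext y
  by_cases h : y = i + 1
  · rw [h, lev_item, Function.update_self, bitOf_cons, if_pos rfl]
  · rw [Function.update_of_ne h, lev, lev]
    split_ifs with hy
    · rw [bitOf_cons, if_neg]
      rintro he
      have := congrArg Fin.val he
      simp only at this
      omega
    · rfl

theorem lev_item_eq (i : Fin n) :
    lev u mx H (i + 1) = idx (thr n u mx) (u i - bitOf H i) := by
  rw [lev_item, bitOf]
  split_ifs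
  · rw [idx_sub_one i.2]; rfl
  · simp

theorem mem_thr_bit (i : Fin n) : u i - bitOf H i ∈ thr n u mx := by
  rw [bitOf]
  split_ifs
  · simpa using mem_thr_sub i.2
  · simpa using mem_thr_self i.2

theorem seg_eq_ofFn (e : ℕ → ℕ) : seg e 1 (n + 1) = List.ofFn fun i : Fin n => e (i + 1) := by
  refine List.ext_getElem (by simp [seg]) fun i h1 h2 => ?_
  simp [seg, add_comm]

/-- The count of the whole sequence, in units of half the greatest weight, is found from the count
of the last run of the second highest level, which gives its parity, and that of the highest level.
The cost is the least power of two that is not smaller. -/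
theorem cost_eq (h : Fit B K n u mx mn) {M : Mem}
    (hG : Good (thrDist (thr n u mx) (mn - 1)) n K (numThr n u mx) (lev u mx H) M) {N : ℕ}
    (hN : N = 2 * M (5, numThr n u mx, 0, 0, n + 1) - M (5, numThr n u mx - 1, 0, 0, n + 1) % 2) :
    2 ≤ numThr n u mx ∧ N ≤ 2 * n ∧ M (5, numThr n u mx, 0, 0, n + 1) ≤ n ∧
      IsMinimaxCost (fun i : Fin n => (u i : ℝ) - (bitOf H i : ℝ))
        ((mx : ℝ) - 1 + (Nat.clog 2 N : ℝ)) := by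
  obtain ⟨i₀, hi₀, hu₀⟩ := h.eq
  obtain ⟨i₁, hi₁, hu₁⟩ := h.eq'
  have hmm : mn ≤ mx := by have := h.ge i₀ hi₀; omega
  have hlev := fun i => lev_item_eq (u := u) (mx := mx) (H := H) i
  have hmem := fun i => mem_thr_bit (u := u) (mx := mx) (H := H) i
  have hmx : mx ∈ thr n u mx := hu₀ ▸ mem_thr_self hi₀
  have hmx1 : mx - 1 ∈ thr n u mx := by have := mem_thr_sub (u := u) (mx := mx) hi₀; rwa [hu₀] at this
  have e1 : numThr n u mx = idx (thr n u mx) mx + 1 :=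
    idx_next hmx (by omega) fun a _ ha => by omega
  have e2 : idx (thr n u mx) mx = idx (thr n u mx) (mx - 1) + 1 :=
    idx_next hmx1 (by omega) fun a _ ha => by omega
  have hv0 := lev_zero (u := u) (mx := mx) (H := H)
  have hvn := lev_last (u := u) (mx := mx) (H := H)
  have hmono : Monotone (thrDist (thr n u mx) (mn - 1)) := thrDist_mono
  have hd := fun s hs => thrDist_idx (Θ := thr n u mx) (s := s) (t₀ := mn - 1) hs
  have hle := h.le
  have hge := h.ge
  set Θ := thr n u mx
  set f := thrDist Θ (mn - 1)
  set v := lev u mx H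
  set m := numThr n u mx
  obtain ⟨E, hE⟩ : ∃ E : ℕ, (E : ℤ) = mx - mn := ⟨(mx - mn).toNat, by omega⟩
  have f1 : f (m - 1) = E + 1 := by rw [e1, Nat.add_sub_cancel, hd mx hmx]; omega
  have f2 : f (m - 1 - 1) = E := by rw [e1, e2, Nat.add_sub_cancel, Nat.add_sub_cancel, hd _ hmx1]; omega
  have hvm : ∀ y, 0 < y → y < n + 1 → v y < m := fun y h1 h2 => by
    have := hlev ⟨y - 1, by omega⟩
    simp only [Nat.sub_add_cancel h1] at this
    rw [this, e1, Nat.lt_succ_iff]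
    exact idx_mono (by have := hle (y - 1) (by omega); omega)
  -- the count at the highest level
  have hA := ((hG m (by omega) le_rfl).link 0 (n + 1) (by omega) le_rfl hv0.ge hvn.ge
    fun y h1 h2 => hvm y h1 h2).2.2
  rw [run, zero_add, f1] at hA
  -- the last separator of the second highest level
  obtain ⟨p, hpn, hpv, hpl⟩ : ∃ p ≤ n, m - 1 ≤ v p ∧ ∀ y, p < y → y < n + 1 → v y < m - 1 := by
    classical
    have hex : ∃ j, j ≤ n ∧ m - 1 ≤ v (n - j) := ⟨n, le_rfl, by rw [Nat.sub_self, hv0]; omega⟩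
    refine ⟨n - Nat.find hex, Nat.sub_le _ _, (Nat.find_spec hex).2, fun y h1 h2 => ?_⟩
    by_contra hc
    exact Nat.find_min hex (m := n - y) (by omega) ⟨by omega, by
      rw [show n - (n - y) = y by omega]; omega⟩
  have hT := ((hG (m - 1) (by omega) (by omega)).link p (n + 1) (by omega) le_rfl hpv (by omega)
    hpl).2.2
  rw [run, f2] at hT
  set e := fun y => f (v y)
  -- up to this separator, the sequence ends at a multiple of the greatest unit
  have hdvd : 2 ^ (E + 1) ∣ gr 0 (seg e 1 (p + 1)) := by
    rcases Nat.eq_zero_or_pos p with rfl | hp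
    · simp
    · have hpe : e p = E + 1 := by
        rw [← f1]
        have := hvm p hp (by omega)
        show f (v p) = f (m - 1)
        congr 1
        omega
      rw [← seg_append e hp (Nat.le_succ p), seg_succ, hpe]
      exact dvd_gr_append_singleton _ _ _
  obtain ⟨A, hA'⟩ := hdvd
  have hcnt : cnt E (seg e 1 (n + 1)) = 2 * A + M (5, m - 1, 0, 0, n + 1) := by
    rw [hT, ← seg_append e (b := p + 1) (by omega) (by omega), cnt_append_of_dvd, cnt, hA',
      show 2 ^ (E + 1) * A = (2 * A) * 2 ^ E by ring, cd_mul (by positivity)]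
    · intro z hz
      obtain ⟨y, h1, h2, rfl⟩ := mem_seg.1 hz
      rw [← f2]
      exact hmono (by have := hpl y (by omega) h2; omega)
    · rw [hA', pow_succ, mul_assoc]; exact dvd_mul_right _ _
  have hcnt' : cd (cnt E (seg e 1 (n + 1))) 2 = M (5, m, 0, 0, n + 1) := by
    have := cnt_cnt (Nat.le_succ E) (seg e 1 (n + 1))
    rw [hA, ← this, show E.succ - E = 1 by omega, pow_one]
  have hlen : M (5, m, 0, 0, n + 1) ≤ n := by
    rw [hA]
    refine (cnt_le_length fun z hz => ?_).trans (by simp [seg])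
    obtain ⟨y, h1, h2, rfl⟩ := mem_seg.1 hz
    rw [← f1]
    exact hmono (by have := hvm y (by omega) h2; omega)
  have hNe : N = cnt E (seg e 1 (n + 1)) := by
    rw [cd] at hcnt'
    omega
  refine ⟨by omega, by omega, hlen, ?_⟩
  have hei : ∀ i : Fin n, (e (i + 1) : ℤ) = u i - bitOf H i - (mn - 1) := fun i => by
    show ((f (v (i + 1)) : ℕ) : ℤ) = _
    rw [hlev i, hd _ (hmem i)]
    have := hge i i.2
    have : bitOf H i ≤ 1 := by rw [bitOf]; split_ifs <;> omega
    omega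
  have key := isMinimaxCost_of_gr h.hn (mn - 1) (fun i : Fin n => e (i + 1))
    (fun i => (u i : ℝ) - (bitOf H i : ℝ)) (fun i => by rw [hei]; push_cast; ring)
    (E + Nat.clog 2 N) ?_ ?_
  · convert key using 1
    have : (E : ℝ) = mx - mn := by exact_mod_cast hE
    push_cast
    rw [this]
    ring
  · rw [← seg_eq_ofFn e, pow_add, mul_comm]
    refine (le_cd_mul (b := 2 ^ E) (by positivity)).trans (Nat.mul_le_mul_right _ ?_)
    rw [← cnt, ← hNe]
    exact Nat.le_pow_clog (by norm_num) _
  · intro m' hm'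
    rw [← seg_eq_ofFn e] at hm'
    have hE' : E ≤ m' := by
      have h1 : e (i₀ + 1) ∈ seg e 1 (n + 1) := mem_seg.2 ⟨_, by omega, by omega, rfl⟩
      have h2 := pow_le_gr (s := 0) h1
      have h3 := hei ⟨i₀, hi₀⟩
      simp only [hu₀] at h3
      have : bitOf H ⟨i₀, hi₀⟩ ≤ 1 := by rw [bitOf]; split_ifs <;> omega
      refine le_trans (b := e (i₀ + 1)) (by omega) ?_
      exact (Nat.pow_le_pow_iff_right (a := 2) (by norm_num)).1 (by omega)
    obtain ⟨j, rfl⟩ := Nat.exists_eq_add_of_le hE'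
    refine Nat.add_le_add_left (Nat.clog_le_of_le_pow ?_) _
    rw [hNe, cnt, cd_le_iff (by positivity), ← pow_add, add_comm j E]
    exact hm'

end Lev

/-! ### The operations -/

/-- Put a set operation on the stack, and lower the item, unless its bit has been set before. -/
def pushP : Cmd :=
  block [.nstore 4 (var 7) (var 1), .nstore 5 (var 7) (var 6), .nstore 11 (var 7) (arr 0 (var 1)),
    .nset 7 (var 7 + lit 1),
    .ite (.neq (arr 0 (var 1)) (lit 0))
      (block [.nstore 0 (var 1) (lit 1), .nset 10 (var 1 + lit 1), .nset 11 (arr 8 (var 1)),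
        .nset 12 (arr 8 (var 1)), lowerP]) .skip]

/-- Take a set operation from the stack, and undo the writes logged since it was put there. -/
def popP : Cmd :=
  .ite (.nle (lit 1) (var 7))
    (block [.nset 7 (var 7 - lit 1), .nstore 0 (arr 4 (var 7)) (arr 11 (var 7)),
      .nset 8 (arr 5 (var 7)),
      .loop (.not (.nle (var 6) (var 8)))
        (block [.nset 6 (var 6 - lit 1), .nstore 1 (arr 2 (var 6)) (arr 3 (var 6))])])
    .skip

/-- Compute the cost from the counts at the end of the two highest levels. -/
def answerP : Cmd :=
  block [.nset 9 (var 0 + lit 1), .nset 10 (var 5 - lit 1),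
    ld 8 (lit 5) (var 5) (lit 0) (lit 0) (var 9), ld 9 (lit 5) (var 10) (lit 0) (lit 0) (var 9),
    .nset 8 (var 8 + var 8 - (var 9 - var 9 / lit 2 * lit 2)),
    .rset 0 (.var 1 - .ofWord (lit 1) + .ofWord (arr 7 (var 8)))]

/-- The memory array `mem` holds right cells for the set operations `H`. -/
def MemOK (K : ℕ) {n : ℕ} (u : ℕ → ℤ) (mx mn : ℤ) (H : List (Fin n)) (mem : ℕ → ℕ) : Prop :=
  ∃ M : Mem, (∀ c, InR (2 * bsz K) c → mem (enc (2 * bsz K) c) = M c) ∧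
    (∀ a, mem a ≤ 2 * bsz K) ∧
    Good (thrDist (thr n u mx) (mn - 1)) n K (numThr n u mx) (lev u mx H) M

/-- With the arrays `na` (log and stack) and a log of length `lp`, the memory array `mem` is right
for the set operations `H`, and each rollback to a position on the stack makes it right for the
rest of `H`. A set operation causes at most `L` writes. -/
def Chain (K : ℕ) {n : ℕ} (u : ℕ → ℤ) (mx mn : ℤ) (L : ℕ) (na : ℕ → ℕ → ℕ) :
    List (Fin n) → ℕ → (ℕ → ℕ) → Prop
  | [], _, mem => MemOK K u mx mn ([] : List (Fin n)) mem
  | i :: H, lp, mem => MemOK K u mx mn (i :: H) mem ∧ na 4 H.length = i ∧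
      na 11 H.length = bitOf H i ∧ na 5 H.length ≤ lp ∧ lp ≤ na 5 H.length + L ∧
      Chain K u mx mn L na H (na 5 H.length)
        (rollback (na 2) (na 3) (lp - na 5 H.length) (na 5 H.length) mem)

/-- The constant part of the memory: tables and numbers. -/
structure Static (B K : ℕ) {n : ℕ} (w : Fin n → ℝ) (mx mn : ℤ) (σ : RamState) : Prop extends
    LowerEnv B K n (numThr n (ceilAt w) mx) (thrDist (thr n (ceilAt w) mx) (mn - 1)) σ where
  nv0 : σ.nv 0 = n
  nv2 : σ.nv 2 = 1
  clog : ∀ N ≤ 2 * n, σ.na 7 N = Nat.clog 2 N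
  ix : ∀ i < n, σ.na 8 i = idx (thr n (ceilAt w) mx) (ceilAt w i)
  rv1 : σ.rv 1 = mx
  wts : ∀ i : Fin n, σ.ra 0 i = w i

/-- The memory between operations, when at most `q` operations have been performed, of which the
set operations `H` are in force. -/
structure Ready (B K : ℕ) {n : ℕ} (w : Fin n → ℝ) (mx mn : ℤ) (q : ℕ) (H : List (Fin n))
    (σ : RamState) : Prop extends Static B K w mx mn σ where
  bits : ∀ i : Fin n, σ.na 0 i = bitOf H i
  sp : σ.nv 7 = H.length
  lp : σ.nv 6 ≤ q * (numThr n (ceilAt w) mx * (K + 3))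
  len : H.length ≤ q
  log : ∀ j < σ.nv 6, σ.na 2 j ≤ B ∧ σ.na 3 j ≤ B
  chain : Chain K (ceilAt w) mx mn (numThr n (ceilAt w) mx * (K + 3)) σ.na H (σ.nv 6) (σ.na 1)

section Ops
variable {B K n q L lp : ℕ} {u : ℕ → ℤ} {w : Fin n → ℝ} {mx mn : ℤ} {H : List (Fin n)}
  {σ σ' : RamState} {mem : ℕ → ℕ}

theorem MemOK.congr {H' : List (Fin n)} (h : MemOK K u mx mn H mem)
    (hl : lev u mx H' = lev u mx H) : MemOK K u mx mn H' mem := by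
  obtain ⟨M, h1, h2, h3⟩ := h
  exact ⟨M, h1, h2, hl ▸ h3⟩

theorem Chain.memOK {na : ℕ → ℕ → ℕ} (h : Chain K u mx mn L na H lp mem) :
    MemOK K u mx mn H mem := by
  cases H with
  | nil => exact h
  | cons i H => exact h.1

theorem Chain.congr {na na' : ℕ → ℕ → ℕ} (h : Chain K u mx mn L na H lp mem)
    (hlog : ∀ j < lp, na 2 j = na' 2 j ∧ na 3 j = na' 3 j)
    (hst : ∀ j < H.length, na 4 j = na' 4 j ∧ na 5 j = na' 5 j ∧ na 11 j = na' 11 j) :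
    Chain K u mx mn L na' H lp mem := by
  induction H generalizing lp mem with
  | nil => exact h
  | cons i H ih =>
    obtain ⟨h1, h2, h3, h4, h5, h6⟩ := h
    obtain ⟨s4, s5, s11⟩ := hst H.length (by simp)
    rw [Chain, ← s4, ← s5, ← s11]
    refine ⟨h1, h2, h3, h4, h5, ?_⟩
    rw [rollback_congr (la' := na 2) (lv' := na 3) mem fun j h7 h8 => ?_]
    · exact ih h6 (fun j hj => hlog j (by omega)) fun j hj => hst j (by simp; omega)
    · have := hlog j (by omega)
      exact ⟨this.1.symm, this.2.symm⟩

theorem Static.congr (h : Static B K w mx mn σ)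
    (hnv : ∀ v, v = 0 ∨ v = 2 ∨ v = 3 ∨ v = 4 ∨ v = 5 → σ'.nv v = σ.nv v)
    (hna : ∀ a, a = 6 ∨ a = 7 ∨ a = 8 ∨ a = 9 → σ'.na a = σ.na a) (hrv : σ'.rv 1 = σ.rv 1)
    (hra : σ'.ra 0 = σ.ra 0) : Static B K w mx mn σ' where
  hB := h.hB
  hK := h.hK
  nv3 := (hnv 3 (by simp)).trans h.nv3
  nv4 := (hnv 4 (by simp)).trans h.nv4
  tab := by rw [hna 6 (by simp)]; exact h.tab
  hn := h.hn
  hm := h.hm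
  nv5 := (hnv 5 (by simp)).trans h.nv5
  mono := h.mono
  pos := by rw [hna 9 (by simp)]; exact h.pos
  le := by rw [hna 9 (by simp)]; exact h.le
  step := by rw [hna 9 (by simp)]; exact h.step
  nv0 := (hnv 0 (by simp)).trans h.nv0
  nv2 := (hnv 2 (by simp)).trans h.nv2
  clog := by rw [hna 7 (by simp)]; exact h.clog
  ix := by rw [hna 8 (by simp)]; exact h.ix
  rv1 := hrv.trans h.rv1
  wts := by rw [hra]; exact h.wts

theorem Sim.refl {M : Mem} (h1 : ∀ c, InR (2 * bsz K) c → σ.na 1 (enc (2 * bsz K) c) = M c)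
    (h2 : ∀ a, σ.na 1 a ≤ 2 * bsz K) : Sim B K σ 0 M σ :=
  ⟨fun _ _ _ => rfl, fun _ _ _ _ _ => rfl, rfl, rfl, h1, h2, le_rfl, le_rfl, fun _ _ => ⟨rfl, rfl⟩,
    fun _ h1 h2 => absurd h2 (by omega), by rw [Nat.sub_self, rollback]⟩

theorem bitOf_le (i : Fin n) : bitOf H i ≤ 1 := by rw [bitOf]; split_ifs <;> omega

theorem run_pushP (hF : Fit B K n (ceilAt w) mx mn) (h : Ready B K w mx mn q H σ) (i : Fin n)
    (h1 : σ.nv 1 = i) (hq : (q + 1) * (numThr n (ceilAt w) mx * (K + 3)) ≤ B) (hqB : q + 1 ≤ B) :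
    Run B pushP σ fun t σ' => t ≤ numThr n (ceilAt w) mx * (150 * K + 400) + 100 ∧
      Ready B K w mx mn (q + 1) (i :: H) σ' := by
  have hBW := hF.base_le
  have hm2 := numThr_le (n := n) (u := ceilAt w) (mx := mx)
  have hn := hF.hnK
  have hi := i.2
  have hb := h.bits i
  have hb1 := bitOf_le (H := H) i
  have hlen := h.len
  have hlp := h.lp
  have hsp := h.sp
  have hix := h.ix i hi
  have hilt := hF.idx_lt hi
  rw [Nat.succ_mul] at hq
  have hst := h.toStatic
  obtain ⟨M, hM1, hM2, hM3⟩ := h.chain.memOK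
  simp [pushP, h1, hsp, hb]
  and_intros <;> try omega
  · intro h0
    have hiH : i ∉ H := fun hc => by rw [bitOf, if_pos hc] at h0; omega
    have hpos : 0 < idx (thr n (ceilAt w) mx) (ceilAt w i) := by rw [idx_sub_one hi]; omega
    simp only [hix, h0]
    and_intros <;> try omega
    generalize hσ : (((((((σ.setNA 4 H.length ↑i).setNA 5 H.length (σ.nv 6)).setNA 11 H.length 0).setNV 7
      (H.length + 1)).setNA 0 (↑i) 1).setNV 10 (↑i + 1)).setNV 11
      (idx (thr n (ceilAt w) mx) (ceilAt w ↑i))).setNV 12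
      (idx (thr n (ceilAt w) mx) (ceilAt w ↑i)) = σ₁
    have hnv : ∀ v < 7, σ₁.nv v = σ.nv v := fun v hv => by
      rw [← hσ]
      simp [show v ≠ 7 by omega, show v ≠ 10 by omega, show v ≠ 11 by omega, show v ≠ 12 by omega]
    have hna : ∀ a, a ≠ 0 → a ≠ 4 → a ≠ 5 → a ≠ 11 → σ₁.na a = σ.na a := fun a a1 a2 a3 a4 => by
      rw [← hσ]; simp [a1, a2, a3, a4]
    have hst₁ : Static B K w mx mn σ₁ := hst.congr (fun v hv => hnv v (by omega))
      (fun a ha => hna a (by omega) (by omega) (by omega) (by omega)) (by rw [← hσ]; simp)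
      (by rw [← hσ]; simp)
    have hna1 := hna 1 (by norm_num) (by norm_num) (by norm_num) (by norm_num)
    have hlev := lev_item (u := ceilAt w) (mx := mx) (H := H) i
    rw [h0, Nat.sub_zero] at hlev
    refine run_lowerP hst₁.toLowerEnv (M := M) (Sim.refl (by rw [hna1]; exact hM1) (by rw [hna1]; exact hM2)) hM3
      lev_zero.ge lev_last.ge (x := i + 1) (r₀ := idx (thr n (ceilAt w) mx) (ceilAt w i) - 1)
      (by omega) (by omega) (by rw [hlev]; exact hilt.le) (by rw [hlev]; omega)
      (by rw [← hσ]; simp) (by rw [← hσ]; simp; omega) (by rw [← hσ, hlev]; simp)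
      (by rw [hnv 6 (by norm_num)]; omega) ?_
    intro t σ₂ M' ht hS hG _
    rw [zero_add] at hS
    have hlp0 := hS.lp0
    have hlp1 := hS.lp
    have hback := hS.back
    rw [hnv 6 (by norm_num)] at hlp0 hlp1 hback
    have hna₂ : ∀ a, a = 0 ∨ a = 4 ∨ a = 5 ∨ a = 11 → σ₂.na a = σ₁.na a := fun a ha =>
      hS.na a (by omega) (by omega) (by omega) (by omega)
    have hst₂ : Static B K w mx mn σ₂ := hst₁.congr (fun v hv => hS.nv v (by omega) (by omega))
      (fun a ha => hS.na a (by omega) (by omega) (by omega) (by omega)) (by rw [hS.rv])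
      (by rw [hS.ra])
    refine ⟨by omega, ⟨hst₂, fun j => ?_, ?_, ?_, ?_, fun j hj => ?_, ?_⟩⟩
    · rw [hna₂ 0 (by simp), ← hσ, bitOf_cons]
      simp [Function.update_apply, h.bits, Fin.ext_iff]
    · rw [hS.nv 7 (by norm_num) (by norm_num), ← hσ]; simp
    · rw [Nat.succ_mul]; omega
    · simp; omega
    · rcases Nat.lt_or_ge j (σ.nv 6) with hj' | hj'
      · have := hS.old j (by rw [hnv 6 (by norm_num)]; exact hj')
        rw [this.1, this.2, hna 2 (by norm_num) (by norm_num) (by norm_num) (by norm_num),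
          hna 3 (by norm_num) (by norm_num) (by norm_num) (by norm_num)]
        exact h.log j hj'
      · exact hS.log j (by rw [hnv 6 (by norm_num)]; exact hj') hj
    · have e5 : σ₂.na 5 H.length = σ.nv 6 := by rw [hna₂ 5 (by simp), ← hσ]; simp
      refine ⟨⟨M', hS.rep, hS.bd, ?_⟩, ?_, ?_, ?_, ?_, ?_⟩
      · rw [lev_cons_of_notMem]; exact hG
      · rw [hna₂ 4 (by simp), ← hσ]; simp
      · rw [hna₂ 11 (by simp), ← hσ]; simp [h0]
      · rw [e5]; exact hlp0
      · rw [e5]; exact hlp1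
      · rw [e5, hback, hna1]
        refine h.chain.congr (fun j hj => ?_) fun j hj => ?_
        · have := hS.old j (by rw [hnv 6 (by norm_num)]; exact hj)
          rw [this.1, this.2, hna 2 (by norm_num) (by norm_num) (by norm_num) (by norm_num),
            hna 3 (by norm_num) (by norm_num) (by norm_num) (by norm_num)]
          exact ⟨rfl, rfl⟩
        · rw [hna₂ 4 (by simp), hna₂ 5 (by simp), hna₂ 11 (by simp), ← hσ]
          simp [Function.update_of_ne hj.ne]
  · intro h0
    have hiH : i ∈ H := by by_contra hc; rw [bitOf, if_neg hc] at h0; omega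
    refine ⟨hst.congr (fun v hv => ?_) (fun a ha => ?_) (by simp) (by simp),
      fun j => ?_, by simp, ?_, by simp; omega, ?_, ?_⟩
    · simp [show v ≠ 7 by omega]
    · simp [show a ≠ 4 by omega, show a ≠ 5 by omega, show a ≠ 11 by omega]
    · rw [bitOf_cons]
      simp only [na_setNV, na_setNA, OfNat.zero_ne_ofNat, if_false, h.bits]
      split_ifs with hj
      · rw [hj, bitOf, if_pos hiH]
      · rfl
    · rw [Nat.succ_mul]; simp; omega
    · simpa using h.log
    · simp only [nv_setNV, na_setNV, na_setNA, Nat.reduceEqDiff, if_false]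
      refine ⟨h.chain.memOK.congr (lev_cons_of_mem hiH), by simp, by simp, by simp, by simp, ?_⟩
      simp only [nv_setNA, na_setNA, Nat.reduceEqDiff, if_false, if_true, Function.update_self,
        Nat.sub_self, rollback]
      refine h.chain.congr (fun j hj => by simp) fun j hj => ?_
      simp [Function.update_of_ne hj.ne]

theorem run_popP (h : Ready B K w mx mn q H σ) (hqB : q + 1 ≤ B)
    (hq : (q + 1) * (numThr n (ceilAt w) mx * (K + 3)) ≤ B) (hnB : n + 1 ≤ B) :
    Run B popP σ fun t σ' => t ≤ 20 * (numThr n (ceilAt w) mx * (K + 3)) + 100 ∧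
      Ready B K w mx mn (q + 1) H.tail σ' := by
  have hlen := h.len
  have hlp := h.lp
  have hsp := h.sp
  rw [Nat.succ_mul] at hq
  cases H with
  | nil =>
    simp at hsp
    simp [popP, hsp]
    refine ⟨by omega, { h with lp := ?_, len := by simp }⟩
    rw [Nat.succ_mul]; omega
  | cons i H =>
    have hst := h.toStatic
    have hch := h.chain
    obtain ⟨c1, c2, c3, c4, c5, c6⟩ := hch
    have hb1 := bitOf_le (H := H) i
    have hi := i.2
    simp at hsp hlen
    obtain ⟨b, hb⟩ : ∃ b, b = σ.na 5 H.length := ⟨_, rfl⟩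
    rw [← hb] at c4 c5 c6
    simp [popP, hsp, c2, c3, ← hb]
    and_intros <;> try omega
    refine (run_loop (c := 15) (fun j σ' => (∀ v, v ≠ 6 → σ'.nv v =
        ((σ.setNV 7 H.length).setNV 8 b).nv v) ∧ σ'.nv 6 = σ.nv 6 - j ∧
      (∀ a, a ≠ 1 → σ'.na a = (σ.setNA 0 i (bitOf H i)).na a) ∧ σ'.rv = σ.rv ∧ σ'.ra = σ.ra ∧
      rollback (σ.na 2) (σ.na 3) (σ.nv 6 - j - b) b (σ'.na 1) =
        rollback (σ.na 2) (σ.na 3) (σ.nv 6 - b) b (σ.na 1)) (σ.nv 6 - b) ?_ ?_ ?_).mono ?_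
    · rintro j hj σ₁ ⟨i1, i2, i3, i4, i5, i6⟩
      have h8 : σ₁.nv 8 = b := by rw [i1 8 (by norm_num)]; simp
      have h2 : σ₁.na 2 = σ.na 2 := by rw [i3 2 (by norm_num)]; simp
      have h3 : σ₁.na 3 = σ.na 3 := by rw [i3 3 (by norm_num)]; simp
      have hlog := h.log (σ.nv 6 - j - 1) (by omega)
      refine ⟨by simp [i2, h8]; omega, by simp [i2, h8]; omega, ?_⟩
      simp [i2, h2, h3]
      refine ⟨by omega, by omega, by omega, fun v hv => ?_, by omega, fun a ha => ?_, i4, i5, ?_⟩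
      · simpa [hv] using i1 v hv
      · simpa [ha] using i3 a ha
      · rw [show σ.nv 6 - j - b = (σ.nv 6 - (j + 1) - b) + 1 by omega, rollback,
          show b + (σ.nv 6 - (j + 1) - b) = σ.nv 6 - j - 1 by omega] at i6
        exact i6
    · rintro σ₁ ⟨i1, i2, -⟩
      have h8 : σ₁.nv 8 = b := by rw [i1 8 (by norm_num)]; simp
      refine ⟨by simp [i2, h8]; omega, by simp [i2, h8]; omega⟩
    · refine ⟨fun v hv => by simp, by simp, fun a ha => by simp, rfl, rfl, by simp⟩
    · rintro t σ₁ ⟨ht, i1, i2, i3, i4, i5, i6⟩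
      have e6 : σ₁.nv 6 = b := by omega
      rw [show σ.nv 6 - (σ.nv 6 - b) - b = 0 by omega, rollback] at i6
      simp at ht
      have hst₁ : Static B K w mx mn σ₁ := by
        refine hst.congr (fun v hv => ?_) (fun a ha => ?_) (by rw [i4]) (by rw [i5])
        · rw [i1 v (by omega)]
          simp [show v ≠ 7 by omega, show v ≠ 8 by omega]
        · rw [i3 a (by omega)]
          simp [show a ≠ 0 by omega]
      refine ⟨by omega, ⟨hst₁, fun j => ?_, ?_, ?_, by omega, fun j hj => ?_, ?_⟩⟩
      · rw [i3 0 (by norm_num)]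
        have := h.bits j
        rw [bitOf_cons] at this
        simp only [na_setNA, if_true, Function.update_apply, this, Fin.ext_iff]
        split_ifs with hj
        · rw [Fin.ext hj]
        · rfl
      · rw [i1 7 (by norm_num)]; simp
      · rw [Nat.succ_mul]; omega
      · rw [i3 2 (by norm_num), i3 3 (by norm_num)]
        simpa using h.log j (by omega)
      · rw [e6, i6]
        refine c6.congr (fun j hj => ?_) fun j hj => ?_
        · rw [i3 2 (by norm_num), i3 3 (by norm_num)]; simp
        · rw [i3 4 (by norm_num), i3 5 (by norm_num), i3 11 (by norm_num)]; simp

theorem Ready.weaken {q' : ℕ} (hq : q ≤ q') (h : Ready B K w mx mn q H σ) :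
    Ready B K w mx mn q' H σ :=
  { h with
    lp := h.lp.trans (Nat.mul_le_mul_right _ hq)
    len := h.len.trans hq }

theorem run_answerP (hF : Fit B K n (ceilAt w) mx mn) (h : Ready B K w mx mn q H σ) :
    Run B answerP σ fun t σ' => t ≤ 100 ∧ Ready B K w mx mn q H σ' ∧
      IsMinimaxCost (fun i : Fin n => (ceilAt w i : ℝ) - (bitOf H i : ℝ)) (σ'.rv 0) := by
  obtain ⟨M, hM1, hM2, hM3⟩ := h.chain.memOK
  obtain ⟨hm2, hN, hlen, hcost⟩ := cost_eq hF hM3 rfl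
  have hS : Sim B K σ 0 M σ := Sim.refl hM1 hM2
  have hE := h.toEnv
  have hBW := hE.mul_le
  have hn := hF.hnK
  have hm := h.hm
  have hm2' := numThr_le (n := n) (u := ceilAt w) (mx := mx)
  have hclog := h.clog
  have hcl := clog_le_self (2 * M (5, numThr n (ceilAt w) mx, 0, 0, n + 1) -
    M (5, numThr n (ceilAt w) mx - 1, 0, 0, n + 1) % 2)
  have h0 := h.nv0
  have h5 := h.nv5
  have h1 := h.rv1
  have hst := h.toStatic
  have hK := hE.four_le
  have hin : ∀ r, r ≤ numThr n (ceilAt w) mx → InR (2 * bsz K) (5, r, 0, 0, n + 1) := fun r hr => by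
    refine ⟨?_, ?_, ?_, ?_, ?_⟩ <;> dsimp only <;> omega
  simp [answerP, h0, h5]
  refine ⟨by omega, by omega, ?_⟩
  refine run_ld hE ((hS.setNV (by norm_num)).setNV (by norm_num)) (by simp) (by simp [h5])
    (hin _ le_rfl) fun b1 => ?_
  refine run_ld hE (((hS.setNV (by norm_num)).setNV (by norm_num)).setNV (by norm_num)) (by simp)
    (by simp) (hin (numThr n (ceilAt w) mx - 1) (by omega)) fun b2 => ?_
  generalize M (5, numThr n (ceilAt w) mx, 0, 0, n + 1) = a at *
  generalize M (5, numThr n (ceilAt w) mx - 1, 0, 0, n + 1) = b at *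
  have hab : a + a - (b - b / 2 * 2) = 2 * a - b % 2 := by omega
  simp [hab, h1]
  rw [hclog _ hN]
  refine ⟨by omega, by omega, ⟨hst.congr (fun v hv => ?_) (fun a ha => by simp) (by simp) (by simp),
    by simpa using h.bits, by simpa using h.sp, by simpa using h.lp, h.len, by simpa using h.log,
    by simpa using h.chain⟩, hcost⟩
  simp [show v ≠ 8 by omega, show v ≠ 9 by omega, show v ≠ 10 by omega]

end Ops

/-! ### The data structure -/

/-- Before the first operation, initialize the levels. -/
def prepP : Cmd := .ite (.neq (var 2) (lit 0)) initP .skip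

/-- The data structure. The levels take more than linear time to initialize; this is done by the
first operation. -/
def minimaxDS : DataStructure :=
  ⟨buildP, .seq prepP pushP, .seq prepP popP, .seq prepP answerP⟩

/-- The memory between the end of the building program and the first operation. -/
structure Fresh (K : ℕ) {n : ℕ} (w : Fin n → ℝ) (mx mn : ℤ) (σ : RamState) : Prop where
  nv0 : σ.nv 0 = n
  nv2 : σ.nv 2 = 0
  nv3 : σ.nv 3 = K
  nv4 : σ.nv 4 = 2 * bsz K
  nv6 : σ.nv 6 = 0
  nv7 : σ.nv 7 = 0
  tab : ∀ k ≤ K, σ.na 6 k = bsz k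
  clog : ∀ N ≤ 2 * n, σ.na 7 N = Nat.clog 2 N
  zero : ∀ a, a ≠ 6 → a ≠ 7 → ∀ i, σ.na a i = 0
  wts : ∀ i : Fin n, σ.ra 0 i = w i
  ceil : ∀ i < n, σ.ra 1 i = ceilAt w i
  rv1 : σ.rv 1 = mx
  rv2 : σ.rv 2 = mn

/-- The memory in which the program of an operation starts: the argument is in register `1`. -/
def withArg {n : ℕ} (σ : RamState) : Op n → RamState
  | .setBit i => σ.setNV 1 i
  | .undo => σ
  | .cost => σ

section Serve
variable {B K n q Q : ℕ} {w : Fin n → ℝ} {mx mn : ℤ} {H : List (Fin n)} {σ : RamState}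

theorem run_buildP (hn : 1 ≤ n) (hB : 2 * (n + 1) ^ 2 ≤ B) :
    Run B buildP (inputState w) fun t σ => t ≤ 300 * n ∧ ∃ K mx mn,
      1 ≤ K ∧ n + 1 < bsz K ∧ bsz (K - 1) ≤ n + 1 ∧ Fresh K w mx mn σ ∧
      (∀ i < n, ceilAt w i ≤ mx) ∧ (∃ i < n, ceilAt w i = mx) ∧
      (∀ i < n, mn ≤ ceilAt w i) ∧ (∃ i < n, ceilAt w i = mn) := by
  have hB' : 4 * n + 4 ≤ B := by nlinarith
  simp only [buildP, run_block_cons, run_block_nil]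
  refine run_rankP hn hB (by simp [inputState]) (by simp [inputState]) ?_
  intro t₁ σ₁ K ht₁ hK1 hK2 hK3 a1 a2 a3 a4 a5 a6 a7
  have hnv₁ : ∀ v, v ≠ 0 → v ≠ 3 → v ≠ 4 → σ₁.nv v = 0 := fun v h0 h3 h4 => by
    rw [a1 v h3 h4]; simp [inputState, h0]
  have h0₁ : σ₁.nv 0 = n := by rw [a1 0 (by norm_num) (by norm_num)]; simp [inputState]
  have hna₁ : ∀ a, a ≠ 6 → ∀ i, σ₁.na a i = 0 := fun a ha i => by
    rw [a4 a ha]; simp [inputState]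
  refine run_clogP hn hB' h0₁ (hna₁ 7 (by norm_num)) ?_
  intro t₂ σ₂ ht₂ b1 b2 b3 b4 b5
  have hw₂ : ∀ i : Fin n, σ₂.ra 0 i = w i := fun i => by
    rw [b5, a7]; simp [inputState]
  refine run_ceilP hn (by omega) ((b1 0 (by norm_num)).trans h0₁) hw₂ ?_
  intro t₃ σ₃ mx mn ht₃ c1 c2 c3 c4 c5 c6 c7 c8 c9 c10
  have hnv : ∀ v, v ≠ 8 → σ₃.nv v = σ₁.nv v := fun v hv => (c1 v hv).trans (b1 v hv)
  refine ⟨by omega, K, mx, mn, hK1, hK2, hK3, ?_, c7, c8, c9, c10⟩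
  exact
    { nv0 := (hnv 0 (by norm_num)).trans h0₁
      nv2 := (hnv 2 (by norm_num)).trans (hnv₁ 2 (by norm_num) (by norm_num) (by norm_num))
      nv3 := (hnv 3 (by norm_num)).trans a2
      nv4 := (hnv 4 (by norm_num)).trans a3
      nv6 := (hnv 6 (by norm_num)).trans (hnv₁ 6 (by norm_num) (by norm_num) (by norm_num))
      nv7 := (hnv 7 (by norm_num)).trans (hnv₁ 7 (by norm_num) (by norm_num) (by norm_num))
      tab := by rw [c2, b2 6 (by norm_num)]; exact a5
      clog := by rw [c2]; exact b3
      zero := fun a h6 h7 i => by rw [c2, b2 a h7]; exact hna₁ a h6 i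
      wts := fun i => by rw [c3]; exact hw₂ i
      ceil := c4
      rv1 := c5
      rv2 := c6 }

theorem Fresh.withArg (h : Fresh K w mx mn σ) (o : Op n) : Fresh K w mx mn (withArg σ o) := by
  cases o with
  | setBit i =>
    exact { h with
      nv0 := by simpa [_root_.withArg] using h.nv0
      nv2 := by simpa [_root_.withArg] using h.nv2
      nv3 := by simpa [_root_.withArg] using h.nv3
      nv4 := by simpa [_root_.withArg] using h.nv4
      nv6 := by simpa [_root_.withArg] using h.nv6
      nv7 := by simpa [_root_.withArg] using h.nv7 }
  | undo => exact h
  | cost => exact h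

theorem Ready.withArg (h : Ready B K w mx mn q H σ) (o : Op n) :
    Ready B K w mx mn q H (withArg σ o) := by
  cases o with
  | setBit i =>
    refine ⟨h.toStatic.congr (fun v hv => ?_) (fun a _ => rfl) rfl rfl, h.bits, ?_, ?_, h.len, ?_, ?_⟩
    · simp [_root_.withArg, show v ≠ 1 by omega]
    · simpa [_root_.withArg] using h.sp
    · simpa [_root_.withArg] using h.lp
    · simpa [_root_.withArg] using h.log
    · simpa [_root_.withArg] using h.chain
  | undo => exact h
  | cost => exact h

theorem run_prepP_fresh (hF : Fit B K n (ceilAt w) mx mn) (h : Fresh K w mx mn σ) :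
    Run B prepP σ fun t σ' => t ≤ n * numThr n (ceilAt w) mx * (150 * K + 800) + 10 ∧
      Ready B K w mx mn 0 [] σ' ∧ σ'.nv 1 = σ.nv 1 := by
  simp only [prepP, run_ite, BExp.Fits, BExp.Holds, fits_var, fits_lit, eval_var, eval_lit, h.nv2]
  refine ⟨by simp, fun _ => ?_, fun hc => absurd trivial hc⟩
  refine run_initP hF h.nv0 h.nv3 h.nv4 h.nv6 h.tab (h.zero 1 (by norm_num) (by norm_num)) h.ceil
    h.rv1 h.rv2 ?_
  intro t σ' M ht hL hnv hnv2 hna hix hra hrv hM1 hM2 hM3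
  have hst : Static B K w mx mn σ' :=
    { hL with
      nv0 := (hnv 0 (by norm_num) (by norm_num) (by norm_num)).trans h.nv0
      nv2 := hnv2
      clog := by rw [hna 7 (by simp)]; exact h.clog
      ix := hix
      rv1 := hrv.trans h.rv1
      wts := by rw [hra]; exact h.wts }
  have h6 : σ'.nv 6 = 0 := (hnv 6 (by norm_num) (by norm_num) (by norm_num)).trans h.nv6
  refine ⟨by simp; omega, ⟨hst, fun i => ?_, ?_, ?_, by simp, fun j hj => ?_, ?_⟩,
    hnv 1 (by norm_num) (by norm_num) (by norm_num)⟩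
  · rw [hna 0 (by simp), h.zero 0 (by norm_num) (by norm_num)]; simp [bitOf]
  · rw [hnv 7 (by norm_num) (by norm_num) (by norm_num), h.nv7]; rfl
  · rw [h6]; exact Nat.zero_le _
  · omega
  · exact ⟨M, hM1, hM2, by rw [lev_nil]; exact hM3⟩

theorem run_prepP_ready (hB : 1 ≤ B) (h : Ready B K w mx mn q H σ) :
    Run B prepP σ fun t σ' => t ≤ 10 ∧ Ready B K w mx mn q H σ' ∧ σ'.nv 1 = σ.nv 1 := by
  simp only [prepP, run_ite, BExp.Fits, BExp.Holds, fits_var, fits_lit, eval_var, eval_lit, h.nv2]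
  refine ⟨by simpa, fun hc => absurd hc (by norm_num), fun _ => ?_⟩
  rw [run_skip]
  exact ⟨by simp, h, rfl⟩

/-- Execution of an operation, given that of the preparation. -/
theorem exists_execOp {τ : ℕ} (hF : Fit B K n (ceilAt w) mx mn) (o : Op n)
    (hq : (q + 1) * (numThr n (ceilAt w) mx * (K + 3)) ≤ B) (hqB : q + 1 ≤ B)
    (hp : Run B prepP (withArg σ o) fun t σ' => t ≤ τ ∧ Ready B K w mx mn q H σ' ∧
      σ'.nv 1 = (withArg σ o).nv 1) :
    ∃ t σ', ExecOp B minimaxDS o σ t σ' ∧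
      t ≤ τ + (numThr n (ceilAt w) mx * (150 * K + 400) + 100) ∧
      Ready B K w mx mn (q + 1) (o.apply H) σ' ∧ AnswerOK w H o σ' := by
  obtain ⟨t₁, σ₁, he₁, ht₁, hR, hnv⟩ := hp
  have hnB : n + 1 ≤ B := by have := hF.hnK; have := hF.base_le; omega
  cases o with
  | setBit i =>
    obtain ⟨t₂, σ₂, he₂, ht₂, hR₂⟩ := run_pushP hF hR i (by rw [hnv]; simp [withArg]) hq hqB
    exact ⟨t₁ + t₂, σ₂, .seq _ _ _ _ _ _ _ he₁ he₂, by omega, hR₂, trivial⟩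
  | undo =>
    obtain ⟨t₂, σ₂, he₂, ht₂, hR₂⟩ := run_popP hR hqB hq hnB
    refine ⟨t₁ + t₂, σ₂, .seq _ _ _ _ _ _ _ he₁ he₂, ?_, hR₂, trivial⟩
    have e : numThr n (ceilAt w) mx * (150 * K + 400) = 20 * (numThr n (ceilAt w) mx * (K + 3)) +
      numThr n (ceilAt w) mx * (130 * K + 340) := by ring
    omega
  | cost =>
    obtain ⟨t₂, σ₂, he₂, ht₂, hR₂, ha⟩ := run_answerP hF hR
    refine ⟨t₁ + t₂, σ₂, .seq _ _ _ _ _ _ _ he₁ he₂, by omega, hR₂.weaken (Nat.le_succ q), ?_⟩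
    simpa [AnswerOK, ceilAt] using ha

theorem exists_serves_ready (hF : Fit B K n (ceilAt w) mx mn) (ops : List (Op n))
    (hQ : Q * (numThr n (ceilAt w) mx * (K + 3)) ≤ B) (hQB : Q ≤ B) (hq : q + ops.length ≤ Q)
    (h : Ready B K w mx mn q H σ) :
    ∃ T, Serves B minimaxDS w H σ ops T ∧
      T ≤ ops.length * (numThr n (ceilAt w) mx * (150 * K + 400) + 110) := by
  induction ops generalizing q H σ with
  | nil => exact ⟨0, .nil H σ fun i => ⟨h.wts i, h.bits i⟩, by simp⟩
  | cons o ops ih =>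
    rw [List.length_cons] at hq
    have hB : 1 ≤ B := by omega
    obtain ⟨t, σ', he, ht, hR, ha⟩ := exists_execOp (σ := σ) (H := H) hF o
      ((Nat.mul_le_mul_right _ (by omega)).trans hQ) (by omega) (run_prepP_ready hB (h.withArg o))
    obtain ⟨T, hT, hle⟩ := ih (q := q + 1) (by omega) hR
    refine ⟨t + T, .cons H σ σ' o ops t T (fun i => ⟨h.wts i, h.bits i⟩) he ha hT, ?_⟩
    rw [List.length_cons, Nat.succ_mul]
    omega

theorem exists_serves_fresh (hF : Fit B K n (ceilAt w) mx mn) (ops : List (Op n))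
    (hQ : ops.length * (numThr n (ceilAt w) mx * (K + 3)) ≤ B) (hQB : ops.length ≤ B)
    (h : Fresh K w mx mn σ) :
    ∃ T, Serves B minimaxDS w [] σ ops T ∧
      T ≤ n * numThr n (ceilAt w) mx * (150 * K + 800) +
        ops.length * (numThr n (ceilAt w) mx * (150 * K + 400) + 110) := by
  have hst : Stores w [] σ := fun i => ⟨h.wts i, by
    rw [h.zero 0 (by norm_num) (by norm_num)]; simp [bitOf]⟩
  cases ops with
  | nil => exact ⟨0, .nil _ σ hst, by simp⟩
  | cons o ops =>
    rw [List.length_cons] at hQ hQB ⊢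
    have hle := Nat.mul_le_mul_right (numThr n (ceilAt w) mx * (K + 3))
      (Nat.le_add_left 1 ops.length)
    obtain ⟨t, σ', he, ht, hR, ha⟩ := exists_execOp (σ := σ) (H := []) (q := 0) hF o
      (by omega) (by omega) (run_prepP_fresh hF (h.withArg o))
    obtain ⟨T, hT, hle⟩ := exists_serves_ready (q := 1) hF ops hQ hQB (by omega) hR
    refine ⟨t + T, .cons _ σ σ' o ops t T hst he ha hT, ?_⟩
    rw [Nat.succ_mul ops.length]
    omega

end Serve

/-! ### The bounds -/

theorem numThr_le_numCeil {n : ℕ} (w : Fin n → ℝ) (mx : ℤ) :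
    numThr n (ceilAt w) mx ≤ 2 * numCeil w := by
  refine idx_top_le.trans (Nat.mul_le_mul le_rfl (Finset.card_le_card fun a ha => ?_))
  simp only [Finset.mem_image, Finset.mem_range, Finset.mem_univ, true_and] at ha ⊢
  obtain ⟨i, hi, rfl⟩ := ha
  exact ⟨⟨i, hi⟩, by simp [ceilAt, hi]⟩

theorem rank_le_logb {n K : ℕ} (hn : 1 ≤ n) (hK : 1 ≤ K) (h : bsz (K - 1) ≤ n + 1) :
    (K : ℝ) ≤ 3 * max 1 (Real.logb 2 (Real.logb 2 n)) := by
  have hmax : (1 : ℝ) ≤ max 1 (Real.logb 2 (Real.logb 2 n)) := le_max_left _ _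
  rcases Nat.lt_or_ge K 2 with h2 | h2
  · have : K = 1 := by omega
    subst this
    push_cast
    linarith
  obtain ⟨j, rfl⟩ := Nat.exists_eq_add_of_le' h2
  have hj : bsz (j + 1) ≤ n + 1 := h
  have hb : 4 ≤ bsz (j + 1) := Nat.pow_le_pow_right (n := 2) (by norm_num)
    (Nat.le_self_pow (n := j + 1) (by omega) 2)
  have hn2 : n + 1 ≤ n ^ 2 := by nlinarith
  have h3 : ((2 : ℝ) ^ 2 ^ (j + 1)) ≤ (n : ℝ) ^ 2 := by
    exact_mod_cast hj.trans hn2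
  have hn0 : (0 : ℝ) < n := by exact_mod_cast hn
  have h4 := Real.logb_le_logb_of_le (b := 2) (by norm_num) (by positivity) h3
  rw [Real.logb_pow, Real.logb_pow, Real.logb_self_eq_one (by norm_num)] at h4
  push_cast at h4
  have h5 : (2 : ℝ) ^ j ≤ Real.logb 2 n := by
    rw [pow_succ] at h4
    linarith
  have h6 := Real.logb_le_logb_of_le (b := 2) (by norm_num) (by positivity) h5
  rw [Real.logb_pow, Real.logb_self_eq_one (by norm_num)] at h6
  have h7 := le_max_right 1 (Real.logb 2 (Real.logb 2 n))
  push_cast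
  linarith

theorem lemma2 :
    ∃ (D : DataStructure) (C₀ : ℕ), ∀ c : ℕ, ∃ C k : ℕ,
      ∀ (n : ℕ) (_hn : 1 ≤ n) (w : Fin n → ℝ),
        ∃ (t₀ : ℕ) (σ₀ : RamState),
          Exec ((n + 2) ^ k) D.buildP (inputState w) t₀ σ₀ ∧
          t₀ ≤ C₀ * n ∧
          ∀ ops : List (Op n), ops.length ≤ c * n →
            ∃ T : ℕ, Serves ((n + 2) ^ k) D w [] σ₀ ops T ∧
              (T : ℝ) ≤ C * (n * numCeil w * max 1 (Real.logb 2 (Real.logb 2 n))) := by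
  refine ⟨minimaxDS, 300, fun c => ⟨(c + 1) * 6300, c + 20, fun n hn w => ?_⟩⟩
  have hpow : ∀ j ≤ c + 20, (n + 2) ^ j ≤ (n + 2) ^ (c + 20) := fun j hj =>
    Nat.pow_le_pow_right (by omega) hj
  have h3 : 2 * (n + 1) ^ 2 ≤ (n + 2) ^ 3 := by nlinarith
  obtain ⟨t₀, σ₀, he, ht, K, mx, mn, hK1, hK2, hK3, hfr, g1, g2, g3, g4⟩ :=
    run_buildP (w := w) hn (h3.trans (hpow 3 (by omega)))
  refine ⟨t₀, σ₀, he, ht, fun ops hops => ?_⟩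
  have hm := numThr_le (n := n) (u := ceilAt w) (mx := mx)
  have hKn : K ≤ n + 1 := by have := lt_bsz (K - 1); omega
  have hbK : bsz K ≤ (n + 1) ^ 2 := by
    have := bsz_succ (K - 1)
    rw [Nat.sub_add_cancel hK1] at this
    rw [this, pow_two]
    exact Nat.mul_le_mul hK3 hK3
  have hL : numThr n (ceilAt w) mx * (K + 3) ≤ (n + 2) ^ 4 := by
    rw [show (n + 2) ^ 4 = (n + 2) ^ 2 * (n + 2) ^ 2 by ring]
    exact Nat.mul_le_mul (hm.trans (by nlinarith)) (by nlinarith)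
  have hlen : ops.length ≤ (n + 2) ^ (c + 1) := by
    refine hops.trans ?_
    rw [pow_succ]
    exact Nat.mul_le_mul (c.lt_two_pow_self.le.trans (Nat.pow_le_pow_left (by omega) c)) (by omega)
  have hF : Fit ((n + 2) ^ (c + 20)) K n (ceilAt w) mx mn :=
    { hn := hn, hK := hK1, hnK := hK2, le := g1, eq := g2, ge := g3, eq' := g4
      hB := by
        refine (Nat.pow_le_pow_left ((Nat.mul_le_mul le_rfl hbK).trans h3) 5).trans ?_
        rw [← pow_mul]
        exact hpow _ (by omega)
      log := by
        refine (Nat.mul_le_mul (show n ≤ (n + 2) ^ 1 by rw [pow_one]; omega) hL).trans ?_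
        rw [← pow_add]
        exact hpow _ (by omega) }
  obtain ⟨T, hT, hle⟩ := exists_serves_fresh hF ops (by
    refine (Nat.mul_le_mul hlen hL).trans ?_
    rw [← pow_add]
    exact hpow _ (by omega)) (hlen.trans (hpow _ (by omega))) hfr
  refine ⟨T, hT, ?_⟩
  have hd := numThr_le_numCeil w mx
  have hlog := rank_le_logb hn hK1 hK3
  have hm0 : 0 < numThr n (ceilAt w) mx := by have := hF.idx_lt (i := 0) hn; omega
  have hTle : T ≤ (c + 1) * 1050 * (n * (2 * numCeil w) * K) := by
    generalize numThr n (ceilAt w) mx = m at *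
    have e1 : n * m * (150 * K + 800) ≤ 1050 * (n * m * K) := by
      calc n * m * (150 * K + 800) ≤ n * m * (1050 * K) := Nat.mul_le_mul_left _ (by omega)
        _ = _ := by ring
    have e2 : m * (150 * K + 400) + 110 ≤ 1050 * (m * K) := by
      have : 1 * 1 ≤ m * K := Nat.mul_le_mul hm0 hK1
      have : m * 1 ≤ m * K := Nat.mul_le_mul le_rfl hK1
      have e : m * (150 * K + 400) = 150 * (m * K) + 400 * m := by ring
      rw [e]
      linarith
    have e3 : T ≤ 1050 * (n * m * K) + c * n * (1050 * (m * K)) :=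
      hle.trans (Nat.add_le_add e1 (Nat.mul_le_mul hops e2))
    calc T ≤ _ := e3
      _ = (c + 1) * 1050 * (n * m * K) := by ring
      _ ≤ _ := Nat.mul_le_mul le_rfl (Nat.mul_le_mul (Nat.mul_le_mul le_rfl hd) le_rfl)
  calc (T : ℝ) ≤ ((c + 1) * 1050 * (n * (2 * numCeil w) * K) : ℕ) := by exact_mod_cast hTle
    _ = ((c : ℝ) + 1) * 1050 * (n * (2 * numCeil w)) * K := by push_cast; ring
    _ ≤ ((c : ℝ) + 1) * 1050 * (n * (2 * numCeil w)) *
        (3 * max 1 (Real.logb 2 (Real.logb 2 n))) :=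
      mul_le_mul_of_nonneg_left hlog (by positivity)
    _ = _ := by push_cast; ring
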